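/- Let $K$ be a two-dimensional local field: a complete discrete valuation field with valuation ring $\mathcal O_K$, whose residue field $\bar K$ is again a complete discrete valuation field, with finite residue field $\mathbb F_q$. Let $K$ carry a topology for which it is a topological additive group, multiplication by each fixed element is continuous, all quotients $L'/L$ of lattices $L\subseteq L'$ in $K^n$ ($n\ge 0$; a lattice is an $\mathcal O_K$-submodule $g\mathcal O_K^n$ with $g\in GL_n(K)$) are locally compact Hausdorff groups, and which induces on $\bar K=\mathcal O_K/\mathfrak m_K$ the topology of its valuation (as the natural topology of $K$ does). Let $\mathbb R_+^*$ be the multiplicative group of positive real numbers. (a) Let $St(K)$ be the Steinberg group of $K$, $SL(K)=\varinjlim_n SL_n(K)$, $K_2(K)=\ker(St(K)\to SL(K))$ with its symbols $(f,g)$ for $f,g\in K^*$, and let $\widetilde{SL_2(K)}$ be the pullback of the universal central extension $1\to K_2(K)\to St(K)\to SL(K)\to 1$ to $SL_2(K)$. The action of $K^*$ on $SL(K)$ by conjugation by the matrices $\mathrm{diag}(a,1,1,\dots)$ lifts to $St(K)$, and it gives the central extension $$1\to K_2(K)\to \widehat{GL_2(K)}=\widetilde{SL_2(K)}\rtimes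 K^*\to GL_2(K)=SL_2(K)\rtimes K^*\to 1 .$$ (b) For lattices $L,L'$ in $K^n$ let $\mu(L\mid L')$ be the $\mathbb R_+^*$-torsor of relative Haar measures: $\mu(L\mid L')\otimes\mu(L'\mid L'')=\mu(L\mid L'')$, and $\mu(L\mid L')$ is the torsor of the nonzero Haar measures on $L'/L$ if $L\subseteq L'$. Let $\widetilde{GL_n(K)}_{\mathbb R_+^*}$ be the group of the pairs $(g,\mu)$ with $g\in GL_n(K)$ and $\mu\in\mu(\mathcal O_K^n\mid g\mathcal O_K^n)$, with the multiplication $(g_1,\mu_1)(g_2,\mu_2)=(g_1g_2,\mu_1\otimes g_1(\mu_2))$, where $g_1(\mu_2)$ is the image of $\mu_2$ under $g_1$. Let $\theta:(g,\mu)\mapsto g$. The group $K^*$ acts on $\theta^{-1}(SL_2(K))$, where $\theta$ is taken for $n=2$, by conjugation by lifts of the matrices $\mathrm{diag}(a,1)$, and this gives the central extension $$1\to \mathbb R_+^*\to \widehat{GL_2(K)}_{\mathbb R_+^*}=\theta^{-1}(SL_2(K))\rtimes K^*\to GL_2(K)\to 1 .$$ (c) For $f,g\in K^*$ let $$\nu_K(f,g)=\nu_{\bar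 K}\Bigl(\,\overline{f^{\nu_K(g)}/g^{\nu_K(f)}}\,\Bigr)\in\mathbb Z,$$ where $\nu_K:K^*\to\mathbb Z$ and $\nu_{\bar K}:\bar K^*\to\mathbb Z$ are the normalized discrete valuations. Then there is exactly one homomorphism $\varphi: K_2(K)\to\mathbb R_+^*$ with $\varphi((f,g))=q^{-\nu_K(f,g)}$ for all $f,g\in K^*$, and the central extension $\widehat{GL_2(K)}_{\mathbb R_+^*}$ is obtained from the central extension $\widehat{GL_2(K)}$ by means of $\varphi$: it is equivalent, as an extension of $GL_2(K)$ by $\mathbb R_+^*$, to the pushout of $\widehat{GL_2(K)}$ along $\varphi$. -/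

import Mathlib

open scoped commutatorElement

/-- A generator `x_{ij}(r)`, `i ≠ j`, of the Steinberg group. -/
structure SteinbergGen (K : Type*) where
  i : ℕ
  j : ℕ
  ne : i ≠ j
  r : K

/-- The generator `x_{ij}(r)` as a word. -/
def SteinbergGen.word {K : Type*} (i j : ℕ) (h : i ≠ j) (r : K) : FreeGroup (SteinbergGen K) :=
  FreeGroup.of ⟨i, j, h, r⟩

/-- The Steinberg relators. -/
inductive SteinbergRel (K : Type*) [Field K] : FreeGroup (SteinbergGen K) → Prop
  | add (i j : ℕ) (h : i ≠ j) (r s : K) :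
      SteinbergRel K (SteinbergGen.word i j h r * SteinbergGen.word i j h s *
        (SteinbergGen.word i j h (r + s))⁻¹)
  | mul (i j k : ℕ) (hij : i ≠ j) (hjk : j ≠ k) (hik : i ≠ k) (r s : K) :
      SteinbergRel K (⁅SteinbergGen.word i j hij r, SteinbergGen.word j k hjk s⁆ *
        (SteinbergGen.word i k hik (r * s))⁻¹)
  | comm (i j k l : ℕ) (hij : i ≠ j) (hkl : k ≠ l) (hjk : j ≠ k) (hil : i ≠ l) (r s : K) :
      SteinbergRel K ⁅SteinbergGen.word i j hij r, SteinbergGen.word k l hkl s⁆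

/-- The (stable) Steinberg group `St(K)`, with generators `x_{ij}(r)` for all `i ≠ j` in `ℕ`. -/
abbrev SteinbergGroup (K : Type*) [Field K] : Type _ :=
  PresentedGroup {w : FreeGroup (SteinbergGen K) | SteinbergRel K w}

namespace SteinbergGroup

variable {K : Type*} [Field K]

/-- The element `x_{ij}(r)` of `St(K)`. -/
def x (i j : ℕ) (h : i ≠ j) (r : K) : SteinbergGroup K :=
  PresentedGroup.mk _ (SteinbergGen.word i j h r)

theorem x_mul_x (i j : ℕ) (h : i ≠ j) (r s : K) : x i j h r * x i j h s = x i j h (r + s) := by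
  have := PresentedGroup.one_of_mem (rels := {w | SteinbergRel K w}) (SteinbergRel.add i j h r s)
  simpa [mul_inv_eq_one, x] using this

theorem commutator_x_x (i j k : ℕ) (hij : i ≠ j) (hjk : j ≠ k) (hik : i ≠ k) (r s : K) :
    ⁅x i j hij r, x j k hjk s⁆ = x i k hik (r * s) := by
  have := PresentedGroup.one_of_mem (rels := {w | SteinbergRel K w})
    (SteinbergRel.mul i j k hij hjk hik r s)
  simpa [mul_inv_eq_one, map_commutatorElement, x] using this

theorem commutator_x_x_eq_one (i j k l : ℕ) (hij : i ≠ j) (hkl : k ≠ l) (hjk : j ≠ k) (hil : i ≠ l)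
    (r s : K) : ⁅x i j hij r, x k l hkl s⁆ = 1 := by
  have := PresentedGroup.one_of_mem (rels := {w | SteinbergRel K w})
    (SteinbergRel.comm i j k l hij hkl hjk hil r s)
  simpa [map_commutatorElement, x] using this

/-- A family of elements satisfying the Steinberg relations defines a homomorphism. -/
def lift {G : Type*} [Group G] (f : ∀ i j : ℕ, i ≠ j → K → G)
    (h₁ : ∀ i j h r s, f i j h r * f i j h s = f i j h (r + s))
    (h₂ : ∀ i j k hij hjk hik r s, ⁅f i j hij r, f j k hjk s⁆ = f i k hik (r * s))
    (h₃ : ∀ i j k l hij hkl, j ≠ k → i ≠ l → ∀ r s, ⁅f i j hij r, f k l hkl s⁆ = 1) :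
    SteinbergGroup K →* G :=
  PresentedGroup.toGroup (f := fun g : SteinbergGen K => f g.i g.j g.ne g.r) (by
    rintro _ (⟨i, j, h, r, s⟩ | ⟨i, j, k, hij, hjk, hik, r, s⟩ |
      ⟨i, j, k, l, hij, hkl, hjk, hil, r, s⟩)
    · simp [SteinbergGen.word, h₁]
    · simp [SteinbergGen.word, map_commutatorElement, h₂ i j k hij hjk hik]
    · simp [SteinbergGen.word, map_commutatorElement, h₃ i j k l hij hkl hjk hil])

@[simp] theorem lift_x {G : Type*} [Group G] (f : ∀ i j : ℕ, i ≠ j → K → G) (h₁ h₂ h₃)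
    (i j : ℕ) (h : i ≠ j) (r : K) : lift f h₁ h₂ h₃ (x i j h r) = f i j h r :=
  PresentedGroup.toGroup.of _

theorem hom_ext {G : Type*} [Group G] {f g : SteinbergGroup K →* G}
    (h : ∀ i j hij r, f (x i j hij r) = g (x i j hij r)) : f = g :=
  PresentedGroup.ext fun a => h a.i a.j a.ne a.r

end SteinbergGroup

/-! ### The group `SL(K) = ⋃ SL_n(K)` acting on `K^∞ = ⨁_ℕ K` -/

section Stable

variable (K : Type*) [Field K]

/-- The linear map `K^∞ → K^∞` with the single matrix entry `r` in place `(i, j)`. -/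
noncomputable def matrixUnit (i j : ℕ) (r : K) : Module.End K (ℕ →₀ K) :=
  Finsupp.lsingle i ∘ₗ (r • Finsupp.lapply j)

variable {K} in
theorem matrixUnit_apply (i j : ℕ) (r : K) (v : ℕ →₀ K) :
    matrixUnit K i j r v = Finsupp.single i (r * v j) := by
  simp [matrixUnit]

variable {K} in
theorem matrixUnit_mul_same (i j k : ℕ) (r s : K) :
    matrixUnit K i j r * matrixUnit K j k s = matrixUnit K i k (r * s) := by
  refine LinearMap.ext fun v => ?_; simp [matrixUnit_apply, mul_assoc]

variable {K} in
theorem matrixUnit_mul_ne (i j k l : ℕ) (h : j ≠ k) (r s : K) :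
    matrixUnit K i j r * matrixUnit K k l s = 0 := by
  refine LinearMap.ext fun v => ?_; simp [matrixUnit_apply, h]

variable {K} in
theorem matrixUnit_add (i j : ℕ) (r s : K) :
    matrixUnit K i j (r + s) = matrixUnit K i j r + matrixUnit K i j s := by
  refine LinearMap.ext fun v => ?_; simp [matrixUnit_apply, add_mul]

/-- The elementary matrix `e_{ij}(r) = 1 + r E_{ij}`. -/
noncomputable def elementary (i j : ℕ) (h : i ≠ j) (r : K) :
    LinearMap.GeneralLinearGroup K (ℕ →₀ K) where
  val := 1 + matrixUnit K i j r
  inv := 1 + matrixUnit K i j (-r)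
  val_inv := by
    have h0 : matrixUnit K i j (0 : K) = 0 := by refine LinearMap.ext fun v => ?_; simp [matrixUnit_apply]
    simp only [mul_add, add_mul, mul_one, one_mul, matrixUnit_mul_ne _ _ _ _ h.symm, add_zero,
      add_assoc, ← matrixUnit_add, add_neg_cancel, h0]
  inv_val := by
    have h0 : matrixUnit K i j (0 : K) = 0 := by refine LinearMap.ext fun v => ?_; simp [matrixUnit_apply]
    simp only [mul_add, add_mul, mul_one, one_mul, matrixUnit_mul_ne _ _ _ _ h.symm, add_zero,
      add_assoc, ← matrixUnit_add, neg_add_cancel, h0]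

/-- The homomorphism `St(K) → SL(K) ⊂ Aut(K^∞)`, `x_{ij}(r) ↦ e_{ij}(r)`. Its image is the subgroup
`SL(K)`, the union of the groups `SL_n(K)` embedded by `stabilize`. -/
noncomputable def SteinbergGroup.toAut :
    SteinbergGroup K →* LinearMap.GeneralLinearGroup K (ℕ →₀ K) :=
  SteinbergGroup.lift (elementary K)
    (by
      intro i j h r s
      ext1
      simp only [elementary, Units.val_mul, matrixUnit_add, mul_add, add_mul,
        matrixUnit_mul_ne _ _ _ _ h.symm, one_mul, mul_one, add_zero]
      abel)
    (by
      intro i j k hij hjk hik r s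
      rw [commutatorElement_def, mul_inv_eq_iff_eq_mul, mul_inv_eq_iff_eq_mul]
      ext1
      simp only [elementary, Units.val_mul, mul_add, add_mul, one_mul, mul_one,
        matrixUnit_mul_same, matrixUnit_mul_ne _ _ _ _ hik.symm,
        matrixUnit_mul_ne _ _ _ _ hjk.symm, add_zero]
      abel)
    (by
      intro i j k l hij hkl hjk hil r s
      rw [commutatorElement_def, mul_inv_eq_iff_eq_mul, mul_inv_eq_iff_eq_mul]
      ext1
      simp only [elementary, Units.val_mul, mul_add, add_mul, one_mul, mul_one,
        matrixUnit_mul_ne _ _ _ _ hjk, matrixUnit_mul_ne _ _ _ _ hil.symm, add_zero]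
      abel)

/-- `K_2(K)` is the kernel of `St(K) → SL(K)`. -/
abbrev K2 : Type _ := (SteinbergGroup.toAut K).ker

/-- The projection `K^∞ → K^n` to the first `n` coordinates. -/
noncomputable def firstCoords (n : ℕ) : (ℕ →₀ K) →ₗ[K] (Fin n → K) :=
  LinearMap.pi fun i => Finsupp.lapply (i : ℕ)

/-- The inclusion `K^n → K^∞` as the first `n` coordinates. -/
noncomputable def inclCoords (n : ℕ) : (Fin n → K) →ₗ[K] (ℕ →₀ K) :=
  ∑ i : Fin n, Finsupp.lsingle (i : ℕ) ∘ₗ LinearMap.proj i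

theorem firstCoords_inclCoords (n : ℕ) (v : Fin n → K) :
    firstCoords K n (inclCoords K n v) = v := by
  ext i
  simp [firstCoords, inclCoords, Finsupp.single_apply, Fin.val_inj]

/-- An `n × n` matrix `A` acts on `K^∞` by `A` on the first `n` coordinates and by the identity on
the others. -/
noncomputable def stabilizeMatrix (n : ℕ) : Matrix (Fin n) (Fin n) K →* Module.End K (ℕ →₀ K) where
  toFun A := 1 + inclCoords K n ∘ₗ Matrix.toLin' (A - 1) ∘ₗ firstCoords K n
  map_one' := by simp
  map_mul' A B := by
    refine LinearMap.ext fun v => ?_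
    have h : A * B - 1 = (A - 1) + (B - 1) + (A - 1) * (B - 1) := by noncomm_ring
    simp only [h, LinearMap.add_apply, Module.End.mul_apply, Module.End.one_apply,
      LinearMap.comp_apply, map_add, firstCoords_inclCoords, Matrix.toLin'_mul]
    abel

/-- The embedding `GL_n(K) → GL(K) ⊂ Aut(K^∞)` in the upper left corner. -/
noncomputable def stabilize (n : ℕ) :
    Matrix.GeneralLinearGroup (Fin n) K →* LinearMap.GeneralLinearGroup K (ℕ →₀ K) :=
  Units.map (stabilizeMatrix K n)

end Stable


/-! ### Extensions of `GL_2(K) = SL_2(K) ⋊ Kˣ` -/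

section Semidirect

/-- An action of a group by endomorphisms is an action by automorphisms. -/
def mulAutOfEnd {G N : Type*} [Group G] [Group N] (f : G → N →* N)
    (h_one : ∀ n, f 1 n = n) (h_mul : ∀ a b n, f (a * b) n = f a (f b n)) : G →* MulAut N where
  toFun a :=
    { toFun := f a
      invFun := f a⁻¹
      left_inv := fun n => by rw [← h_mul, inv_mul_cancel, h_one]
      right_inv := fun n => by rw [← h_mul, mul_inv_cancel, h_one]
      map_mul' := map_mul (f a) }
  map_one' := by ext n; exact h_one n
  map_mul' a b := by ext n; exact h_mul a b n

variable (K : Type*) [Field K]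

/-- The group `GL_2(K)`. -/
abbrev GL2 : Type _ := Matrix.GeneralLinearGroup (Fin 2) K

/-- The embedding `Kˣ → GL_2(K)`, `a ↦ diag(a, 1)`, in the upper left corner. -/
def upperLeft : Kˣ →* GL2 K where
  toFun a :=
    { val := Matrix.diagonal ![(a : K), 1]
      inv := Matrix.diagonal ![((a⁻¹ : Kˣ) : K), 1]
      val_inv := by
        rw [Matrix.diagonal_mul_diagonal, ← Matrix.diagonal_one]
        congr 1; ext i; fin_cases i <;> simp
      inv_val := by
        rw [Matrix.diagonal_mul_diagonal, ← Matrix.diagonal_one]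
        congr 1; ext i; fin_cases i <;> simp }
  map_one' := by
    ext1
    simp only [Units.val_one]
    rw [← Matrix.diagonal_one]
    congr 1; ext i; fin_cases i <;> simp
  map_mul' a b := by
    ext1
    simp only [Units.val_mul]
    rw [Matrix.diagonal_mul_diagonal]
    congr 1; ext i; fin_cases i <;> simp

theorem det_upperLeft (a : Kˣ) : Matrix.GeneralLinearGroup.det (upperLeft K a) = a := by
  ext; simp [upperLeft]

/-- Let `1 → A → N → SL_2(K) → 1` be an extension, and let `Kˣ` act on `N`, compatibly with its
action on `SL_2(K)` by conjugation by the matrices `diag(a, 1)`. Then `N ⋊ Kˣ` is an extension of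
`SL_2(K) ⋊ Kˣ = GL_2(K)` by `A`, with the projection `(n, a) ↦ p(n) diag(a, 1)`. -/
def semidirectExtension {A N : Type*} [Group A] [Group N] (i : A →* N) (p : N →* GL2 K)
    (hi : Function.Injective i) (hip : i.range = p.ker)
    (hp : ∀ g : GL2 K, Matrix.GeneralLinearGroup.det g = 1 ↔ g ∈ p.range)
    (φ : Kˣ →* MulAut N) (hφ : ∀ a n, p (φ a n) = upperLeft K a * p n * (upperLeft K a)⁻¹) :
    GroupExtension A (N ⋊[φ] Kˣ) (GL2 K) where
  inl := SemidirectProduct.inl.comp i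
  rightHom := SemidirectProduct.lift p (upperLeft K) (fun a => by ext1 n; simp [hφ])
  inl_injective := SemidirectProduct.inl_injective.comp hi
  range_inl_eq_ker_rightHom := by
    ext ⟨n, a⟩
    rw [MonoidHom.mem_ker, MonoidHom.mem_range]
    constructor
    · rintro ⟨b, hb⟩
      rw [← hb]
      have : i b ∈ p.ker := hip ▸ ⟨b, rfl⟩
      simpa using this
    · intro h
      have h1 : p n * upperLeft K a = 1 := h
      have h2 := congrArg Matrix.GeneralLinearGroup.det h1
      rw [map_mul, (hp _).2 ⟨n, rfl⟩, det_upperLeft, one_mul, map_one] at h2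
      subst h2
      rw [map_one, mul_one] at h1
      obtain ⟨b, hb⟩ : n ∈ i.range := hip ▸ h1
      exact ⟨b, by rw [← hb]; rfl⟩
  rightHom_surjective g := by
    obtain ⟨n, hn⟩ := (hp (g * (upperLeft K (Matrix.GeneralLinearGroup.det g))⁻¹)).1 (by
      rw [map_mul, map_inv, det_upperLeft, mul_inv_cancel])
    refine ⟨⟨n, Matrix.GeneralLinearGroup.det g⟩, ?_⟩
    change p n * _ = g
    rw [hn, inv_mul_cancel_right]

end Semidirect

/-! ### The extension of `GL_2(K)` by `K_2(K)` -/

section SteinbergExtension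

variable (K : Type*) [Field K]

/-- For `d = diag(d_0, d_1, …)` the automorphism `x_{ij}(r) ↦ x_{ij}(d_i r d_j⁻¹)` of `St(K)`. It
lifts the conjugation by `d` on `SL(K)`. -/
def diagHom (d : ℕ → Kˣ) : SteinbergGroup K →* SteinbergGroup K :=
  SteinbergGroup.lift (fun i j h r => SteinbergGroup.x i j h (d i * r * ((d j)⁻¹ : Kˣ)))
    (fun i j h r s => by rw [SteinbergGroup.x_mul_x]; congr 1; ring)
    (fun i j k hij hjk hik r s => by
      rw [SteinbergGroup.commutator_x_x _ _ _ _ _ hik]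
      congr 1
      have : ((d j)⁻¹ : Kˣ) * (d j : K) = 1 := by simp
      linear_combination (d i * r * s * ((d k)⁻¹ : Kˣ) : K) * this)
    (fun i j k l hij hkl hjk hil r s => SteinbergGroup.commutator_x_x_eq_one _ _ _ _ _ _ hjk hil _ _)

/-- The action of `Kˣ` on `St(K)` which lifts its action on `SL(K)` by conjugation by the matrices
`diag(a, 1, 1, …)`. -/
def cornerAction : Kˣ → SteinbergGroup K →* SteinbergGroup K :=
  fun a => diagHom K (Pi.mulSingle 0 a)

theorem cornerAction_one (s : SteinbergGroup K) : cornerAction K 1 s = s := by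
  suffices h : cornerAction K 1 = MonoidHom.id _ by rw [h]; rfl
  apply SteinbergGroup.hom_ext
  intro i j hij r
  simp [cornerAction, diagHom]

theorem cornerAction_mul (a b : Kˣ) (s : SteinbergGroup K) :
    cornerAction K (a * b) s = cornerAction K a (cornerAction K b s) := by
  suffices h : cornerAction K (a * b) = (cornerAction K a).comp (cornerAction K b) by rw [h]; rfl
  apply SteinbergGroup.hom_ext
  intro i j hij r
  simp only [cornerAction, diagHom, Pi.mulSingle_mul, SteinbergGroup.lift_x, MonoidHom.comp_apply,
    Pi.mul_apply, mul_inv, Units.val_mul]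
  congr 1
  ring

theorem stabilize_upperLeft_apply (a : Kˣ) (v : ℕ →₀ K) (k : ℕ) :
    ((stabilize K 2 (upperLeft K a) : LinearMap.GeneralLinearGroup K (ℕ →₀ K)) :
      Module.End K (ℕ →₀ K)) v k = (Pi.mulSingle 0 a : ℕ → Kˣ) k * v k := by
  simp only [stabilize, stabilizeMatrix, upperLeft, firstCoords, inclCoords, Units.coe_map,
    MonoidHom.coe_mk, OneHom.coe_mk, LinearMap.add_apply, Module.End.one_apply,
    LinearMap.comp_apply, Finsupp.add_apply, Matrix.toLin'_apply, Fin.sum_univ_two,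
    LinearMap.proj_apply, Finsupp.lsingle_apply, Matrix.sub_mulVec, Matrix.mulVec_diagonal,
    Pi.sub_apply, LinearMap.pi_apply, Finsupp.lapply_apply, Matrix.one_mulVec]
  rcases Nat.eq_zero_or_pos k with rfl | hk
  · simp
  · simp [hk.ne']

theorem toAut_cornerAction (a : Kˣ) (s : SteinbergGroup K) :
    SteinbergGroup.toAut K (cornerAction K a s) =
      stabilize K 2 (upperLeft K a) * SteinbergGroup.toAut K s *
        (stabilize K 2 (upperLeft K a))⁻¹ := by
  suffices h : (SteinbergGroup.toAut K).comp (cornerAction K a) =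
      (MulAut.conj (stabilize K 2 (upperLeft K a))).toMonoidHom.comp (SteinbergGroup.toAut K) by
    exact DFunLike.congr_fun h s
  apply SteinbergGroup.hom_ext
  intro i j hij r
  simp only [cornerAction, diagHom, SteinbergGroup.toAut, SteinbergGroup.lift_x,
    MonoidHom.comp_apply, MulEquiv.toMonoidHom_eq_coe, MonoidHom.coe_coe, MulAut.conj_apply]
  rw [eq_mul_inv_iff_mul_eq]
  ext1
  refine LinearMap.ext fun v => Finsupp.ext fun k => ?_
  simp only [Units.val_mul, Module.End.mul_apply, elementary, LinearMap.add_apply,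
    Module.End.one_apply, Finsupp.add_apply, matrixUnit_apply, stabilize_upperLeft_apply, mul_add,
    Finsupp.single_apply]
  congr 1
  split_ifs with h
  · subst h
    simp [mul_assoc]
  · simp

/-- The pullback `SL_2(K)~` of `St(K) → SL(K)` along `SL_2(K) → SL(K)`. -/
def steinbergSL2 : Subgroup (SteinbergGroup K × GL2 K) where
  carrier := {x | Matrix.GeneralLinearGroup.det x.2 = 1 ∧
    SteinbergGroup.toAut K x.1 = stabilize K 2 x.2}
  one_mem' := by simp
  mul_mem' {x y} hx hy := by
    constructor
    · rw [Prod.snd_mul, map_mul, hx.1, hy.1, one_mul]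
    · rw [Prod.fst_mul, Prod.snd_mul, map_mul, map_mul, hx.2, hy.2]
  inv_mem' {x} hx := by
    constructor
    · rw [Prod.snd_inv, map_inv, hx.1, inv_one]
    · rw [Prod.fst_inv, Prod.snd_inv, map_inv, map_inv, hx.2]

/-- The action of `Kˣ` on the pullback `SL_2(K)~`, by conjugation by `diag(a, 1)` on `SL_2(K)` and
by its lift on `St(K)`. -/
def steinbergAction : Kˣ →* MulAut (steinbergSL2 K) :=
  mulAutOfEnd
    (fun a =>
      { toFun := fun x => ⟨(cornerAction K a x.1.1, upperLeft K a * x.1.2 * (upperLeft K a)⁻¹), by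
          constructor
          · simp [x.2.1]
          · simp only [toAut_cornerAction, x.2.2, map_mul, map_inv]⟩
        map_one' := by ext1; simp
        map_mul' := fun x y => by ext1; simp [mul_assoc] })
    (fun x => by ext1; simp [cornerAction_one])
    (fun a b x => by ext1; simp [cornerAction_mul, mul_assoc])

/-- The inclusion of `K_2(K)` into `SL_2(K)~`. -/
def steinbergInl : K2 K →* steinbergSL2 K where
  toFun k := ⟨(k.1, 1), map_one _, (MonoidHom.mem_ker.1 k.2).trans (map_one _).symm⟩
  map_one' := rfl
  map_mul' k l := by ext1; simp

/-- The projection of `SL_2(K)~` to `SL_2(K)`, as a map to `GL_2(K)`. -/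
def steinbergProj : steinbergSL2 K →* GL2 K := (MonoidHom.snd _ _).comp (steinbergSL2 K).subtype

theorem stabilize_transvection (i j : Fin 2) (h : i ≠ j) (r : K) (g : GL2 K)
    (hg : (g : Matrix (Fin 2) (Fin 2) K) = Matrix.transvection i j r) :
    SteinbergGroup.toAut K (SteinbergGroup.x i j (by simpa [Fin.val_inj] using h) r) =
      stabilize K 2 g := by
  ext1
  refine LinearMap.ext fun v => ?_
  simp only [SteinbergGroup.toAut, SteinbergGroup.lift_x, elementary, stabilize, stabilizeMatrix,
    firstCoords, inclCoords, Units.coe_map, hg, Matrix.transvection,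
    MonoidHom.coe_mk, OneHom.coe_mk, LinearMap.add_apply, Module.End.one_apply,
    LinearMap.comp_apply, add_sub_cancel_left, matrixUnit_apply, Matrix.toLin'_apply]
  congr 1
  fin_cases i <;> fin_cases j <;> 
    simp_all [Fin.sum_univ_two]

theorem det_eq_one_iff_mem_range_steinbergProj (g : GL2 K) :
    Matrix.GeneralLinearGroup.det g = 1 ↔ g ∈ (steinbergProj K).range := by
  constructor
  swap
  · rintro ⟨x, rfl⟩
    exact x.2.1
  have key : ∀ (i j : Fin 2) (h : i ≠ j) (r : K) (t : GL2 K),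
      (t : Matrix (Fin 2) (Fin 2) K) = Matrix.transvection i j r →
        t ∈ (steinbergProj K).range := by
    intro i j h r t ht
    refine ⟨⟨(SteinbergGroup.x i j (by simpa [Fin.val_inj] using h) r, t), ?_, ?_⟩, rfl⟩
    · ext
      simp [ht, Matrix.det_transvection_of_ne i j h r]
    · exact stabilize_transvection K i j h r t ht
  have key' : ∀ (i j : Fin 2) (h : i ≠ j) (r : K), ∃ t : GL2 K,
      (t : Matrix (Fin 2) (Fin 2) K) = Matrix.transvection i j r := fun i j h r =>
    ⟨Matrix.GeneralLinearGroup.mkOfDetNeZero (Matrix.transvection i j r)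
      (by simp [Matrix.det_transvection_of_ne i j h r]), rfl⟩
  have main : ∀ g : GL2 K, Matrix.GeneralLinearGroup.det g = 1 →
      (g : Matrix (Fin 2) (Fin 2) K) 1 0 ≠ 0 → g ∈ (steinbergProj K).range := by
    intro g hg hc
    have hd : (g : Matrix (Fin 2) (Fin 2) K) 0 0 * (g : Matrix (Fin 2) (Fin 2) K) 1 1 -
        (g : Matrix (Fin 2) (Fin 2) K) 0 1 * (g : Matrix (Fin 2) (Fin 2) K) 1 0 = 1 := by
      have := congrArg Units.val hg
      simpa [Matrix.det_fin_two] using this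
    obtain ⟨t₁, h₁⟩ := key' 0 1 (by decide)
      (((g : Matrix (Fin 2) (Fin 2) K) 0 0 - 1) / (g : Matrix (Fin 2) (Fin 2) K) 1 0)
    obtain ⟨t₂, h₂⟩ := key' 1 0 (by decide) ((g : Matrix (Fin 2) (Fin 2) K) 1 0)
    obtain ⟨t₃, h₃⟩ := key' 0 1 (by decide)
      (((g : Matrix (Fin 2) (Fin 2) K) 1 1 - 1) / (g : Matrix (Fin 2) (Fin 2) K) 1 0)
    have hprod : g = t₁ * t₂ * t₃ := by
      ext i j
      simp only [Units.val_mul, h₁, h₂, h₃]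
      fin_cases i <;> fin_cases j <;>
        simp [Matrix.transvection, Matrix.mul_apply, Fin.sum_univ_two, Matrix.single_apply] <;>
        field_simp
      all_goals first | ring1 | linear_combination hd | linear_combination (-1 : K) * hd
    rw [hprod]
    exact mul_mem (mul_mem (key _ _ (by decide) _ _ h₁) (key _ _ (by decide) _ _ h₂))
      (key _ _ (by decide) _ _ h₃)
  intro hg
  by_cases hc : (g : Matrix (Fin 2) (Fin 2) K) 1 0 = 0
  · obtain ⟨t, ht⟩ := key' 1 0 (by decide) 1
    have htm := key 1 0 (by decide) 1 t ht
    have : g * t ∈ (steinbergProj K).range := by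
      apply main
      · rw [map_mul, hg, one_mul]
        ext
        simp [ht, Matrix.det_transvection_of_ne (1 : Fin 2) 0 (by decide)]
      · intro h0
        have hd := congrArg Units.val hg
        simp only [Matrix.GeneralLinearGroup.val_det_apply, Matrix.det_fin_two, hc, mul_zero,
          sub_zero, Units.val_one] at hd
        simp [ht, Matrix.mul_apply, Fin.sum_univ_two, Matrix.transvection, Matrix.single_apply,
          hc] at h0
        simp [h0] at hd
    simpa using mul_mem this (inv_mem htm)
  · exact main g hg hc

/-- The extension `1 → K_2(K) → SL_2(K)~ ⋊ Kˣ → GL_2(K) → 1`, where `SL_2(K)~` is the pullback of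
the universal central extension `1 → K_2(K) → St(K) → SL(K) → 1` to `SL_2(K)`. -/
noncomputable def steinbergExtension :
    GroupExtension (K2 K) (steinbergSL2 K ⋊[steinbergAction K] Kˣ) (GL2 K) :=
  semidirectExtension K (steinbergInl K) (steinbergProj K)
    (fun k l h => Subtype.ext (congrArg (fun x : steinbergSL2 K => x.1.1) h))
    (by
      ext x
      rw [MonoidHom.mem_ker, MonoidHom.mem_range]
      constructor
      · rintro ⟨k, rfl⟩
        rfl
      · intro h
        have h2 : x.1.2 = 1 := h
        refine ⟨⟨x.1.1, ?_⟩, Subtype.ext (Prod.ext rfl h2.symm)⟩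
        rw [MonoidHom.mem_ker, x.2.2, h2, map_one])
    (det_eq_one_iff_mem_range_steinbergProj K)
    (steinbergAction K) (fun a n => rfl)

end SteinbergExtension

/-! ### The symbols in `K_2(K)` -/

section Symbol

variable {K : Type*} [Field K]

namespace SteinbergGroup

/-- `w_{ij}(u) = x_{ij}(u) x_{ji}(-u⁻¹) x_{ij}(u)`. -/
def w (i j : ℕ) (h : i ≠ j) (u : Kˣ) : SteinbergGroup K :=
  x i j h (u : K) * x j i h.symm (-((u⁻¹ : Kˣ) : K)) * x i j h (u : K)

/-- `h_{ij}(u) = w_{ij}(u) w_{ij}(-1)`, a lift of the diagonal matrix with `u` and `u⁻¹` in the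
places `i` and `j`. -/
def h (i j : ℕ) (hij : i ≠ j) (u : Kˣ) : SteinbergGroup K := w i j hij u * w i j hij (-1)

theorem toAut_h_apply (i j : ℕ) (hij : i ≠ j) (u : Kˣ) (v : ℕ →₀ K) (k : ℕ) :
    (toAut K (h i j hij u) : Module.End K (ℕ →₀ K)) v k =
      (if k = i then (u : K) else if k = j then (u⁻¹ : Kˣ) else 1) * v k := by
  have e (i j : ℕ) (hij : i ≠ j) (r : K) (v : ℕ →₀ K) :
      (toAut K (x i j hij r) : Module.End K (ℕ →₀ K)) v = v + Finsupp.single i (r * v j) := by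
    simp [toAut, elementary, matrixUnit_apply]
  simp only [h, w, map_mul, Units.val_mul, Module.End.mul_apply, e, Finsupp.add_apply,
    Finsupp.single_apply, hij, hij.symm, if_true, if_false]
  by_cases hi : k = i
  · subst hi
    simp [hij.symm]
    field_simp
    ring
  by_cases hj : k = j
  · subst hj
    simp [hij, hij.symm]
    field_simp
    ring
  simp [hi, hj, Ne.symm hi, Ne.symm hj]

end SteinbergGroup

/-- The symbol `{u, v} = [h_{12}(u), h_{13}(v)] ∈ K_2(K)`. -/
def symbol (u v : Kˣ) : K2 K :=
  ⟨⁅SteinbergGroup.h 0 1 (by decide) u, SteinbergGroup.h 0 2 (by decide) v⁆, by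
    rw [MonoidHom.mem_ker, map_commutatorElement, commutatorElement_eq_one_iff_mul_comm]
    ext1
    refine LinearMap.ext fun f => Finsupp.ext fun k => ?_
    simp only [Units.val_mul, Module.End.mul_apply, SteinbergGroup.toAut_h_apply]
    ring⟩

end Symbol

/-! ### Lattices in `K^n` and Haar measures on their quotients -/

section Lattice

open MeasureTheory

variable (O K : Type*) [CommRing O] [Field K] [Algebra O K] (n : ℕ)

/-- The standard lattice `O^n` in `K^n`. -/
def standardLattice : Submodule O (Fin n → K) :=
  Submodule.pi Set.univ fun _ => LinearMap.range (Algebra.linearMap O K)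

variable {K n} in
/-- The `O`-linear map `K^n → K^n` given by a matrix. -/
noncomputable def glMap (g : Matrix.GeneralLinearGroup (Fin n) K) :
    (Fin n → K) →ₗ[O] (Fin n → K) :=
  (Matrix.toLin' (g : Matrix (Fin n) (Fin n) K)).restrictScalars O

variable {K n} in
theorem glMap_one : glMap O (1 : Matrix.GeneralLinearGroup (Fin n) K) = LinearMap.id := by
  ext1; simp [glMap]

variable {K n} in
theorem glMap_mul (g g' : Matrix.GeneralLinearGroup (Fin n) K) :
    glMap O (g * g') = glMap O g ∘ₗ glMap O g' := by
  ext1; simp [glMap, Matrix.toLin'_mul]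

/-- The `O`-submodules of `K^n` of the form `g O^n` with `g ∈ GL_n(K)`. -/
@[ext]
structure OLattice where
  toSubmodule : Submodule O (Fin n → K)
  exists_eq : ∃ g : Matrix.GeneralLinearGroup (Fin n) K,
    toSubmodule = (standardLattice O K n).map (glMap O g)

namespace OLattice

variable {O K n}

instance : PartialOrder (OLattice O K n) :=
  PartialOrder.lift OLattice.toSubmodule fun _ _ => OLattice.ext

variable (O K n) in
/-- `O^n` as a lattice. -/
def std : OLattice O K n := ⟨standardLattice O K n, 1, by rw [glMap_one, Submodule.map_id]⟩

/-- `GL_n(K)` acts on the set of lattices. -/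
noncomputable instance : MulAction (Matrix.GeneralLinearGroup (Fin n) K) (OLattice O K n) where
  smul g L := ⟨L.1.map (glMap O g), by
    obtain ⟨g', hg'⟩ := L.2
    exact ⟨g * g', by rw [hg', glMap_mul, Submodule.map_comp]⟩⟩
  one_smul L := OLattice.ext (by
    change L.1.map (glMap O 1) = L.1
    rw [glMap_one, Submodule.map_id])
  mul_smul g g' L := OLattice.ext (by
    change L.1.map (glMap O (g * g')) = (L.1.map (glMap O g')).map (glMap O g)
    rw [glMap_mul, Submodule.map_comp])

theorem smul_val (g : Matrix.GeneralLinearGroup (Fin n) K) (L : OLattice O K n) :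
    (g • L).1 = L.1.map (glMap O g) := rfl

theorem smul_mono (g : Matrix.GeneralLinearGroup (Fin n) K) {N L : OLattice O K n} (h : N ≤ L) :
    g • N ≤ g • L := Submodule.map_mono (show N.1 ≤ L.1 from h)

theorem le_comap_smul (g : Matrix.GeneralLinearGroup (Fin n) K) (L : OLattice O K n) :
    L.1 ≤ (g • L).1.comap (glMap O g) := Submodule.le_comap_map _ _

theorem smul_le_comap (g : Matrix.GeneralLinearGroup (Fin n) K) (L : OLattice O K n) :
    (g • L).1 ≤ L.1.comap (glMap O g⁻¹) := by
  rw [smul_val, Submodule.map_le_iff_le_comap, ← Submodule.comap_comp, ← glMap_mul, inv_mul_cancel,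
    glMap_one, Submodule.comap_id]

/-- The group `L / N` (which is used for `N ≤ L` only). -/
def Quot (N L : OLattice O K n) : Type _ := L.1 ⧸ N.1.submoduleOf L.1

namespace Quot

variable {N L M N' L' M' : OLattice O K n}

instance : AddCommGroup (Quot N L) :=
  inferInstanceAs (AddCommGroup (L.1 ⧸ N.1.submoduleOf L.1))

instance : Module O (Quot N L) := inferInstanceAs (Module O (L.1 ⧸ N.1.submoduleOf L.1))

/-- The topology on `L / N`: the quotient of the topology induced on `L` from `K^n`. -/
instance [TopologicalSpace K] : TopologicalSpace (Quot N L) :=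
  inferInstanceAs (TopologicalSpace (L.1 ⧸ N.1.submoduleOf L.1))

instance [TopologicalSpace K] [IsTopologicalAddGroup K] : IsTopologicalAddGroup (Quot N L) :=
  inferInstanceAs (IsTopologicalAddGroup (L.1 ⧸ N.1.submoduleOf L.1))

instance [TopologicalSpace K] : MeasurableSpace (Quot N L) := borel _

instance [TopologicalSpace K] : BorelSpace (Quot N L) := ⟨rfl⟩

/-- The map `L / N → L' / N'` induced by a linear map `f` with `f(N) ⊆ N'` and `f(L) ⊆ L'`. -/
def map (f : (Fin n → K) →ₗ[O] (Fin n → K)) (hN : N.1 ≤ N'.1.comap f) (hL : L.1 ≤ L'.1.comap f) :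
    Quot N L →ₗ[O] Quot N' L' :=
  Submodule.mapQ _ _ (f.restrict hL) fun x hx => hN (show (x : Fin n → K) ∈ N.1 from hx)

theorem map_map (f f' : (Fin n → K) →ₗ[O] (Fin n → K)) (hN : N.1 ≤ N'.1.comap f)
    (hL : L.1 ≤ L'.1.comap f) (hN' : N'.1 ≤ M.1.comap f') (hL' : L'.1 ≤ M'.1.comap f')
    (x : Quot N L) :
    map f' hN' hL' (map f hN hL x) = map (N := N) (L := L) (N' := M) (L' := M') (f' ∘ₗ f)
      (fun _ hy => hN' (hN hy)) (fun _ hy => hL' (hL hy)) x := by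
  obtain ⟨x, rfl⟩ := Submodule.mkQ_surjective _ x
  rfl

theorem map_congr {f f' : (Fin n → K) →ₗ[O] (Fin n → K)} (h : f = f') (hN : N.1 ≤ N'.1.comap f)
    (hL : L.1 ≤ L'.1.comap f) (x : Quot N L) :
    map f hN hL x = map (N := N) (L := L) (N' := N') (L' := L') f' (h ▸ hN) (h ▸ hL) x := by
  subst h; rfl

theorem map_id (hN : N.1 ≤ N.1.comap LinearMap.id) (hL : L.1 ≤ L.1.comap LinearMap.id)
    (x : Quot N L) : map LinearMap.id hN hL x = x := by
  obtain ⟨x, rfl⟩ := Submodule.mkQ_surjective _ x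
  rfl

theorem continuous_map [TopologicalSpace K] {f : (Fin n → K) →ₗ[O] (Fin n → K)}
    (hf : Continuous f) (hN : N.1 ≤ N'.1.comap f) (hL : L.1 ≤ L'.1.comap f) :
    Continuous (map f hN hL) := by
  refine Continuous.quotient_lift ?_ _
  refine continuous_quotient_mk'.comp ?_
  exact (hf.comp continuous_subtype_val).subtype_mk _

/-- The inclusion `L / N → M / N` for `N ≤ L ≤ M`. -/
def incl (h : L ≤ M) : Quot N L →ₗ[O] Quot N M := map LinearMap.id le_rfl h

/-- The projection `M / N → M / L` for `N ≤ L ≤ M`. -/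
def proj (h : N ≤ L) : Quot N M →ₗ[O] Quot L M := map LinearMap.id h le_rfl

theorem proj_surjective (h : N ≤ L) : Function.Surjective (proj (M := M) h) := by
  intro x
  obtain ⟨x, rfl⟩ := Submodule.mkQ_surjective _ x
  exact ⟨Submodule.mkQ _ x, rfl⟩

theorem exists_incl_of_proj_eq (h : N ≤ L) (h' : L ≤ M) {x y : Quot N M}
    (hxy : proj h x = proj h y) : ∃ z : Quot N L, x = y + incl h' z := by
  obtain ⟨x, rfl⟩ := Submodule.mkQ_surjective _ x
  obtain ⟨y, rfl⟩ := Submodule.mkQ_surjective _ y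
  have h1 : x - y ∈ L.1.submoduleOf M.1 := (Submodule.Quotient.eq _).1 hxy
  refine ⟨Submodule.mkQ _ ⟨(x - y : M.1), h1⟩, ?_⟩
  have h2 : Submodule.mkQ (N.1.submoduleOf M.1) x =
      Submodule.mkQ (N.1.submoduleOf M.1) y + Submodule.mkQ (N.1.submoduleOf M.1) (x - y) := by
    rw [← map_add, add_sub_cancel]
  exact h2

end Quot

theorem exists_le_le [IsDomain O] [IsFractionRing O K] (L L' : OLattice O K n) :
    ∃ N : OLattice O K n, N ≤ L ∧ N ≤ L' := by
  classical
  obtain ⟨g, hg⟩ := L.2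
  obtain ⟨g', hg'⟩ := L'.2
  obtain ⟨b, hb⟩ := IsLocalization.exist_integer_multiples_of_finset (nonZeroDivisors O)
    ((Finset.univ.image fun p : Fin n × Fin n =>
        ((g⁻¹ : Matrix.GeneralLinearGroup (Fin n) K) : Matrix (Fin n) (Fin n) K) p.1 p.2) ∪
      (Finset.univ.image fun p : Fin n × Fin n =>
        ((g'⁻¹ : Matrix.GeneralLinearGroup (Fin n) K) : Matrix (Fin n) (Fin n) K) p.1 p.2))
  have hb0 : algebraMap O K b ≠ 0 := by
    simp [nonZeroDivisors.ne_zero b.2]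
  let s : Matrix.GeneralLinearGroup (Fin n) K :=
    Units.map (Matrix.scalar (Fin n)).toMonoidHom (Units.mk0 _ hb0)
  have key : ∀ g : Matrix.GeneralLinearGroup (Fin n) K,
      (∀ i j, IsLocalization.IsInteger O ((b : O) •
        ((g⁻¹ : Matrix.GeneralLinearGroup (Fin n) K) : Matrix (Fin n) (Fin n) K) i j)) →
      (s • std O K n).1 ≤ (standardLattice O K n).map (glMap O g) := by
    intro g h
    rintro _ ⟨v, hv, rfl⟩
    refine ⟨glMap O (g⁻¹ * s) v, ?_, ?_⟩
    · rintro i -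
      have : glMap O (g⁻¹ * s) v i = ∑ j, ((b : O) •
          ((g⁻¹ : Matrix.GeneralLinearGroup (Fin n) K) : Matrix (Fin n) (Fin n) K) i j) * v j := by
        simp [glMap, s, Matrix.mulVec, dotProduct, Algebra.smul_def, mul_comm, mul_left_comm]
      rw [this]
      refine Submodule.sum_mem _ fun j _ => ?_
      obtain ⟨x, hx⟩ := h i j
      obtain ⟨y, hy⟩ := hv j trivial
      exact ⟨x * y, by rw [← hx, ← hy]; simp⟩
    · rw [← LinearMap.comp_apply, ← glMap_mul, mul_inv_cancel_left]
  refine ⟨s • std O K n, ?_, ?_⟩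
  · change (s • std O K n).1 ≤ L.1
    rw [hg]
    exact key g fun i j => hb _ (Finset.mem_union_left _ (Finset.mem_image_of_mem _
      (Finset.mem_univ (i, j))))
  · change (s • std O K n).1 ≤ L'.1
    rw [hg']
    exact key g' fun i j => hb _ (Finset.mem_union_right _ (Finset.mem_image_of_mem
      (fun p : Fin n × Fin n => ((g'⁻¹ : Matrix.GeneralLinearGroup (Fin n) K) :
        Matrix (Fin n) (Fin n) K) p.1 p.2) (Finset.mem_univ (i, j))))

end OLattice

/-- The topologies on `K` for which `K` is a topological additive group, multiplication by a fixed
element is continuous, and the quotients of two lattices in `K^n` are locally compact Hausdorff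
groups. -/
class IsLatticeTopology [TopologicalSpace K] : Prop where
  isTopologicalAddGroup : IsTopologicalAddGroup K
  continuous_mul_left : ∀ a : K, Continuous fun x : K => a * x
  locallyCompactSpace : ∀ (n : ℕ) (N L : OLattice O K n), N ≤ L → LocallyCompactSpace (N.Quot L)
  t2Space : ∀ (n : ℕ) (N L : OLattice O K n), N ≤ L → T2Space (N.Quot L)

variable {O K n} [TopologicalSpace K]

theorem continuous_glMap [IsLatticeTopology O K] (g : Matrix.GeneralLinearGroup (Fin n) K) :
    Continuous (glMap O g) := by
  have := IsLatticeTopology.isTopologicalAddGroup (O := O) (K := K)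
  refine continuous_pi fun i => ?_
  simp only [glMap, LinearMap.coe_restrictScalars, Matrix.toLin'_apply, Matrix.mulVec, dotProduct]
  exact continuous_finsetSum _ fun j _ =>
    (IsLatticeTopology.continuous_mul_left (O := O) _).comp (continuous_apply j)

end Lattice

/-! ### Relative Haar measures and the extension of `GL_n(K)` by `ℝ_{>0}` -/

/-- The multiplicative group of positive real numbers. -/
abbrev PosReal : Type := {x : ℝ // 0 < x}

section Haar

open MeasureTheory

variable {O K : Type*} [CommRing O] [Field K] [Algebra O K] {n : ℕ} [TopologicalSpace K]

/-- For `N ≤ L ≤ M`, the Haar measure `γ` on `M / N` is the tensor product of the Haar measures `α`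
on `L / N` and `β` on `M / L`, i.e. `∫_{M/N} f dγ = ∫_{M/L} (∫_{L/N} f(x + y) dα(y)) dβ(x)` for all
continuous functions `f` with compact support. -/
def IsTensor {N L M : OLattice O K n} (hNL : N ≤ L) (hLM : L ≤ M) (α : Measure (N.Quot L))
    (β : Measure (L.Quot M)) (γ : Measure (N.Quot M)) : Prop :=
  ∀ f : N.Quot M → ℝ, Continuous f → HasCompactSupport f → ∀ F : L.Quot M → ℝ,
    (∀ x, F (OLattice.Quot.proj hNL x) = ∫ y, f (x + OLattice.Quot.incl hLM y) ∂α) →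
      ∫ x, f x ∂γ = ∫ z, F z ∂β

variable (O K n) in
/-- A coherent choice of Haar measures on all the groups `L / N`, for lattices `N ≤ L` in `K^n`:
for `N ≤ L ≤ M` the measure on `M / N` is the tensor product of those on `L / N` and `M / L`. -/
structure HaarSystem where
  meas : ∀ N L : OLattice O K n, N ≤ L → Measure (N.Quot L)
  isAddHaar : ∀ N L h, (meas N L h).IsAddHaarMeasure
  regular : ∀ N L h, (meas N L h).Regular
  isTensor : ∀ N L M (hNL : N ≤ L) (hLM : L ≤ M),
    IsTensor hNL hLM (meas N L hNL) (meas L M hLM) (meas N M (hNL.trans hLM))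

theorem HaarSystem.ext' {h h' : HaarSystem O K n}
    (H : ∀ N L hNL, h.meas N L hNL = h'.meas N L hNL) : h = h' := by
  cases h; cases h'
  congr
  funext N L hNL
  exact H N L hNL

theorem HaarSystem.meas_map_congr (h : HaarSystem O K n) {N L N₁ L₁ N₂ L₂ : OLattice O K n}
    (hN : N₁ = N₂) (hL : L₁ = L₂) (h₁ : N₁ ≤ L₁) (h₂ : N₂ ≤ L₂)
    (f₁ f₂ : (Fin n → K) →ₗ[O] (Fin n → K)) (hf : f₁ = f₂)
    (a₁ : N₁.1 ≤ N.1.comap f₁) (b₁ : L₁.1 ≤ L.1.comap f₁)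
    (a₂ : N₂.1 ≤ N.1.comap f₂) (b₂ : L₂.1 ≤ L.1.comap f₂) :
    (h.meas N₁ L₁ h₁).map (OLattice.Quot.map f₁ a₁ b₁) =
      (h.meas N₂ L₂ h₂).map (OLattice.Quot.map f₂ a₂ b₂) := by
  subst hN hL hf
  rfl

/-- `Rescaled c h h'` says that `h'` is obtained from `h` by multiplying the Haar measure on
`L / N` by `c(L) / c(N)`, for all `N ≤ L`. -/
def Rescaled (c : OLattice O K n → PosReal) (h h' : HaarSystem O K n) : Prop :=
  ∀ N L hNL, h'.meas N L hNL = ENNReal.ofReal ((c L : ℝ) / c N) • h.meas N L hNL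

/-- The `ℝ_{>0}`-torsor `μ(L | L')` of relative Haar measures. It is determined by
`μ(L | L') ⊗ μ(L' | L'') = μ(L | L'')` and by `μ(L | L')` being the torsor of the Haar measures on
`L' / L` if `L ≤ L'`. A coherent choice `h` of Haar measures gives an element `h(L | L')` of it
for all `L` and `L'`, and an element `r` is represented by its ratios `r(h)` to the `h(L | L')`. So
the elements are the functions `r` with `r(h') h'(L | L') = r(h) h(L | L')`, where
`h'(L | L') = (c(L') / c(L)) h(L | L')` if `h'` is obtained from `h` by rescaling with `c`. The
tensor product is the product of functions. For `L ≤ L'` a Haar measure `m` on `L' / L` is the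
element `r` with `m = r(h) h(L | L')` for all `h`. -/
def IsRelMeasure (L L' : OLattice O K n) (r : HaarSystem O K n → PosReal) : Prop :=
  ∀ h h' c, Rescaled c h h' → r h' * c L' = r h * c L

theorem IsRelMeasure.mul {L L' L'' : OLattice O K n} {r s : HaarSystem O K n → PosReal}
    (hr : IsRelMeasure L L' r) (hs : IsRelMeasure L' L'' s) : IsRelMeasure L L'' (r * s) := by
  intro h h' c hc
  have h1 := hr h h' c hc
  have h2 := hs h h' c hc
  calc r h' * s h' * c L'' = r h' * (s h' * c L'') := mul_assoc _ _ _
    _ = (r h' * c L') * s h := by rw [h2]; rw [mul_comm (s h), mul_assoc]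
    _ = r h * s h * c L := by rw [h1, mul_right_comm]

theorem IsRelMeasure.inv {L L' : OLattice O K n} {r : HaarSystem O K n → PosReal}
    (hr : IsRelMeasure L L' r) : IsRelMeasure L' L r⁻¹ := by
  intro h h' c hc
  have h1 := hr h h' c hc
  change (r h')⁻¹ * c L = (r h)⁻¹ * c L'
  rw [inv_mul_eq_iff_eq_mul, mul_left_comm, h1, inv_mul_cancel_left]

theorem isRelMeasure_const (L : OLattice O K n) (t : PosReal) :
    IsRelMeasure L L (fun _ => t) := fun _ _ _ _ => rfl

/-! #### The action of `GL_n(K)` -/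

variable [IsLatticeTopology O K]

/-- The isomorphism `g⁻¹ : g L / g N → L / N` of topological groups. -/
noncomputable def OLattice.Quot.smulInv (g : Matrix.GeneralLinearGroup (Fin n) K)
    (N L : OLattice O K n) : (g • N).Quot (g • L) ≃ₜ+ N.Quot L where
  toFun := OLattice.Quot.map (glMap O g⁻¹) (N.smul_le_comap g) (L.smul_le_comap g)
  invFun := OLattice.Quot.map (glMap O g) (N.le_comap_smul g) (L.le_comap_smul g)
  left_inv x := by
    rw [OLattice.Quot.map_map,
      OLattice.Quot.map_congr (by rw [← glMap_mul, mul_inv_cancel, glMap_one])]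
    exact OLattice.Quot.map_id _ _ _
  right_inv x := by
    rw [OLattice.Quot.map_map,
      OLattice.Quot.map_congr (by rw [← glMap_mul, inv_mul_cancel, glMap_one])]
    exact OLattice.Quot.map_id _ _ _
  map_add' := map_add _
  continuous_toFun := OLattice.Quot.continuous_map (continuous_glMap _) _ _
  continuous_invFun := OLattice.Quot.continuous_map (continuous_glMap _) _ _

theorem OLattice.Quot.smulInv_apply (g : Matrix.GeneralLinearGroup (Fin n) K)
    (N L : OLattice O K n) (x : (g • N).Quot (g • L)) :
    OLattice.Quot.smulInv g N L x =
      OLattice.Quot.map (glMap O g⁻¹) (N.smul_le_comap g) (L.smul_le_comap g) x := rfl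

/-- The action of `g⁻¹` on the coherent choices of Haar measures by transport of structure: the new
measure on `L / N` is the image under `g⁻¹` of the old measure on `g L / g N`. -/
noncomputable def HaarSystem.pull (g : Matrix.GeneralLinearGroup (Fin n) K)
    (h : HaarSystem O K n) : HaarSystem O K n where
  meas N L hNL := (h.meas (g • N) (g • L) (OLattice.smul_mono g hNL)).map
    (OLattice.Quot.smulInv g N L)
  isAddHaar N L hNL := by
    have := IsLatticeTopology.isTopologicalAddGroup (O := O) (K := K)
    have := h.isAddHaar _ _ (OLattice.smul_mono g hNL)
    exact (OLattice.Quot.smulInv g N L).isAddHaarMeasure_map _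
  regular N L hNL := by
    have := h.regular _ _ (OLattice.smul_mono g hNL)
    exact Measure.Regular.map (OLattice.Quot.smulInv g N L).toHomeomorph
  isTensor N L M hNL hLM := by
    intro f hf hfs F hF
    have e1 : ∫ x, f x ∂(h.meas (g • N) (g • M) (OLattice.smul_mono g (hNL.trans hLM))).map
        (OLattice.Quot.smulInv g N M) = ∫ x, f (OLattice.Quot.smulInv g N M x)
          ∂(h.meas (g • N) (g • M) (OLattice.smul_mono g (hNL.trans hLM))) :=
      integral_map_equiv (OLattice.Quot.smulInv g N M).toHomeomorph.toMeasurableEquiv f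
    have e2 : ∫ x, F x ∂(h.meas (g • L) (g • M) (OLattice.smul_mono g hLM)).map
        (OLattice.Quot.smulInv g L M) = ∫ x, F (OLattice.Quot.smulInv g L M x)
          ∂(h.meas (g • L) (g • M) (OLattice.smul_mono g hLM)) :=
      integral_map_equiv (OLattice.Quot.smulInv g L M).toHomeomorph.toMeasurableEquiv F
    rw [e1, e2]
    refine h.isTensor (g • N) (g • L) (g • M) (OLattice.smul_mono g hNL) (OLattice.smul_mono g hLM)
      _ (hf.comp (OLattice.Quot.smulInv g N M).continuous_toFun)
      (hfs.comp_homeomorph (OLattice.Quot.smulInv g N M).toHomeomorph) _ fun x => ?_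
    have e3 : OLattice.Quot.smulInv g L M
        (OLattice.Quot.proj (OLattice.smul_mono g hNL) x) =
          OLattice.Quot.proj hNL (OLattice.Quot.smulInv g N M x) := by
      obtain ⟨x, rfl⟩ := Submodule.mkQ_surjective _ x
      rfl
    have e4 : ∫ y, f (OLattice.Quot.smulInv g N M x + OLattice.Quot.incl hLM y)
        ∂(h.meas (g • N) (g • L) (OLattice.smul_mono g hNL)).map (OLattice.Quot.smulInv g N L) =
        ∫ y, f (OLattice.Quot.smulInv g N M x +
          OLattice.Quot.incl hLM (OLattice.Quot.smulInv g N L y))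
          ∂(h.meas (g • N) (g • L) (OLattice.smul_mono g hNL)) :=
      integral_map_equiv (OLattice.Quot.smulInv g N L).toHomeomorph.toMeasurableEquiv
        (fun y => f (OLattice.Quot.smulInv g N M x + OLattice.Quot.incl hLM y))
    rw [e3, hF, e4]
    refine integral_congr_ae (Filter.Eventually.of_forall fun y => ?_)
    change _ = f (OLattice.Quot.smulInv g N M (x + OLattice.Quot.incl (OLattice.smul_mono g hLM) y))
    rw [map_add]
    obtain ⟨y, rfl⟩ := Submodule.mkQ_surjective _ y
    rfl

theorem HaarSystem.pull_one (h : HaarSystem O K n) : h.pull 1 = h := by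
  refine HaarSystem.ext' fun N L hNL => ?_
  have e := h.meas_map_congr (N := N) (L := L) (one_smul _ N) (one_smul _ L)
    (OLattice.smul_mono 1 hNL) hNL (glMap O 1⁻¹) LinearMap.id (by rw [inv_one, glMap_one])
    (N.smul_le_comap 1) (L.smul_le_comap 1) le_rfl le_rfl
  refine e.trans ?_
  rw [show (OLattice.Quot.map LinearMap.id le_rfl le_rfl : N.Quot L → N.Quot L) = id from
    funext fun x => OLattice.Quot.map_id _ _ x, Measure.map_id]

theorem HaarSystem.pull_mul (g g' : Matrix.GeneralLinearGroup (Fin n) K) (h : HaarSystem O K n) :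
    h.pull (g * g') = (h.pull g).pull g' := by
  refine HaarSystem.ext' fun N L hNL => ?_
  have e := h.meas_map_congr (N := N) (L := L) (mul_smul g g' N) (mul_smul g g' L)
    (OLattice.smul_mono (g * g') hNL) (OLattice.smul_mono g (OLattice.smul_mono g' hNL))
    (glMap O (g * g')⁻¹) (glMap O g'⁻¹ ∘ₗ glMap O g⁻¹) (by rw [mul_inv_rev, glMap_mul])
    (N.smul_le_comap _) (L.smul_le_comap _)
    (fun _ hy => N.smul_le_comap g' ((g' • N).smul_le_comap g hy))
    (fun _ hy => L.smul_le_comap g' ((g' • L).smul_le_comap g hy))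
  refine e.trans ?_
  change _ = Measure.map (OLattice.Quot.smulInv g' N L)
    (Measure.map (OLattice.Quot.smulInv g (g' • N) (g' • L)) _)
  have m₁ : Measurable (OLattice.Quot.smulInv g' N L) :=
    (OLattice.Quot.smulInv g' N L).continuous_toFun.measurable
  have m₂ : Measurable (OLattice.Quot.smulInv g (g' • N) (g' • L)) :=
    (OLattice.Quot.smulInv g (g' • N) (g' • L)).continuous_toFun.measurable
  rw [Measure.map_map m₁ m₂]
  congr 1
  funext x
  exact (OLattice.Quot.map_map _ _ _ _ _ _ x).symm

theorem Rescaled.pull {c : OLattice O K n → PosReal} {h h' : HaarSystem O K n}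
    (H : Rescaled c h h') (g : Matrix.GeneralLinearGroup (Fin n) K) :
    Rescaled (fun L => c (g • L)) (h.pull g) (h'.pull g) := by
  intro N L hNL
  change Measure.map _ _ = _ • Measure.map _ _
  rw [H (g • N) (g • L) (OLattice.smul_mono g hNL), Measure.map_smul]

theorem IsRelMeasure.pull {L L' : OLattice O K n} {r : HaarSystem O K n → PosReal}
    (hr : IsRelMeasure L L' r) (g : Matrix.GeneralLinearGroup (Fin n) K) :
    IsRelMeasure (g • L) (g • L') (fun h => r (h.pull g)) :=
  fun h h' _ H => hr (h.pull g) (h'.pull g) _ (H.pull g)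

/-! #### Coherent choices of Haar measures differ by a rescaling -/

theorem HaarSystem.exists_scalar (h h' : HaarSystem O K n) (N L : OLattice O K n) (hNL : N ≤ L) :
    ∃ t : PosReal, h'.meas N L hNL = ENNReal.ofReal t • h.meas N L hNL := by
  have := IsLatticeTopology.isTopologicalAddGroup (O := O) (K := K)
  have := IsLatticeTopology.locallyCompactSpace n N L hNL
  have := h.isAddHaar N L hNL
  have := h'.isAddHaar N L hNL
  have := h.regular N L hNL
  have := h'.regular N L hNL
  refine ⟨⟨_, NNReal.coe_pos.2
    (Measure.addHaarScalarFactor_pos_of_isAddHaarMeasure (h'.meas N L hNL) (h.meas N L hNL))⟩, ?_⟩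
  rw [ENNReal.ofReal_coe_nnreal]
  exact Measure.isAddLeftInvariant_eq_smul_of_regular _ _

theorem HaarSystem.exists_integral_ne_zero (h : HaarSystem O K n) (N L : OLattice O K n)
    (hNL : N ≤ L) : ∃ f : N.Quot L → ℝ, Continuous f ∧ HasCompactSupport f ∧
      ∫ x, f x ∂h.meas N L hNL ≠ 0 := by
  have := IsLatticeTopology.isTopologicalAddGroup (O := O) (K := K)
  have := IsLatticeTopology.locallyCompactSpace n N L hNL
  have := h.isAddHaar N L hNL
  obtain ⟨f, hf1, hf2, -, hf4⟩ := exists_continuousMap_one_of_isCompact_subset_isOpen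
    (isCompact_singleton (x := (0 : N.Quot L))) isOpen_univ (Set.subset_univ _)
  refine ⟨f, f.continuous, hf2, ne_of_gt ?_⟩
  refine f.continuous.integral_pos_of_hasCompactSupport_nonneg_nonzero (x := 0) hf2
    (fun x => (hf4 x).1) ?_
  rw [hf1 rfl]
  exact one_ne_zero

theorem integral_posReal_smul {X : Type*} [MeasurableSpace X] (m : Measure X) (t : PosReal)
    (f : X → ℝ) : ∫ x, f x ∂(ENNReal.ofReal t • m) = (t : ℝ) * ∫ x, f x ∂m := by
  rw [integral_smul_measure, ENNReal.toReal_ofReal t.2.le, smul_eq_mul]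

theorem HaarSystem.scalar_unique (h : HaarSystem O K n) {N L : OLattice O K n} (hNL : N ≤ L)
    {s t : PosReal}
    (hst : ENNReal.ofReal s • h.meas N L hNL = ENNReal.ofReal t • h.meas N L hNL) : s = t := by
  obtain ⟨f, -, -, hf⟩ := h.exists_integral_ne_zero N L hNL
  have := congrArg (fun m => ∫ x, f x ∂m) hst
  simp only [integral_posReal_smul] at this
  exact Subtype.ext (mul_right_cancel₀ hf this)

/-- The scalar by which the measures of `h` and `h'` on `L / N` differ. -/
noncomputable def HaarSystem.scalar (h h' : HaarSystem O K n) (N L : OLattice O K n)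
    (hNL : N ≤ L) : PosReal := (h.exists_scalar h' N L hNL).choose

theorem HaarSystem.scalar_spec (h h' : HaarSystem O K n) (N L : OLattice O K n) (hNL : N ≤ L) :
    h'.meas N L hNL = ENNReal.ofReal (h.scalar h' N L hNL) • h.meas N L hNL :=
  (h.exists_scalar h' N L hNL).choose_spec

theorem HaarSystem.scalar_mul (h h' : HaarSystem O K n) {N L M : OLattice O K n} (hNL : N ≤ L)
    (hLM : L ≤ M) :
    h.scalar h' N M (hNL.trans hLM) = h.scalar h' N L hNL * h.scalar h' L M hLM := by
  have := IsLatticeTopology.isTopologicalAddGroup (O := O) (K := K)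
  have := h.isAddHaar N L hNL
  obtain ⟨f, hf, hfs, hf0⟩ := h.exists_integral_ne_zero N M (hNL.trans hLM)
  obtain ⟨F, hF⟩ : ∃ F : L.Quot M → ℝ, ∀ x, F (OLattice.Quot.proj hNL x) =
      ∫ y, f (x + OLattice.Quot.incl hLM y) ∂h.meas N L hNL := by
    refine ⟨fun z => ∫ y, f (Function.surjInv (OLattice.Quot.proj_surjective (M := M) hNL) z +
      OLattice.Quot.incl hLM y) ∂h.meas N L hNL, fun x => ?_⟩
    obtain ⟨z, hz⟩ := OLattice.Quot.exists_incl_of_proj_eq hNL hLM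
      (Function.surjInv_eq (OLattice.Quot.proj_surjective (M := M) hNL)
        (OLattice.Quot.proj hNL x))
    simp only [hz, add_assoc, ← map_add]
    exact integral_add_left_eq_self (fun y => f (x + OLattice.Quot.incl hLM y)) z
  have e1 := h.isTensor N L M hNL hLM f hf hfs F hF
  have e2 := h'.isTensor N L M hNL hLM f hf hfs (fun z => h.scalar h' N L hNL * F z) fun x => by
    rw [h.scalar_spec h' N L hNL, integral_posReal_smul, hF]
  rw [integral_const_mul, h.scalar_spec h' N M, h.scalar_spec h' L M, integral_posReal_smul,
    integral_posReal_smul, ← e1, ← mul_assoc] at e2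
  exact Subtype.ext (mul_right_cancel₀ hf0 e2)

theorem HaarSystem.exists_rescaled [IsDomain O] [IsFractionRing O K] (h h' : HaarSystem O K n) :
    ∃ c, Rescaled c h h' := by
  choose P hP hP' using fun L : OLattice O K n => L.exists_le_le (OLattice.std O K n)
  have indep : ∀ (L N N' : OLattice O K n) (hNL : N ≤ L) (hN : N ≤ OLattice.std O K n)
      (hN' : N' ≤ N),
      h.scalar h' N L hNL / h.scalar h' N _ hN =
        h.scalar h' N' L (hN'.trans hNL) / h.scalar h' N' _ (hN'.trans hN) := by
    intro L N N' hNL hN hN'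
    rw [h.scalar_mul h' hN' hNL, h.scalar_mul h' hN' hN, mul_div_mul_left_eq_div]
  refine ⟨fun L => h.scalar h' (P L) L (hP L) / h.scalar h' (P L) _ (hP' L), fun N L hNL => ?_⟩
  obtain ⟨Q, hQN, hQL⟩ := (P N).exists_le_le (P L)
  have e : (h.scalar h' (P L) L (hP L) / h.scalar h' (P L) _ (hP' L)) /
      (h.scalar h' (P N) N (hP N) / h.scalar h' (P N) _ (hP' N)) = h.scalar h' N L hNL := by
    rw [indep L (P L) Q (hP L) (hP' L) hQL, indep N (P N) Q (hP N) (hP' N) hQN,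
      div_div_div_cancel_right, div_eq_iff_eq_mul, mul_comm,
      ← h.scalar_mul h' (hQN.trans (hP N)) hNL]
  rw [h.scalar_spec h' N L hNL, ← e]
  rfl

theorem exists_isRelMeasure [IsDomain O] [IsFractionRing O K] (L L' : OLattice O K n) :
    ∃ r, IsRelMeasure L L' r := by
  rcases isEmpty_or_nonempty (HaarSystem O K n) with hE | ⟨⟨h₀⟩⟩
  · exact ⟨fun _ => 1, fun h => (hE.false h).elim⟩
  choose c hc using fun h : HaarSystem O K n => h₀.exists_rescaled h
  refine ⟨fun h => c h L / c h L', fun h h' b hb => ?_⟩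
  obtain ⟨N, hN, hN'⟩ := L.exists_le_le L'
  have key : ∀ M (hM : N ≤ M), c h' M / c h' N = (b M / b N) * (c h M / c h N) := by
    intro M hM
    apply h₀.scalar_unique hM
    have e := (hc h' N M hM).symm.trans (hb N M hM)
    rw [hc h N M hM, smul_smul, ← ENNReal.ofReal_mul (div_pos (b M).2 (b N).2).le] at e
    exact e
  have k := key L hN
  have k' := key L' hN'
  rw [div_eq_iff_eq_mul] at k k'
  change c h' L / c h' L' * b L' = c h L / c h L' * b L
  rw [k, k', mul_div_mul_right_eq_div, div_mul_eq_mul_div (b L / b N * (c h L / c h N)),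
    div_eq_iff_eq_mul]
  nth_rewrite 1 [← div_mul_cancel (c h L) (c h L')]
  simp only [div_eq_mul_inv]
  ac_rfl

/-! #### The group of pairs `(g, μ)` with `μ ∈ μ(O^n | g O^n)` -/

variable (O K n) in
/-- The group of all pairs `(g, μ)` with `g ∈ GL_n(K)` and `μ ∈ μ(O^n | g O^n)`. -/
@[ext]
structure HaarGL where
  g : Matrix.GeneralLinearGroup (Fin n) K
  r : HaarSystem O K n → PosReal
  isRelMeasure : IsRelMeasure (OLattice.std O K n) (g • OLattice.std O K n) r

namespace HaarGL

/-- `(g₁, μ₁) (g₂, μ₂) = (g₁ g₂, μ₁ ⊗ g₁(μ₂))`. -/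
noncomputable instance : Mul (HaarGL O K n) where
  mul x y := ⟨x.g * y.g, x.r * fun h => y.r (h.pull x.g), by
    rw [mul_smul]
    exact x.isRelMeasure.mul (y.isRelMeasure.pull x.g)⟩

noncomputable instance : One (HaarGL O K n) where
  one := ⟨1, fun _ => 1, by rw [one_smul]; exact isRelMeasure_const _ 1⟩

noncomputable instance : Inv (HaarGL O K n) where
  inv x := ⟨x.g⁻¹, fun h => (x.r (h.pull x.g⁻¹))⁻¹, by
    have := x.isRelMeasure.inv.pull x.g⁻¹
    rw [inv_smul_smul] at this
    exact this⟩

theorem mul_g (x y : HaarGL O K n) : (x * y).g = x.g * y.g := rfl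

theorem mul_r (x y : HaarGL O K n) (h : HaarSystem O K n) :
    (x * y).r h = x.r h * y.r (h.pull x.g) := rfl

noncomputable instance : Group (HaarGL O K n) :=
  Group.ofLeftAxioms
    (fun x y z => HaarGL.ext (mul_assoc _ _ _) (funext fun h => by
      rw [mul_r, mul_r, mul_r, mul_r, mul_g, HaarSystem.pull_mul, mul_assoc]))
    (fun x => HaarGL.ext (one_mul _) (funext fun h => by
      change 1 * x.r (h.pull 1) = x.r h
      rw [HaarSystem.pull_one, one_mul]))
    (fun x => HaarGL.ext (inv_mul_cancel _) (funext fun h => by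
      change (x.r (h.pull x.g⁻¹))⁻¹ * x.r (h.pull x.g⁻¹) = 1
      rw [inv_mul_cancel]))

variable (O K n) in
/-- The projection `(g, μ) ↦ g`. -/
noncomputable def toGL : HaarGL O K n →* Matrix.GeneralLinearGroup (Fin n) K where
  toFun := g
  map_one' := rfl
  map_mul' _ _ := rfl

variable (O K n) in
/-- The inclusion of `ℝ_{>0} = μ(O^n | O^n)`. -/
noncomputable def ofPosReal : PosReal →* HaarGL O K n where
  toFun t := ⟨1, fun _ => t, by rw [one_smul]; exact isRelMeasure_const _ t⟩
  map_one' := rfl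
  map_mul' s t := HaarGL.ext (mul_one 1).symm rfl

theorem toGL_surjective [IsDomain O] [IsFractionRing O K] :
    Function.Surjective (toGL O K n) := fun g => by
  obtain ⟨r, hr⟩ := exists_isRelMeasure (OLattice.std O K n) (g • OLattice.std O K n)
  exact ⟨⟨g, r, hr⟩, rfl⟩

theorem ker_toGL_le_center [IsDomain O] [IsFractionRing O K] :
    (toGL O K n).ker ≤ Subgroup.center (HaarGL O K n) := by
  intro x hx
  have hx1 : x.g = 1 := hx
  have hr : ∀ h h', x.r h' = x.r h := by
    intro h h'
    obtain ⟨c, hc⟩ := h.exists_rescaled h'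
    have := x.isRelMeasure h h' c hc
    rw [hx1, one_smul] at this
    exact mul_right_cancel this
  rw [Subgroup.mem_center_iff]
  intro y
  refine HaarGL.ext (by rw [mul_g, mul_g, hx1, one_mul, mul_one]) (funext fun h => ?_)
  rw [mul_r, mul_r, hx1, HaarSystem.pull_one, hr h, mul_comm]

end HaarGL

end Haar

/-! ### The extension of `GL_2(K)` by `ℝ_{>0}` -/

section HaarExtension

variable (O K : Type*) [CommRing O] [IsDomain O] [Field K] [Algebra O K] [IsFractionRing O K]
  [TopologicalSpace K] [IsLatticeTopology O K]

/-- The preimage `θ⁻¹(SL_2(K))` of `SL_2(K)` under `θ : (g, μ) ↦ g`. -/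
noncomputable def haarSL2 : Subgroup (HaarGL O K 2) :=
  (Matrix.GeneralLinearGroup.det.comp (HaarGL.toGL O K 2)).ker

/-- A lift of the matrix `diag(a, 1)` to a pair `(diag(a, 1), μ)`. -/
noncomputable def haarLift (a : Kˣ) : HaarGL O K 2 :=
  (HaarGL.toGL_surjective (O := O) (upperLeft K a)).choose

theorem toGL_haarLift (a : Kˣ) : HaarGL.toGL O K 2 (haarLift O K a) = upperLeft K a :=
  (HaarGL.toGL_surjective (O := O) (upperLeft K a)).choose_spec

theorem conj_eq_of_toGL_eq {x y : HaarGL O K 2}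
    (h : HaarGL.toGL O K 2 x = HaarGL.toGL O K 2 y) (z : HaarGL O K 2) :
    x * z * x⁻¹ = y * z * y⁻¹ := by
  have hk : y⁻¹ * x ∈ (HaarGL.toGL O K 2).ker := by
    rw [MonoidHom.mem_ker, map_mul, map_inv, h, inv_mul_cancel]
  have hc := Subgroup.mem_center_iff.1 (HaarGL.ker_toGL_le_center hk) z
  calc x * z * x⁻¹ = y * (y⁻¹ * x * z) * x⁻¹ := by group
    _ = y * (z * (y⁻¹ * x)) * x⁻¹ := by rw [hc]
    _ = y * z * y⁻¹ := by group

/-- The action of `Kˣ` on `θ⁻¹(SL_2(K))`: an element `a` acts by conjugation by any lift of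
`diag(a, 1)` along `θ`. -/
noncomputable def haarAction : Kˣ →* MulAut (haarSL2 O K) :=
  mulAutOfEnd
    (fun a =>
      { toFun := fun x => ⟨haarLift O K a * x.1 * (haarLift O K a)⁻¹,
          (MonoidHom.normal_ker _).conj_mem x.1 x.2 _⟩
        map_one' := by ext1; simp
        map_mul' := fun x y => by ext1; simp [mul_assoc] })
    (fun x => by
      ext1
      change haarLift O K 1 * x.1 * (haarLift O K 1)⁻¹ = x.1
      rw [conj_eq_of_toGL_eq O K (y := 1) (by rw [toGL_haarLift, map_one, map_one])]
      simp)
    (fun a b x => by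
      ext1
      change haarLift O K (a * b) * x.1 * (haarLift O K (a * b))⁻¹ =
        haarLift O K a * (haarLift O K b * x.1 * (haarLift O K b)⁻¹) * (haarLift O K a)⁻¹
      rw [conj_eq_of_toGL_eq O K (y := haarLift O K a * haarLift O K b)
        (by simp only [map_mul, toGL_haarLift])]
      group)

/-- The group `θ⁻¹(SL_2(K)) ⋊ Kˣ`. -/
abbrev HaarGL2 : Type _ := haarSL2 O K ⋊[haarAction O K] Kˣ

/-- The projection `θ⁻¹(SL_2(K)) ⋊ Kˣ → SL_2(K) ⋊ Kˣ = GL_2(K)`. -/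
noncomputable def haarProj : HaarGL2 O K →* GL2 K :=
  SemidirectProduct.lift ((HaarGL.toGL O K 2).comp (haarSL2 O K).subtype) (upperLeft K)
    (fun a => by
      ext1 x
      change HaarGL.toGL O K 2 (haarLift O K a * x.1 * (haarLift O K a)⁻¹) =
        upperLeft K a * HaarGL.toGL O K 2 x.1 * (upperLeft K a)⁻¹
      rw [map_mul, map_mul, map_inv, toGL_haarLift])

/-- The inclusion of `ℝ_{>0}` into `θ⁻¹(SL_2(K)) ⋊ Kˣ`. -/
noncomputable def haarInl : PosReal →* HaarGL2 O K :=
  SemidirectProduct.inl.comp ((HaarGL.ofPosReal O K 2).codRestrict (haarSL2 O K) fun t => by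
    rw [haarSL2, MonoidHom.mem_ker, MonoidHom.comp_apply]
    exact map_one _)

end HaarExtension

/-! ### Two-dimensional local fields -/

section TwoDimensional

/-- The normalized discrete valuation `F → ℤ` of the fraction field `F` of a discrete valuation
ring `R` (with the value `0` at `0`). -/
noncomputable def dvrVal (R : Type*) {F : Type*} [CommRing R] [IsDomain R]
    [IsDiscreteValuationRing R] [Field F] [Algebra R F] [IsFractionRing R F] (x : F) : ℤ :=
  WithZero.log (Ring.ordFrac R x)

/-- The residue class of an element of the image of `O` in `K` (see the lemma below; on the other
elements of `K`, on which it is never used, it has no meaning). -/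
noncomputable def reduction (O : Type*) {K : Type*} [CommRing O] [IsLocalRing O] [Field K]
    [Algebra O K] (x : K) : IsLocalRing.ResidueField O :=
  IsLocalRing.residue O (Function.invFun (algebraMap O K) x)

theorem reduction_algebraMap (O : Type*) {K : Type*} [CommRing O] [IsDomain O] [IsLocalRing O]
    [Field K] [Algebra O K] [IsFractionRing O K] (x : O) :
    reduction O (algebraMap O K x) = IsLocalRing.residue O x := by
  rw [reduction, Function.leftInverse_invFun (IsFractionRing.injective O K)]

/-- `ν_K(f, g) = ν_k(the residue class of f ^ ν_K(g) / g ^ ν_K(f))`, where `k` is the residue field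
of `O`, the fraction field of the discrete valuation ring `O₁`. The element in brackets has the
valuation `0`, so it is a unit of `O`. -/
noncomputable def tameVal (O O₁ : Type*) {K : Type*} [CommRing O] [IsDomain O]
    [IsDiscreteValuationRing O] [Field K] [Algebra O K] [IsFractionRing O K] [CommRing O₁]
    [IsDomain O₁] [IsDiscreteValuationRing O₁] [Algebra O₁ (IsLocalRing.ResidueField O)]
    [IsFractionRing O₁ (IsLocalRing.ResidueField O)] (f g : Kˣ) : ℤ :=
  dvrVal O₁ (reduction O ((f : K) ^ dvrVal O (g : K) / (g : K) ^ dvrVal O (f : K)))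

/-- The topology of `K` induces on the residue field `k` of `O` (as the quotient of `O ⊂ K`) the
topology of its valuation: the images in `k` of the neighbourhoods of `0` in `O` are generated by
the powers of the maximal ideal of the discrete valuation ring `O₁` of `k`. -/
def InducesResidueTopology (O O₁ K : Type*) [CommRing O] [IsLocalRing O] [Field K] [Algebra O K]
    [TopologicalSpace K] [CommRing O₁] [IsLocalRing O₁]
    [Algebra O₁ (IsLocalRing.ResidueField O)] : Prop :=
  (Filter.map (IsLocalRing.residue O) (Filter.comap (algebraMap O K) (nhds 0))).HasBasis
    (fun _ : ℕ => True) fun k =>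
      algebraMap O₁ (IsLocalRing.ResidueField O) '' (IsLocalRing.maximalIdeal O₁ ^ k : Ideal O₁)

end TwoDimensional

/-! ### Pushouts of extensions -/

section Pushout

variable {A B E E' G : Type*} [Group A] [Group B] [Group E] [Group E'] [Group G]

/-- The group `(E × B) / ⟨(i(a), φ(a)⁻¹)⟩`, for homomorphisms `i : A → E` and `φ : A → B` (with
`i(A)` central in `E` and `B` commutative, so that these elements form a normal subgroup). -/
abbrev PushoutGroup (i : A →* E) (φ : A →* B) : Type _ :=
  (E × B) ⧸ Subgroup.normalClosure (Set.range fun a => (i a, (φ a)⁻¹))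

/-- The extension `S'` of `G` by `B` is equivalent to the one which is obtained from the extension
`S` of `G` by `A` by means of the homomorphism `φ : A → B`: its group is isomorphic to
`(E × B) / ⟨(i(a), φ(a)⁻¹)⟩`, compatibly with the maps from `B` and to `G`. -/
def IsPushoutExtension (S : GroupExtension A E G) (φ : A →* B) (S' : GroupExtension B E' G) :
    Prop :=
  ∃ e : PushoutGroup S.inl φ ≃* E', (∀ b, e (QuotientGroup.mk (1, b)) = S'.inl b) ∧
    ∀ x b, S'.rightHom (e (QuotientGroup.mk (x, b))) = S.rightHom x

end Pushout

/-!
The comparison comes from the universal property of the Steinberg group. The groups of pairs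
`(g, μ)`, for all `n`, are stabilized to a direct limit `HaarGLInf`. This is a central extension by
`ℝ_{>0}` of a group of automorphisms of `K^∞` which contains `SL(K)`. Since `St(K) → SL(K)` is a
universal central extension (`SteinbergGroup.exists_lift`), the map `St(K) → SL(K)` lifts to a
homomorphism `steinbergLift : St(K) → HaarGLInf`. On the kernels it is a homomorphism
`haarSymbol : K_2(K) → ℝ_{>0}`, and over `SL_2(K)` it takes its values in the group of pairs for
`n = 2`, because that group embeds into the limit (`HaarGLInf.of_injective`). It is equivariant for
`Kˣ`, since lifts are unique (`SteinbergGroup.hom_ext_of_ker_le_center`). So it extends to a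
morphism `comparison` between the two extensions of `GL_2(K)` which is `haarSymbol` on the kernels,
and such a morphism identifies the second extension with the pushout of the first
(`isPushoutExtension_of_hom`).

That `ℝ_{>0}` is the whole kernel of `(g, μ) ↦ g`, and embeds into the group of pairs, needs a
coherent system of Haar measures on the quotients of lattices (`HaarSystem.nonempty`). Haar measures
chosen arbitrarily are multiplicative in extensions up to a 2-cocycle on the directed set of
lattices, and every such cocycle is a coboundary (`exists_coboundary`).

The value of `haarSymbol` on the symbol of `f` and `g` is the commutator of any two pairs over
`diag(f, f⁻¹, 1)` and `diag(g, 1, g⁻¹)` (`mul_eq_ofPosReal_haarPairing_mul`). It is bimultiplicative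
and skew-symmetric, so that only units of `O` and a uniformizer `ϖ` have to be considered. It is
trivial on two units, which preserve the standard lattice and its measure, and on `(ϖ, ϖ)`, where
its square is `1`. For a unit `u` and `ϖ` it is the factor by which the multiplication with the
residue class of `u` changes the Haar measure of the residue field `O / ϖ O`. This factor is
computed on a ball: it is `q ^ (-ν)`, where `ν` is the valuation of the residue class
(`mul_pow_eq_one_of_map_eq_smul`, `haarPairing_unit_uniformizer`).

Uniqueness holds because `K_2(K)` is generated by symbols (`SteinbergGroup.ker_toAut_eq`,
`K2.hom_ext`). This is proved by induction on the rank, with a decomposition of `St_{n+1}(K)` into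
cells according to the last column (`SteinbergGroup.mem_columnCells`). The symbols are central, so
this also shows that `K_2(K)` is central in `St(K)`.
-/

/-! ### Commutators in central extensions -/

/-- In a central extension, the commutator of two elements depends only on their images. -/
theorem commutatorElement_congr_of_ker_le_center {E G : Type*} [Group E] [Group G] {p : E →* G}
    (hp : p.ker ≤ Subgroup.center E) {a a' b b' : E} (ha : p a = p a') (hb : p b = p b') :
    ⁅a, b⁆ = ⁅a', b'⁆ := by
  have h1 := Subgroup.mem_center_iff.1 (hp (show a'⁻¹ * a ∈ p.ker by
    rw [MonoidHom.mem_ker, map_mul, map_inv, ha, inv_mul_cancel]))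
  have h2 := Subgroup.mem_center_iff.1 (hp (show b'⁻¹ * b ∈ p.ker by
    rw [MonoidHom.mem_ker, map_mul, map_inv, hb, inv_mul_cancel]))
  obtain ⟨z, rfl⟩ : ∃ z, a = a' * z := ⟨a'⁻¹ * a, by group⟩
  obtain ⟨y, rfl⟩ : ∃ y, b = b' * y := ⟨b'⁻¹ * b, by group⟩
  rw [inv_mul_cancel_left] at h1 h2
  rw [commutatorElement_def, commutatorElement_def, mul_inv_rev, mul_inv_rev]
  have e1 : a' * z * (b' * y) * (z⁻¹ * a'⁻¹) * (y⁻¹ * b'⁻¹) =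
      a' * (z * (b' * y)) * z⁻¹ * a'⁻¹ * y⁻¹ * b'⁻¹ := by group
  have e2 : a' * (b' * y * z) * z⁻¹ * a'⁻¹ * y⁻¹ * b'⁻¹ = a' * b' * (y * a'⁻¹) * y⁻¹ * b'⁻¹ := by
    group
  rw [e1, ← h1, e2, ← h2]
  group

/-! ### Monomial elements of the Steinberg group -/

namespace SteinbergGroup

variable {K : Type*} [Field K]

theorem x_congr {i i' j j' : ℕ} {r r' : K} (hi : i = i') (hj : j = j') (hr : r = r') (h : i ≠ j)
    (h' : i' ≠ j') : x i j h r = x i' j' h' r' := by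
  subst hi hj hr; rfl

theorem x_zero (i j : ℕ) (h : i ≠ j) : x i j h (0 : K) = 1 := by
  have := x_mul_x i j h (0 : K) 0
  rwa [add_zero, mul_eq_left] at this

theorem x_inv (i j : ℕ) (h : i ≠ j) (r : K) : (x i j h r)⁻¹ = x i j h (-r) := by
  rw [inv_eq_iff_mul_eq_one, x_mul_x, add_neg_cancel, x_zero]

theorem x_comm (i j k l : ℕ) (hij : i ≠ j) (hkl : k ≠ l) (hjk : j ≠ k) (hil : i ≠ l) (r s : K) :
    x i j hij r * x k l hkl s = x k l hkl s * x i j hij r :=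
  commutatorElement_eq_one_iff_mul_comm.1 (commutator_x_x_eq_one i j k l hij hkl hjk hil r s)

theorem conj_x_of_ne (i j k l : ℕ) (hij : i ≠ j) (hkl : k ≠ l) (hjk : j ≠ k) (hil : i ≠ l)
    (r s : K) : MulAut.conj (x i j hij r) (x k l hkl s) = x k l hkl s := by
  rw [MulAut.conj_apply, x_comm i j k l hij hkl hjk hil, mul_inv_cancel_right]

theorem conj_x_row (i j k : ℕ) (hij : i ≠ j) (hjk : j ≠ k) (hik : i ≠ k) (r s : K) :
    MulAut.conj (x i j hij r) (x j k hjk s) = x i k hik (r * s) * x j k hjk s := by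
  rw [MulAut.conj_apply, ← commutator_x_x i j k hij hjk hik, commutatorElement_def]
  group

theorem conj_x_col (k i j : ℕ) (hij : i ≠ j) (hki : k ≠ i) (hkj : k ≠ j) (r s : K) :
    MulAut.conj (x i j hij r) (x k i hki s) = x k i hki s * x k j hkj (-(s * r)) := by
  rw [MulAut.conj_apply, ← neg_mul, ← commutator_x_x k i j hki hij hkj, commutatorElement_def,
    ← x_inv]
  group

theorem x_eq_commutator (k l m : ℕ) (hkl : k ≠ l) (hkm : k ≠ m) (hml : m ≠ l) (r : K) :
    x k l hkl r = ⁅x k m hkm r, x m l hml 1⁆ := by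
  rw [commutator_x_x k m l hkm hml hkl, mul_one]

theorem toAut_x_apply (i j : ℕ) (h : i ≠ j) (r : K) (v : ℕ →₀ K) :
    (toAut K (x i j h r) : Module.End K (ℕ →₀ K)) v = v + Finsupp.single i (r * v j) := by
  simp [toAut, elementary, matrixUnit_apply]

theorem closure_x_eq_top :
    Subgroup.closure {s : SteinbergGroup K | ∃ i j h r, s = x i j h r} = ⊤ := by
  rw [eq_top_iff, ← PresentedGroup.closure_range_of, Subgroup.closure_le]
  rintro _ ⟨a, rfl⟩
  exact Subgroup.subset_closure ⟨a.i, a.j, a.ne, a.r, rfl⟩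

/-- `g` acts on the generators by conjugation, and on the basis vectors of `K^∞`, like the monomial
matrix which maps the `k`-th basis vector to `d k` times the `σ k`-th one. -/
structure IsMonomial (g : SteinbergGroup K) (σ : Equiv.Perm ℕ) (d : ℕ → Kˣ) : Prop where
  conj_x : ∀ k l (h : k ≠ l) (r : K), MulAut.conj g (x k l h r) =
    x (σ k) (σ l) (σ.injective.ne h) (d k * r * ((d l)⁻¹ : Kˣ))
  toAut_single : ∀ k, (toAut K g : Module.End K (ℕ →₀ K)) (Finsupp.single k 1) =
    Finsupp.single (σ k) (d k : K)

theorem IsMonomial.mul {g g' : SteinbergGroup K} {σ σ' : Equiv.Perm ℕ} {d d' : ℕ → Kˣ}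
    (h : IsMonomial g σ d) (h' : IsMonomial g' σ' d') :
    IsMonomial (g * g') (σ * σ') fun k => d (σ' k) * d' k where
  conj_x k l hkl r := by
    rw [map_mul, MulAut.mul_apply, h'.conj_x, h.conj_x]
    refine x_congr rfl rfl ?_ _ _
    simp only [Units.val_mul, mul_inv]
    ring
  toAut_single k := by
    rw [map_mul, Units.val_mul, Module.End.mul_apply, h'.toAut_single, ← mul_one (d' k : K),
      ← smul_eq_mul, ← Finsupp.smul_single, map_smul, h.toAut_single, Finsupp.smul_single,
      smul_eq_mul, Units.val_mul, mul_comm, Equiv.Perm.mul_apply]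

theorem IsMonomial.one : IsMonomial (1 : SteinbergGroup K) 1 1 where
  conj_x k l hkl r := by
    rw [map_one]
    exact x_congr rfl rfl (by simp) _ _
  toAut_single k := by simp

theorem IsMonomial.inv {g : SteinbergGroup K} {σ : Equiv.Perm ℕ} {d : ℕ → Kˣ}
    (h : IsMonomial g σ d) : IsMonomial g⁻¹ σ⁻¹ fun k => (d (σ⁻¹ k))⁻¹ where
  conj_x k l hkl r := by
    apply (MulAut.conj g).injective
    rw [h.conj_x, ← MulAut.mul_apply, ← map_mul, mul_inv_cancel, map_one, MulAut.one_apply]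
    refine x_congr (by simp) (by simp) ?_ _ _
    have h1 := (d (σ⁻¹ k)).ne_zero
    have h2 := (d (σ⁻¹ l)).ne_zero
    simp only [Units.val_inv_eq_inv_val, inv_inv]
    field_simp
  toAut_single k := by
    have h1 := h.toAut_single (σ⁻¹ k)
    rw [Equiv.Perm.inv_def, Equiv.apply_symm_apply] at h1
    rw [Equiv.Perm.inv_def]
    have h2 : Finsupp.single k (1 : K) = (((d (σ.symm k))⁻¹ : Kˣ) : K) •
        Finsupp.single k (d (σ.symm k) : K) := by simp
    rw [h2, ← h1, map_smul, ← Module.End.mul_apply, ← Units.val_mul, ← map_mul, inv_mul_cancel,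
      map_one, Units.val_one, Module.End.one_apply, Finsupp.smul_single, smul_eq_mul, mul_one]

/-- The monomial matrix which lies under `w_{ij}(u)` has the entry `u` in column `j` and the entry
`-u⁻¹` in column `i`. -/
def wEntry (i j : ℕ) (u : Kˣ) (k : ℕ) : Kˣ := if k = j then u else if k = i then -u⁻¹ else 1

theorem w_inv (i j : ℕ) (h : i ≠ j) (u : Kˣ) : (w i j h u)⁻¹ = w i j h (-u) := by
  simp only [w, mul_inv_rev, x_inv, inv_neg, Units.val_neg, neg_neg, mul_assoc]

theorem isMonomial_w (i j : ℕ) (hij : i ≠ j) (u : Kˣ) :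
    IsMonomial (w i j hij u) (Equiv.swap i j) (wEntry i j u) := by
  have hu : (u : K) * ((u⁻¹ : Kˣ) : K) = 1 := by simp
  have hu' : ((u⁻¹ : Kˣ) : K) * (u : K) = 1 := by simp
  have e1 : ∀ k m (hkm : k ≠ m) (r : K) (hmi : m ≠ i) (hmj : m ≠ j),
      MulAut.conj (w i j hij u) (x k m hkm r) = x (Equiv.swap i j k) m
        (by rw [← Equiv.swap_apply_of_ne_of_ne hmi hmj]; exact (Equiv.injective _).ne hkm)
        (wEntry i j u k * r) := by
    intro k m hkm r hmi hmj
    by_cases hkj : k = j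
    · subst hkj
      have h1 : MulAut.conj (x k i hij.symm (-((u⁻¹ : Kˣ) : K)))
          (MulAut.conj (x i k hij (u : K)) (x k m hkm r)) = x i m hmi.symm (u * r) := by
        rw [conj_x_row i k m hij hkm hmi.symm, map_mul, conj_x_row k i m hij.symm hmi.symm hkm,
          conj_x_of_ne k i k m hij.symm hkm hij hkm, mul_assoc,
          x_comm i m k m hmi.symm hkm hmj hmi.symm, ← mul_assoc, x_mul_x, ← mul_assoc, neg_mul, hu',
          neg_one_mul, neg_add_cancel, x_zero, one_mul]
      simp only [w, map_mul, MulAut.mul_apply]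
      rw [h1, conj_x_of_ne i k i m hij hmi.symm hij.symm hmi.symm]
      exact x_congr (by simp) rfl (by simp [wEntry]) _ _
    by_cases hki : k = i
    · subst hki
      have h1 : MulAut.conj (x k j hij (u : K)) (MulAut.conj (x j k hij.symm (-((u⁻¹ : Kˣ) : K)))
          (x k m hkm r)) = x j m hmj.symm (-((u⁻¹ : Kˣ) : K) * r) := by
        rw [conj_x_row j k m hij.symm hkm hmj.symm, map_mul, conj_x_row k j m hij hmj.symm hkm,
          conj_x_of_ne k j k m hij hkm hij.symm hkm, mul_assoc,
          x_comm j m k m hmj.symm hkm hkm.symm hmj.symm, ← mul_assoc, x_mul_x, ← mul_assoc, mul_neg,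
          hu, neg_one_mul, neg_add_cancel, x_zero, one_mul]
      simp only [w, map_mul, MulAut.mul_apply]
      rw [conj_x_of_ne k j k m hij hkm hij.symm hkm, h1]
      exact x_congr (by simp) rfl (by simp [wEntry, hij]) _ _
    · simp only [w, map_mul, MulAut.mul_apply]
      rw [conj_x_of_ne i j k m hij hkm (Ne.symm hkj) hmi.symm,
        conj_x_of_ne j i k m hij.symm hkm (Ne.symm hki) hmj.symm,
        conj_x_of_ne i j k m hij hkm (Ne.symm hkj) hmi.symm]
      exact x_congr (Equiv.swap_apply_of_ne_of_ne hki hkj).symm rfl (by simp [wEntry, hki, hkj]) _ _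
  have e2 : ∀ m l (hml : m ≠ l) (r : K) (hmi : m ≠ i) (hmj : m ≠ j),
      MulAut.conj (w i j hij u) (x m l hml r) = x m (Equiv.swap i j l)
        (by rw [← Equiv.swap_apply_of_ne_of_ne hmi hmj]; exact (Equiv.injective _).ne hml)
        (r * ((wEntry i j u l)⁻¹ : Kˣ)) := by
    intro m l hml r hmi hmj
    by_cases hlj : l = j
    · subst hlj
      have h1 : MulAut.conj (x i l hij (u : K)) (MulAut.conj (x l i hij.symm (-((u⁻¹ : Kˣ) : K)))
          (x m l hml r)) = x m i hmi (r * ((u⁻¹ : Kˣ) : K)) := by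
        rw [conj_x_col m l i hij.symm hml hmi, map_mul, conj_x_col m i l hij hmi hml,
          conj_x_of_ne i l m l hij hml hml.symm hij, x_comm m i m l hmi hml hmi.symm hml,
          ← mul_assoc, x_mul_x, mul_neg, neg_neg, mul_assoc, hu', mul_one, add_neg_cancel, x_zero,
          one_mul]
      simp only [w, map_mul, MulAut.mul_apply]
      rw [conj_x_of_ne i l m l hij hml hml.symm hij, h1]
      exact x_congr rfl (by simp) (by simp [wEntry]) _ _
    by_cases hli : l = i
    · subst hli
      have h1 : MulAut.conj (x j l hij.symm (-((u⁻¹ : Kˣ) : K))) (MulAut.conj (x l j hij (u : K))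
          (x m l hml r)) = x m j hmj (-(r * u)) := by
        rw [conj_x_col m l j hij hml hmj, map_mul, conj_x_col m j l hij.symm hmj hml,
          conj_x_of_ne j l m l hij.symm hml hml.symm hij.symm,
          x_comm m j m l hmj hml hmj.symm hml, ← mul_assoc,
          x_mul_x, mul_neg, neg_mul, neg_neg, mul_assoc, hu, mul_one,
          add_neg_cancel, x_zero, one_mul]
      simp only [w, map_mul, MulAut.mul_apply]
      rw [h1, conj_x_of_ne l j m j hij hmj hmj.symm hij]
      exact x_congr rfl (by simp) (by simp [wEntry, hij, inv_neg]) _ _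
    · simp only [w, map_mul, MulAut.mul_apply]
      rw [conj_x_of_ne i j m l hij hml hmj.symm (Ne.symm hli),
        conj_x_of_ne j i m l hij.symm hml hmi.symm (Ne.symm hlj),
        conj_x_of_ne i j m l hij hml hmj.symm (Ne.symm hli)]
      exact x_congr rfl (Equiv.swap_apply_of_ne_of_ne hli hlj).symm (by simp [wEntry, hli, hlj]) _ _
  refine ⟨fun k l hkl r => ?_, fun k => ?_⟩
  · -- a fourth index reduces the general case to the two cases of a single common index
    obtain ⟨m, hm⟩ := Infinite.exists_notMem_finset ({i, j, k, l} : Finset ℕ)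
    simp only [Finset.mem_insert, Finset.mem_singleton, not_or] at hm
    obtain ⟨hmi, hmj, hmk, hml⟩ := hm
    rw [x_eq_commutator k l m hkl (Ne.symm hmk) hml, map_commutatorElement, e1 _ _ _ _ hmi hmj,
      e2 _ _ _ _ hmi hmj, commutator_x_x _ _ _ _ _ ((Equiv.injective _).ne hkl), one_mul]
  · simp only [w, map_mul, Units.val_mul, Module.End.mul_apply, toAut_x_apply, Finsupp.add_apply,
      Finsupp.single_apply, hij, if_true, if_false]
    by_cases hkj : k = j
    · subst hkj
      simp [hij.symm, wEntry, Finsupp.single_neg]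
    by_cases hki : k = i
    · subst hki
      simp [hij, wEntry, Finsupp.single_neg]
    · simp [hki, hkj, wEntry, Equiv.swap_apply_of_ne_of_ne]

theorem IsMonomial.conj_w {g : SteinbergGroup K} {σ : Equiv.Perm ℕ} {d : ℕ → Kˣ}
    (h : IsMonomial g σ d) (i j : ℕ) (hij : i ≠ j) (u : Kˣ) :
    MulAut.conj g (w i j hij u) = w (σ i) (σ j) (σ.injective.ne hij) (d i * u * (d j)⁻¹) := by
  simp only [w, map_mul, h.conj_x]
  congr 2
  refine x_congr rfl rfl ?_ _ _
  simp only [mul_inv, inv_inv, Units.val_mul]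
  ring

theorem isMonomial_h (i j : ℕ) (hij : i ≠ j) (u : Kˣ) :
    IsMonomial (h i j hij u) 1 fun k => if k = i then u else if k = j then u⁻¹ else 1 := by
  have h1 := (isMonomial_w i j hij u).mul (isMonomial_w i j hij (-1))
  rw [Equiv.swap_mul_self] at h1
  convert h1 using 1
  · rfl
  funext k
  by_cases hi : k = i
  · subst hi; simp [wEntry, hij]
  by_cases hj : k = j
  · subst hj; simp [wEntry, hij, hij.symm]
  simp [wEntry, hi, hj, Equiv.swap_apply_of_ne_of_ne]

theorem h_one (i j : ℕ) (hij : i ≠ j) : h i j hij (1 : Kˣ) = 1 := by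
  rw [h, ← w_inv, mul_inv_cancel]

theorem w_eq_h_mul (i j : ℕ) (hij : i ≠ j) (u : Kˣ) : w i j hij u = h i j hij u * w i j hij 1 := by
  rw [h, mul_assoc, ← w_inv i j hij 1, inv_mul_cancel, mul_one]

theorem w_mul_w (i j : ℕ) (hij : i ≠ j) (u v : Kˣ) :
    w i j hij u * w i j hij v = h i j hij u * (h i j hij (-v))⁻¹ := by
  rw [h, h, mul_inv_rev, w_inv, w_inv, neg_neg, neg_neg, mul_assoc, ← mul_assoc (w i j hij (-1)),
    ← w_inv i j hij 1, inv_mul_cancel, one_mul]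

/-- `w_{ij}(u) = w_{ji}(-u⁻¹)`. -/
theorem w_swap (i j : ℕ) (hij : i ≠ j) (u : Kˣ) : w i j hij u = w j i hij.symm (-u⁻¹) := by
  have h1 := (isMonomial_w i j hij u).conj_w i j hij u
  rw [MulAut.conj_apply, mul_inv_cancel_right] at h1
  rw [h1]
  have key : ∀ a b (hab : a ≠ b) c, a = j → b = i → c = -u⁻¹ →
      w a b hab c = w j i hij.symm (-u⁻¹) := by
    rintro a b hab c rfl rfl rfl; rfl
  refine key _ _ _ _ (by simp) (by simp) ?_
  simp [wEntry, hij]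

end SteinbergGroup

/-! ### `K_2` of a field is generated by symbols -/

namespace SteinbergGroup

variable {K : Type*} [Field K]

/-- Two elements over diagonal matrices act on the generators of `St(K)` by commuting automorphisms,
so that their commutator acts trivially. -/
theorem commutator_mem_center_of_isMonomial_one {a b : SteinbergGroup K} {d e : ℕ → Kˣ}
    (ha : IsMonomial a 1 d) (hb : IsMonomial b 1 e) :
    ⁅a, b⁆ ∈ Subgroup.center (SteinbergGroup K) := by
  have key : (MulAut.conj (a * b)).toMonoidHom = (MulAut.conj (b * a)).toMonoidHom := by
    refine hom_ext fun i j hij r => ?_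
    change MulAut.conj (a * b) _ = MulAut.conj (b * a) _
    rw [(ha.mul hb).conj_x, (hb.mul ha).conj_x]
    refine x_congr rfl rfl ?_ _ _
    simp only [Equiv.Perm.one_apply, mul_comm]
  rw [Subgroup.mem_center_iff]
  intro g
  have h1 : a * b * ((b * a)⁻¹ * g * (b * a)) * (a * b)⁻¹ =
      b * a * ((b * a)⁻¹ * g * (b * a)) * (b * a)⁻¹ := DFunLike.congr_fun key _
  have h2 : a * b * ((b * a)⁻¹ * g * (b * a)) * (a * b)⁻¹ = ⁅a, b⁆ * g * ⁅a, b⁆⁻¹ := by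
    rw [commutatorElement_def]; group
  have h3 : b * a * ((b * a)⁻¹ * g * (b * a)) * (b * a)⁻¹ = g := by group
  rw [h2, h3] at h1
  exact (mul_inv_eq_iff_eq_mul.1 h1).symm

variable (K) in
/-- The subgroup of `St(K)` which is generated by the symbols. -/
def symbolSubgroup : Subgroup (SteinbergGroup K) :=
  Subgroup.closure {s | ∃ u v : Kˣ, s = (symbol u v : K2 K)}

theorem symbolSubgroup_le_center : symbolSubgroup K ≤ Subgroup.center (SteinbergGroup K) := by
  rw [symbolSubgroup, Subgroup.closure_le]
  rintro _ ⟨u, v, rfl⟩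
  exact commutator_mem_center_of_isMonomial_one (isMonomial_h _ _ _ u) (isMonomial_h _ _ _ v)

theorem symbolSubgroup_le_ker : symbolSubgroup K ≤ (toAut K).ker := by
  rw [symbolSubgroup, Subgroup.closure_le]
  rintro _ ⟨u, v, rfl⟩
  exact (symbol u v).2

theorem comm_of_mem_symbolSubgroup {z : SteinbergGroup K} (hz : z ∈ symbolSubgroup K)
    (g : SteinbergGroup K) : g * z = z * g :=
  Subgroup.mem_center_iff.1 (symbolSubgroup_le_center hz) g

/-- The symbol measures the failure of `u ↦ h_{02}(u)` to be multiplicative. -/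
theorem symbol_eq (u v : Kˣ) : ((symbol u v : K2 K) : SteinbergGroup K) =
    h 0 2 (by decide) (u * v) * (h 0 2 (by decide) u)⁻¹ * (h 0 2 (by decide) v)⁻¹ := by
  have h1 := (isMonomial_h (K := K) 0 1 (by decide) u).conj_w 0 2 (by decide)
  have h2 : MulAut.conj (h 0 1 (by decide) u) (h 0 2 (by decide) v) =
      h 0 2 (by decide) (u * v) * (h 0 2 (by decide) u)⁻¹ := by
    rw [show h 0 2 (by decide) v = w 0 2 (by decide) v * w 0 2 (by decide) (-1) from rfl, map_mul,
      h1, h1]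
    have := w_mul_w 0 2 (by decide) (u * v) (-u)
    rw [neg_neg] at this
    rw [← this]
    simp
  rw [← h2]
  rfl

theorem exists_h_mul_h_eq (n : ℕ) (hn : 0 ≠ n) (u v : Kˣ) : ∃ z ∈ symbolSubgroup K,
    h 0 n hn u * h 0 n hn v = h 0 n hn (u * v) * z := by
  have h0 : ∀ u v : Kˣ, ∃ z ∈ symbolSubgroup K,
      h 0 2 (by decide) u * h 0 2 (by decide) v = h 0 2 (by decide) (u * v) * z := by
    intro u v
    have hz : ((symbol v u : K2 K) : SteinbergGroup K)⁻¹ ∈ symbolSubgroup K :=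
      inv_mem (Subgroup.subset_closure ⟨v, u, rfl⟩)
    refine ⟨_, hz, ?_⟩
    rw [comm_of_mem_symbolSubgroup hz, symbol_eq, mul_comm v u]
    group
  by_cases h2 : n = 2
  · subst h2
    exact h0 u v
  · obtain ⟨z, hz, e⟩ := h0 u v
    -- conjugation by `w_{n2}(1)` exchanges the indices `2` and `n` and fixes `0`
    have hc : ∀ t : Kˣ, MulAut.conj (w n 2 h2 1) (h 0 2 (by decide) t) = h 0 n hn t := by
      have key : ∀ t : Kˣ, MulAut.conj (w n 2 h2 1) (w 0 2 (by decide) t) = w 0 n hn t := by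
        intro t
        rw [(isMonomial_w n 2 h2 1).conj_w]
        have aux : ∀ a b (hab : a ≠ b) c, a = 0 → b = n → c = t → w a b hab c = w 0 n hn t := by
          rintro a b hab c rfl rfl rfl; rfl
        refine aux _ _ _ _ ?_ ?_ ?_
        · exact Equiv.swap_apply_of_ne_of_ne hn (by decide)
        · simp
        · simp [wEntry, hn]
      intro t
      rw [h, map_mul, key, key, h]
    refine ⟨z, hz, ?_⟩
    have e' := congrArg (MulAut.conj (w n 2 h2 1)) e
    rw [map_mul, map_mul, hc, hc, hc] at e'
    rw [e', MulAut.conj_apply, comm_of_mem_symbolSubgroup hz, mul_inv_cancel_right]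

variable (K) in
/-- The subgroup of `St(K)` which is generated by the `x_{ij}(r)` with `i, j < n`. -/
def rankSubgroup (n : ℕ) : Subgroup (SteinbergGroup K) :=
  Subgroup.closure {s | ∃ i j h r, i < n ∧ j < n ∧ s = x i j h r}

theorem x_mem_rankSubgroup {n i j : ℕ} (hij : i ≠ j) (hi : i < n) (hj : j < n) (r : K) :
    x i j hij r ∈ rankSubgroup K n :=
  Subgroup.subset_closure ⟨i, j, hij, r, hi, hj, rfl⟩

theorem w_mem_rankSubgroup {n i j : ℕ} (hij : i ≠ j) (hi : i < n) (hj : j < n) (u : Kˣ) :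
    w i j hij u ∈ rankSubgroup K n :=
  mul_mem (mul_mem (x_mem_rankSubgroup hij hi hj _) (x_mem_rankSubgroup hij.symm hj hi _))
    (x_mem_rankSubgroup hij hi hj _)

theorem exists_mem_rankSubgroup (s : SteinbergGroup K) : ∃ n, s ∈ rankSubgroup K n := by
  have hmono : ∀ m n, m ≤ n → rankSubgroup K m ≤ rankSubgroup K n := fun m n hmn =>
    Subgroup.closure_mono (by
      rintro _ ⟨i, j, h, r, hi, hj, rfl⟩
      exact ⟨i, j, h, r, hi.trans_le hmn, hj.trans_le hmn, rfl⟩)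
  have hs : s ∈ Subgroup.closure {s : SteinbergGroup K | ∃ i j h r, s = x i j h r} := by
    rw [closure_x_eq_top]; trivial
  induction hs using Subgroup.closure_induction with
  | mem s hs =>
    obtain ⟨i, j, h, r, rfl⟩ := hs
    exact ⟨i + j + 1, x_mem_rankSubgroup _ (by omega) (by omega) _⟩
  | one => exact ⟨0, one_mem _⟩
  | mul a b _ _ ha hb =>
    obtain ⟨m, hm⟩ := ha
    obtain ⟨n, hn⟩ := hb
    exact ⟨max m n, mul_mem (hmono _ _ (le_max_left _ _) hm) (hmono _ _ (le_max_right _ _) hn)⟩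
  | inv a _ ha =>
    obtain ⟨n, hn⟩ := ha
    exact ⟨n, inv_mem hn⟩

/-- A coset representative of the monomial elements of rank `n + 1` modulo those of rank `n`: it
maps the `n`-th basis vector to `a` times the `i`-th one. -/
def monomialRep (n : ℕ) (hn : 0 ≠ n) (i : ℕ) (a : Kˣ) : SteinbergGroup K :=
  if hi : i = n then h n 0 hn.symm a else w i n hi a

theorem monomialRep_self (n : ℕ) (hn : 0 ≠ n) (a : Kˣ) :
    monomialRep n hn n a = h n 0 hn.symm a := by simp [monomialRep]

theorem monomialRep_of_ne (n : ℕ) (hn : 0 ≠ n) (i : ℕ) (hi : i ≠ n) (a : Kˣ) :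
    monomialRep n hn i a = w i n hi a := by simp [monomialRep, hi]

instance : (symbolSubgroup K).Normal :=
  ⟨fun z hz g => by rw [comm_of_mem_symbolSubgroup hz, mul_inv_cancel_right]; exact hz⟩

/-- Modulo the symbols, `u ↦ h_{0n}(u)` is a homomorphism. -/
def hModSymbols (n : ℕ) (hn : 0 ≠ n) : Kˣ →* SteinbergGroup K ⧸ symbolSubgroup K :=
  MonoidHom.mk' (fun u => (h 0 n hn u : SteinbergGroup K ⧸ symbolSubgroup K)) fun u v => by
    obtain ⟨z, hz, e⟩ := exists_h_mul_h_eq n hn u v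
    rw [← QuotientGroup.mk_mul, e, QuotientGroup.mk_mul, (QuotientGroup.eq_one_iff z).2 hz, mul_one]

theorem mk_w_mul_w (n : ℕ) (hn : 0 ≠ n) (u v : Kˣ) :
    (w 0 n hn u * w 0 n hn v : SteinbergGroup K ⧸ symbolSubgroup K) =
      hModSymbols n hn (-(u * v⁻¹)) := by
  rw [← QuotientGroup.mk_mul, w_mul_w, QuotientGroup.mk_mul, QuotientGroup.mk_inv]
  change hModSymbols n hn u * (hModSymbols n hn (-v))⁻¹ = _
  rw [← map_inv, ← map_mul, inv_neg, mul_neg]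

theorem mk_h_swap (n : ℕ) (hn : 0 ≠ n) (a : Kˣ) :
    (h n 0 hn.symm a : SteinbergGroup K ⧸ symbolSubgroup K) = hModSymbols n hn a⁻¹ := by
  have h1 : h n 0 hn.symm a = w 0 n hn (-a⁻¹) * w 0 n hn 1 := by
    rw [h, w_swap n 0, w_swap n 0]; simp
  rw [h1, QuotientGroup.mk_mul, mk_w_mul_w]
  simp

theorem mk_w_mul_h (n : ℕ) (hn : 0 ≠ n) (b a : Kˣ) :
    (w 0 n hn b * h n 0 hn.symm a : SteinbergGroup K ⧸ symbolSubgroup K) = w 0 n hn (b * a) := by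
  have h1 : h n 0 hn.symm a = w 0 n hn (-a⁻¹) * w 0 n hn 1 := by
    rw [h, w_swap n 0, w_swap n 0]; simp
  rw [h1, QuotientGroup.mk_mul, ← mul_assoc, mk_w_mul_w, w_eq_h_mul 0 n hn (b * a)]
  simp only [inv_neg, mul_neg, inv_inv, neg_neg]
  rfl

variable (K) in
/-- The subgroup generated by `St_n(K)` and the symbols. -/
abbrev rankSymbolSubgroup (n : ℕ) : Subgroup (SteinbergGroup K) :=
  rankSubgroup K n ⊔ symbolSubgroup K

theorem inv_mul_mem_of_mk_eq {n : ℕ} {a b : SteinbergGroup K}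
    (hab : (a : SteinbergGroup K ⧸ symbolSubgroup K) = b) : a⁻¹ * b ∈ rankSymbolSubgroup K n :=
  Subgroup.mem_sup_right (QuotientGroup.eq.1 hab)

theorem conj_inv_w_mem {n : ℕ} {g : SteinbergGroup K} {d : ℕ → Kˣ} (hg : IsMonomial g 1 d)
    {i j : ℕ} (hij : i ≠ j) (hi : i < n) (hj : j < n) (u : Kˣ) :
    g⁻¹ * w i j hij u * g ∈ rankSymbolSubgroup K n := by
  refine Subgroup.mem_sup_left ?_
  have h1 := hg.inv.conj_w i j hij u
  rw [MulAut.conj_apply, inv_inv] at h1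
  rw [h1]
  exact w_mem_rankSubgroup _ hi hj _

/-- The cosets of the elements `monomialRep n i a` are permuted by the `w_{ij}(u)`. -/
theorem exists_w_mul_monomialRep (n : ℕ) (hn : 0 ≠ n) (i j : ℕ) (hij : i ≠ j) (hi : i ≤ n)
    (hj : j ≤ n) (u : Kˣ) (k : ℕ) (hk : k ≤ n) (a : Kˣ) : ∃ k' ≤ n, ∃ a',
      (monomialRep n hn k' a')⁻¹ * (w i j hij u * monomialRep n hn k a) ∈
        rankSymbolSubgroup K n := by
  have hw : ∀ {i j : ℕ} (hij : i ≠ j) (_ : i < n) (_ : j < n) (u : Kˣ),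
      w i j hij u ∈ rankSymbolSubgroup K n := fun hij hi hj u =>
    Subgroup.mem_sup_left (w_mem_rankSubgroup hij hi hj u)
  have w_congr : ∀ {i i' j j' : ℕ} {u u' : Kˣ} (h : i ≠ j) (h' : i' ≠ j'), i = i' → j = j' →
      u = u' → w i j h u = w i' j' h' u' := by
    rintro _ _ _ _ _ _ _ _ rfl rfl rfl; rfl
  have hn0 : 0 < n := Nat.pos_of_ne_zero hn.symm
  -- the elements of rank `n`
  have small : ∀ (i j : ℕ) (hij : i ≠ j) (_ : i < n) (_ : j < n) (u : Kˣ) (k : ℕ) (_ : k ≤ n)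
      (a : Kˣ), ∃ k' ≤ n, ∃ a', (monomialRep n hn k' a')⁻¹ * (w i j hij u * monomialRep n hn k a) ∈
        rankSymbolSubgroup K n := by
    intro i j hij hi hj u k hk a
    by_cases hkn : k = n
    · refine ⟨n, le_rfl, a, ?_⟩
      rw [hkn, monomialRep_self, ← mul_assoc]
      exact conj_inv_w_mem (isMonomial_h _ _ _ a) hij hi hj u
    · have h1 := (isMonomial_w i j hij u).conj_w k n hkn a
      have h2 : Equiv.swap i j n = n := Equiv.swap_apply_of_ne_of_ne hi.ne' hj.ne'
      have h3 : Equiv.swap i j k ≠ n := by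
        rw [← h2]; simpa using hkn
      refine ⟨Equiv.swap i j k, ?_, wEntry i j u k * a * (wEntry i j u n)⁻¹, ?_⟩
      · rcases eq_or_ne k i with rfl | hki
        · rw [Equiv.swap_apply_left]; exact hj.le
        rcases eq_or_ne k j with rfl | hkj
        · rw [Equiv.swap_apply_right]; exact hi.le
        rwa [Equiv.swap_apply_of_ne_of_ne hki hkj]
      · rw [monomialRep_of_ne _ _ _ h3, monomialRep_of_ne _ _ _ hkn]
        rw [w_congr _ h3 rfl h2 rfl, MulAut.conj_apply, mul_inv_eq_iff_eq_mul] at h1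
        rw [h1, inv_mul_cancel_left]
        exact hw hij hi hj u
  -- the elements `w_{in}(u)`
  have last : ∀ (i : ℕ) (hi : i ≠ n) (_ : i < n) (u : Kˣ) (k : ℕ) (_ : k ≤ n)
      (a : Kˣ), ∃ k' ≤ n, ∃ a', (monomialRep n hn k' a')⁻¹ * (w i n hi u * monomialRep n hn k a) ∈
        rankSymbolSubgroup K n := by
    intro i hin hi u k hk a
    -- `w_{in}(u)` is conjugate to `w_{0n}(u)` by an element of rank `n`
    obtain ⟨s, hs, hsm, hsh, hsw⟩ : ∃ s : SteinbergGroup K, s ∈ rankSymbolSubgroup K n ∧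
        (∀ (k : ℕ) (_ : k ≤ n) (a : Kˣ), ∃ k' ≤ n, ∃ a',
          (monomialRep n hn k' a')⁻¹ * (s * monomialRep n hn k a) ∈ rankSymbolSubgroup K n) ∧
        (∀ a, (h n 0 hn.symm a)⁻¹ * s * h n 0 hn.symm a ∈ rankSymbolSubgroup K n) ∧
        ∀ u, w i n hin u = s * w 0 n hn u * s⁻¹ := by
      by_cases hi0 : i = 0
      · subst hi0
        exact ⟨1, one_mem _, fun k hk a => ⟨k, hk, a, by simp [one_mem]⟩,
          fun a => by simp [one_mem], fun u => by simp⟩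
      · refine ⟨w i 0 hi0 1, hw _ hi hn0 _, fun k hk a => small _ _ _ hi hn0 _ k hk a,
          fun a => conj_inv_w_mem (isMonomial_h _ _ _ a) _ hi hn0 1, fun u => ?_⟩
        rw [← MulAut.conj_apply, (isMonomial_w i 0 hi0 1).conj_w]
        refine w_congr _ _ (by simp) ?_ ?_
        · rw [Equiv.swap_apply_of_ne_of_ne (Ne.symm hin) hn.symm]
        · simp [wEntry, hn.symm, Ne.symm hin]
    by_cases hkn : k = n
    · obtain ⟨k', hk', a', h1⟩ := hsm 0 (Nat.zero_le n) (u * a)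
      refine ⟨k', hk', a', ?_⟩
      have h2 : (w 0 n hn (u * a))⁻¹ * (w 0 n hn u * h n 0 hn.symm a) ∈ rankSymbolSubgroup K n :=
        inv_mul_mem_of_mk_eq (by rw [QuotientGroup.mk_mul, mk_w_mul_h])
      rw [hkn, monomialRep_self, hsw]
      rw [monomialRep_of_ne n hn 0 hn] at h1
      convert mul_mem (mul_mem h1 h2) (inv_mem (hsh a)) using 1
      group
    by_cases hki : k = i
    · subst hki
      obtain ⟨k', hk', a', h1⟩ := hsm n le_rfl (-(u * a⁻¹))⁻¹
      refine ⟨k', hk', a', ?_⟩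
      have h2 : (h n 0 hn.symm (-(u * a⁻¹))⁻¹)⁻¹ * (w 0 n hn u * w 0 n hn a) ∈
          rankSymbolSubgroup K n :=
        inv_mul_mem_of_mk_eq (by rw [QuotientGroup.mk_mul, mk_w_mul_w, mk_h_swap, inv_inv])
      rw [monomialRep_of_ne _ _ _ hkn, hsw, hsw]
      rw [monomialRep_self] at h1
      convert mul_mem (mul_mem h1 h2) (inv_mem hs) using 1
      group
    · have hkn' : k < n := lt_of_le_of_ne hk hkn
      obtain ⟨k', hk', a', h1⟩ := small k i hki hkn' hi
        (wEntry i n u k * a * (wEntry i n u n)⁻¹) i hi.le u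
      refine ⟨k', hk', a', ?_⟩
      have h2 := (isMonomial_w i n hin u).conj_w k n hkn a
      rw [w_congr _ hki (Equiv.swap_apply_of_ne_of_ne hki hkn) (Equiv.swap_apply_right i n) rfl,
        MulAut.conj_apply, mul_inv_eq_iff_eq_mul] at h2
      rwa [monomialRep_of_ne _ _ _ hkn, h2, ← monomialRep_of_ne n hn i hin]
  rcases hi.lt_or_eq with hi' | rfl
  · rcases hj.lt_or_eq with hj' | rfl
    · exact small i j hij hi' hj' u k hk a
    · exact last i hij hi' u k hk a
  · have hj' := lt_of_le_of_ne hj hij.symm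
    rw [w_swap]
    exact last j hij.symm hj' _ k hk a

variable (K) in
/-- The subgroup of `St(K)` which is generated by the `w_{ij}(u)` with `i, j ≤ n`. -/
def monomialSubgroup (n : ℕ) : Subgroup (SteinbergGroup K) :=
  Subgroup.closure {s | ∃ i j h u, i ≤ n ∧ j ≤ n ∧ s = w i j h u}

theorem exists_monomialRep_inv_mul_mem {n : ℕ} (hn : 0 ≠ n) {g : SteinbergGroup K}
    (hg : g ∈ monomialSubgroup K n) : ∃ k ≤ n, ∃ a,
      (monomialRep n hn k a)⁻¹ * g ∈ rankSymbolSubgroup K n := by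
  have step : ∀ (i j : ℕ) (hij : i ≠ j) (_ : i ≤ n) (_ : j ≤ n) (u : Kˣ) (y : SteinbergGroup K),
      (∃ k ≤ n, ∃ a, (monomialRep n hn k a)⁻¹ * y ∈ rankSymbolSubgroup K n) →
      ∃ k ≤ n, ∃ a, (monomialRep n hn k a)⁻¹ * (w i j hij u * y) ∈ rankSymbolSubgroup K n := by
    rintro i j hij hi hj u y ⟨k, hk, a, h1⟩
    obtain ⟨k', hk', a', h2⟩ := exists_w_mul_monomialRep n hn i j hij hi hj u k hk a
    refine ⟨k', hk', a', ?_⟩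
    convert mul_mem h2 h1 using 1
    group
  induction hg using Subgroup.closure_induction_left with
  | one => exact ⟨n, le_rfl, 1, by simp [monomialRep_self, h_one, one_mem]⟩
  | mul_left x hx y _ ih =>
    obtain ⟨i, j, hij, u, hi, hj, rfl⟩ := hx
    exact step i j hij hi hj u y ih
  | inv_mul_cancel x hx y _ ih =>
    obtain ⟨i, j, hij, u, hi, hj, rfl⟩ := hx
    rw [w_inv]
    exact step i j hij hi hj _ y ih

/-! ### The action on `K^∞` of subgroups generated by `x_{ij}(r)` -/

theorem toAut_apply_of_forall_row_ne {X : Set (SteinbergGroup K)} {k : ℕ}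
    (hX : ∀ s ∈ X, ∃ i j h r, i ≠ k ∧ s = x i j h r) {s : SteinbergGroup K}
    (hs : s ∈ Subgroup.closure X) (v : ℕ →₀ K) :
    (toAut K s : Module.End K (ℕ →₀ K)) v k = v k := by
  induction hs using Subgroup.closure_induction generalizing v with
  | mem s hs =>
    obtain ⟨i, j, h, r, hi, rfl⟩ := hX s hs
    simp [toAut_x_apply, hi]
  | one => simp
  | mul a b _ _ ha hb => rw [map_mul, Units.val_mul, Module.End.mul_apply, ha, hb]
  | inv a _ ha =>
    rw [← ha, ← Module.End.mul_apply, ← Units.val_mul, ← map_mul, mul_inv_cancel]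
    simp

theorem toAut_single_of_forall_col_ne {X : Set (SteinbergGroup K)} {k : ℕ}
    (hX : ∀ s ∈ X, ∃ i j h r, j ≠ k ∧ s = x i j h r) {s : SteinbergGroup K}
    (hs : s ∈ Subgroup.closure X) (a : K) :
    (toAut K s : Module.End K (ℕ →₀ K)) (Finsupp.single k a) = Finsupp.single k a := by
  induction hs using Subgroup.closure_induction with
  | mem s hs =>
    obtain ⟨i, j, h, r, hi, rfl⟩ := hX s hs
    simp [toAut_x_apply, hi.symm]
  | one => simp
  | mul a b _ _ ha hb => rw [map_mul, Units.val_mul, Module.End.mul_apply, hb, ha]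
  | inv b _ ha =>
    nth_rw 1 [← ha]
    rw [← Module.End.mul_apply, ← Units.val_mul, ← map_mul, inv_mul_cancel]
    simp

end SteinbergGroup

/-! ### A Bruhat decomposition by columns -/

namespace SteinbergGroup

variable {K : Type*} [Field K]

variable (K) in
/-- The subgroup of the products of elements `x_{li}(r)` with `l ∈ P`. -/
def columnSubgroup (P : Set ℕ) (i : ℕ) : Subgroup (SteinbergGroup K) :=
  Subgroup.closure {s | ∃ l h r, l ∈ P ∧ s = x l i h r}

variable (K) in
/-- The subgroup of the products of elements `x_{nl}(r)` with `l ∈ P`. -/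
def rowSubgroup (P : Set ℕ) (n : ℕ) : Subgroup (SteinbergGroup K) :=
  Subgroup.closure {s | ∃ l h r, l ∈ P ∧ s = x n l h r}

theorem columnSubgroup_mono {P P' : Set ℕ} (hP : P ⊆ P') (i : ℕ) :
    columnSubgroup K P i ≤ columnSubgroup K P' i :=
  Subgroup.closure_mono (by
    rintro _ ⟨l, h, r, hl, rfl⟩
    exact ⟨l, h, r, hP hl, rfl⟩)

theorem x_mem_columnSubgroup {P : Set ℕ} {l i : ℕ} (hl : l ∈ P) (h : l ≠ i) (r : K) :
    x l i h r ∈ columnSubgroup K P i :=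
  Subgroup.subset_closure ⟨l, h, r, hl, rfl⟩

theorem x_mem_normalizer {H : Subgroup (SteinbergGroup K)} {a b : ℕ} (hab : a ≠ b)
    (h : ∀ r : K, ∀ y ∈ H, MulAut.conj (x a b hab r) y ∈ H) (r : K) :
    x a b hab r ∈ Subgroup.normalizer (H : Set (SteinbergGroup K)) := by
  rw [Subgroup.mem_normalizer_iff]
  refine fun y => ⟨fun hy => h r y hy, fun hy => ?_⟩
  have := h (-r) _ hy
  rw [MulAut.conj_apply, ← x_inv, inv_inv] at this
  convert this using 1
  group

theorem x_mem_normalizer_columnSubgroup {n a b i : ℕ} (hab : a ≠ b) (ha : a ≤ n) (hai : a ≠ i)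
    (hbi : b ≠ i) (r : K) : x a b hab r ∈
      Subgroup.normalizer (columnSubgroup K (Set.Iic n) i : Set (SteinbergGroup K)) := by
  refine x_mem_normalizer hab (fun r => ?_) r
  change columnSubgroup K (Set.Iic n) i ≤ (columnSubgroup K (Set.Iic n) i).comap
    (MulAut.conj (x a b hab r)).toMonoidHom
  conv_lhs => rw [columnSubgroup]
  rw [Subgroup.closure_le]
  rintro _ ⟨l, hl, t, hln, rfl⟩
  change MulAut.conj (x a b hab r) (x l i hl t) ∈ columnSubgroup K (Set.Iic n) i
  by_cases hlb : l = b
  · subst hlb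
    rw [conj_x_row a l i hab hl hai]
    exact mul_mem (x_mem_columnSubgroup (Set.mem_Iic.2 ha) _ _) (x_mem_columnSubgroup hln _ _)
  · rw [conj_x_of_ne a b l i hab hl (Ne.symm hlb) hai]
    exact x_mem_columnSubgroup hln _ _

theorem rankSubgroup_le_normalizer_rowSubgroup (n : ℕ) : rankSubgroup K n ≤
    Subgroup.normalizer (rowSubgroup K (Set.Iio n) n : Set (SteinbergGroup K)) := by
  rw [rankSubgroup, Subgroup.closure_le]
  rintro _ ⟨a, b, hab, r, ha, hb, rfl⟩
  refine x_mem_normalizer hab (fun r => ?_) r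
  change rowSubgroup K (Set.Iio n) n ≤ (rowSubgroup K (Set.Iio n) n).comap
    (MulAut.conj (x a b hab r)).toMonoidHom
  conv_lhs => rw [rowSubgroup]
  rw [Subgroup.closure_le]
  rintro _ ⟨l, hl, t, hln, rfl⟩
  change MulAut.conj (x a b hab r) (x n l hl t) ∈ rowSubgroup K (Set.Iio n) n
  by_cases hla : l = a
  · subst hla
    rw [conj_x_col n l b hab hl hb.ne']
    exact mul_mem (Subgroup.subset_closure ⟨l, hl, _, hln, rfl⟩)
      (Subgroup.subset_closure ⟨b, hb.ne', _, hb, rfl⟩)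
  · rw [conj_x_of_ne a b n l hab hl hb.ne (Ne.symm hla)]
    exact Subgroup.subset_closure ⟨l, hl, _, hln, rfl⟩

theorem columnSubgroup_diff_le_normalizer {n i b : ℕ} (hib : i ≠ b) :
    columnSubgroup K (Set.Iic n \ {b}) i ≤
      Subgroup.normalizer (columnSubgroup K (Set.Iic n) b : Set (SteinbergGroup K)) := by
  rw [columnSubgroup, Subgroup.closure_le]
  rintro _ ⟨l, h, r, ⟨hl, hlb⟩, rfl⟩
  exact x_mem_normalizer_columnSubgroup h hl hlb hib r

theorem exists_eq_x_mul_of_mem_columnSubgroup {P : Set ℕ} {i b : ℕ} (hbi : b ≠ i)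
    {y : SteinbergGroup K} (hy : y ∈ columnSubgroup K P i) :
    ∃ c, ∃ y' ∈ columnSubgroup K (P \ {b}) i, y = x b i hbi c * y' := by
  have step : ∀ l (h : l ≠ i) (r : K) (_ : l ∈ P) (y : SteinbergGroup K),
      (∃ c, ∃ y' ∈ columnSubgroup K (P \ {b}) i, y = x b i hbi c * y') →
        ∃ c, ∃ y' ∈ columnSubgroup K (P \ {b}) i, x l i h r * y = x b i hbi c * y' := by
    rintro l h r hl _ ⟨c, y', hy', rfl⟩
    by_cases hlb : l = b
    · subst hlb
      exact ⟨r + c, y', hy', by rw [← mul_assoc, x_mul_x]⟩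
    · refine ⟨c, x l i h r * y',
        mul_mem (Subgroup.subset_closure ⟨l, h, r, ⟨hl, hlb⟩, rfl⟩) hy', ?_⟩
      rw [← mul_assoc, x_comm l i b i h hbi hbi.symm h, mul_assoc]
  induction hy using Subgroup.closure_induction_left with
  | one => exact ⟨0, 1, one_mem _, by rw [x_zero, one_mul]⟩
  | mul_left s hs y _ ih =>
    obtain ⟨l, h, r, hl, rfl⟩ := hs
    exact step l h r hl y ih
  | inv_mul_cancel s hs y _ ih =>
    obtain ⟨l, h, r, hl, rfl⟩ := hs
    rw [x_inv]
    exact step l h _ hl y ih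

theorem exists_eq_x_mul_of_mem_rowSubgroup {P : Set ℕ} {n b : ℕ} (hnb : n ≠ b)
    {y : SteinbergGroup K} (hy : y ∈ rowSubgroup K P n) :
    ∃ c, ∃ y' ∈ rowSubgroup K (P \ {b}) n, y = x n b hnb c * y' := by
  have step : ∀ l (h : n ≠ l) (r : K) (_ : l ∈ P) (y : SteinbergGroup K),
      (∃ c, ∃ y' ∈ rowSubgroup K (P \ {b}) n, y = x n b hnb c * y') →
        ∃ c, ∃ y' ∈ rowSubgroup K (P \ {b}) n, x n l h r * y = x n b hnb c * y' := by
    rintro l h r hl _ ⟨c, y', hy', rfl⟩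
    by_cases hlb : l = b
    · subst hlb
      exact ⟨r + c, y', hy', by rw [← mul_assoc, x_mul_x]⟩
    · refine ⟨c, x n l h r * y',
        mul_mem (Subgroup.subset_closure ⟨l, h, r, ⟨hl, hlb⟩, rfl⟩) hy', ?_⟩
      rw [← mul_assoc, x_comm n l n b h hnb h.symm hnb, mul_assoc]
  induction hy using Subgroup.closure_induction_left with
  | one => exact ⟨0, 1, one_mem _, by rw [x_zero, one_mul]⟩
  | mul_left s hs y _ ih =>
    obtain ⟨l, h, r, hl, rfl⟩ := hs
    exact step l h r hl y ih
  | inv_mul_cancel s hs y _ ih =>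
    obtain ⟨l, h, r, hl, rfl⟩ := hs
    rw [x_inv]
    exact step l h _ hl y ih

theorem eq_one_of_mem_columnSubgroup (F : Finset ℕ) {n : ℕ} {y : SteinbergGroup K}
    (hy : y ∈ columnSubgroup K F n) (h : (toAut K y : Module.End K (ℕ →₀ K)) (Finsupp.single n 1) =
      Finsupp.single n 1) : y = 1 := by
  induction F using Finset.induction_on generalizing y with
  | empty => simpa [columnSubgroup] using hy
  | insert b F hb ih =>
    by_cases hbn : b = n
    · refine ih ?_ h
      subst hbn
      refine Subgroup.closure_mono ?_ hy
      rintro _ ⟨l, h, r, hl, rfl⟩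
      exact ⟨l, h, r, (Finset.mem_insert.1 hl).resolve_left h, rfl⟩
    obtain ⟨c, y', hy', rfl⟩ := exists_eq_x_mul_of_mem_columnSubgroup hbn hy
    have h1 : (toAut K y' : Module.End K (ℕ →₀ K)) (Finsupp.single n 1) b = 0 := by
      rw [toAut_apply_of_forall_row_ne (k := b) _ hy']
      · exact Finsupp.single_eq_of_ne hbn
      · rintro _ ⟨l, h, r, hl, rfl⟩
        exact ⟨l, n, h, r, hl.2, rfl⟩
    have h2 : (toAut K y' : Module.End K (ℕ →₀ K)) (Finsupp.single n 1) n = 1 := by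
      rw [toAut_apply_of_forall_row_ne (k := n) _ hy']
      · exact Finsupp.single_eq_same
      · rintro _ ⟨l, h, r, hl, rfl⟩
        exact ⟨l, n, h, r, h, rfl⟩
    have h3 := DFunLike.congr_fun h b
    rw [map_mul, Units.val_mul, Module.End.mul_apply, toAut_x_apply, Finsupp.add_apply, h1, h2,
      Finsupp.single_eq_same, Finsupp.single_eq_of_ne hbn, zero_add, mul_one] at h3
    rw [h3, x_zero, one_mul] at h ⊢
    refine ih (columnSubgroup_mono ?_ _ hy') h
    rintro l ⟨hl, hlb⟩
    exact (Finset.mem_insert.1 hl).resolve_left hlb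

theorem eq_one_of_mem_rowSubgroup (F : Finset ℕ) {n : ℕ} {y : SteinbergGroup K}
    (hy : y ∈ rowSubgroup K F n) (h : ∀ l ≠ n, (toAut K y : Module.End K (ℕ →₀ K))
      (Finsupp.single l 1) n = 0) : y = 1 := by
  induction F using Finset.induction_on generalizing y with
  | empty => simpa [rowSubgroup] using hy
  | insert b F hb ih =>
    by_cases hbn : n = b
    · refine ih ?_ h
      subst hbn
      refine Subgroup.closure_mono ?_ hy
      rintro _ ⟨l, h, r, hl, rfl⟩
      exact ⟨l, h, r, (Finset.mem_insert.1 hl).resolve_left h.symm, rfl⟩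
    obtain ⟨c, y', hy', rfl⟩ := exists_eq_x_mul_of_mem_rowSubgroup hbn hy
    have h1 : (toAut K y' : Module.End K (ℕ →₀ K)) (Finsupp.single b 1) = Finsupp.single b 1 := by
      refine toAut_single_of_forall_col_ne (k := b) ?_ hy' 1
      rintro _ ⟨l, h, r, hl, rfl⟩
      exact ⟨n, l, h, r, hl.2, rfl⟩
    have h3 := h b (Ne.symm hbn)
    rw [map_mul, Units.val_mul, Module.End.mul_apply, h1, toAut_x_apply, Finsupp.add_apply,
      Finsupp.single_eq_same, Finsupp.single_eq_same, Finsupp.single_eq_of_ne hbn, zero_add,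
      mul_one] at h3
    rw [h3, x_zero, one_mul] at h ⊢
    refine ih (Subgroup.closure_mono ?_ hy') h
    rintro _ ⟨l, h, r, hl, rfl⟩
    exact ⟨l, h, r, (Finset.mem_insert.1 hl.1).resolve_left hl.2, rfl⟩

variable (K) in
/-- The subgroup generated by the `x_{ij}(r)` with `i ≤ n` and `j < n` and by the symbols. It fixes
the `n`-th basis vector. -/
abbrev fixingSubgroup (n : ℕ) : Subgroup (SteinbergGroup K) :=
  rowSubgroup K (Set.Iio n) n ⊔ rankSymbolSubgroup K n

theorem x_mem_fixingSubgroup {n i j : ℕ} (h : i ≠ j) (hi : i ≤ n) (hj : j < n) (r : K) :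
    x i j h r ∈ fixingSubgroup K n := by
  rcases hi.lt_or_eq with hi | rfl
  · exact Subgroup.mem_sup_right (Subgroup.mem_sup_left (x_mem_rankSubgroup h hi hj r))
  · exact Subgroup.mem_sup_left (Subgroup.subset_closure ⟨j, h, r, hj, rfl⟩)

theorem inv_mul_mul_mem_fixingSubgroup {n b : ℕ} {g : SteinbergGroup K} {σ : Equiv.Perm ℕ}
    {d : ℕ → Kˣ} (hg : IsMonomial g σ d) (hσ : ∀ k, n < k → σ k = k) (hb : b ≤ n) (hbn : b ≠ σ n)
    {y : SteinbergGroup K} (hy : y ∈ columnSubgroup K (Set.Iic n) b) :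
    g⁻¹ * y * g ∈ fixingSubgroup K n := by
  have hle : ∀ k ≤ n, σ⁻¹ k ≤ n := by
    intro k hk
    by_contra! h
    have h1 := hσ _ h
    rw [Equiv.Perm.inv_def, Equiv.apply_symm_apply] at h1
    rw [Equiv.Perm.inv_def] at h
    omega
  have key : columnSubgroup K (Set.Iic n) b ≤
      (fixingSubgroup K n).comap (MulAut.conj g⁻¹).toMonoidHom := by
    rw [columnSubgroup, Subgroup.closure_le]
    rintro _ ⟨l, h, r, hl, rfl⟩
    change MulAut.conj g⁻¹ (x l b h r) ∈ fixingSubgroup K n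
    rw [hg.inv.conj_x]
    refine x_mem_fixingSubgroup _ (hle l hl) (lt_of_le_of_ne (hle b hb) fun e => hbn ?_) _
    rw [← e, Equiv.Perm.inv_def, Equiv.apply_symm_apply]
  have h1 := key hy
  rw [Subgroup.mem_comap] at h1
  change g⁻¹ * y * g⁻¹⁻¹ ∈ _ at h1
  rwa [inv_inv] at h1

variable (K) in
/-- The union of the double cosets `Y g Q`, where `g` runs through the monomial elements, `Y` is the
column subgroup of the index to which `g` maps `n`, and `Q` fixes the `n`-th basis vector. -/
def columnCells (n : ℕ) : Set (SteinbergGroup K) :=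
  {s | ∃ g ∈ monomialSubgroup K n, ∃ σ d, IsMonomial g σ d ∧ (∀ k, n < k → σ k = k) ∧
    ∃ y ∈ columnSubgroup K (Set.Iic n) (σ n), ∃ q ∈ fixingSubgroup K n, s = y * g * q}

theorem x_eq_x_mul_w_mul_x (i b : ℕ) (hib : i ≠ b) (c : Kˣ) : x b i hib.symm (c : K) =
    x i b hib ((c⁻¹ : Kˣ) : K) * w i b hib (-c⁻¹) * x i b hib ((c⁻¹ : Kˣ) : K) := by
  simp only [w, inv_neg, inv_inv, Units.val_neg, neg_neg, ← x_inv]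
  group

/-- Multiplication by `x_{ab}(r)` leaves a cell, with `i = σ n`, only if `a = i` and the column
factor has an entry `c ≠ 0` in row `b`; then the identity `x_eq_x_mul_w_mul_x` leads into the cell
of `w_{ib}(-c⁻¹) g`. -/
theorem x_mul_mem_columnCells {n a b : ℕ} (hab : a ≠ b) (ha : a ≤ n) (hb : b ≤ n) (r : K)
    {s : SteinbergGroup K} (hs : s ∈ columnCells K n) : x a b hab r * s ∈ columnCells K n := by
  obtain ⟨g, hgm, σ, d, hg, hσ, y, hy, q, hq, rfl⟩ := hs
  by_cases hbi : b = σ n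
  · subst hbi
    exact ⟨g, hgm, σ, d, hg, hσ, x a _ hab r * y,
      mul_mem (x_mem_columnSubgroup (Set.mem_Iic.2 ha) hab r) hy, q, hq, by simp only [mul_assoc]⟩
  by_cases hai : a = σ n
  swap
  · refine ⟨g, hgm, σ, d, hg, hσ, x a b hab r * y * (x a b hab r)⁻¹, ?_,
      g⁻¹ * x a b hab r * g * q, mul_mem ?_ hq, by group⟩
    · exact (Subgroup.mem_normalizer_iff.1
        (x_mem_normalizer_columnSubgroup hab ha hai hbi r) y).1 hy
    · exact inv_mul_mul_mem_fixingSubgroup hg hσ hb hbi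
        (x_mem_columnSubgroup (Set.mem_Iic.2 ha) hab r)
  subst hai
  obtain ⟨c, y', hy', rfl⟩ := exists_eq_x_mul_of_mem_columnSubgroup hab.symm hy
  -- `x_{ib}(t)`, for `i = σ n`, can be moved through `y' g` into the last factor
  have move : ∀ t : K, ∃ q' ∈ fixingSubgroup K n, x (σ n) b hab t * (y' * g) = y' * g * q' := by
    intro t
    refine ⟨g⁻¹ * (y'⁻¹ * x (σ n) b hab t * y') * g, ?_, by group⟩
    refine inv_mul_mul_mem_fixingSubgroup hg hσ hb hbi ?_
    have h1 := columnSubgroup_diff_le_normalizer hab (inv_mem hy')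
    have h2 := (Subgroup.mem_normalizer_iff.1 h1 _).1
      (x_mem_columnSubgroup (Set.mem_Iic.2 ha) hab t)
    rwa [inv_inv] at h2
  by_cases hc : c = 0
  · obtain ⟨q', hq', e⟩ := move r
    refine ⟨g, hgm, σ, d, hg, hσ, y', columnSubgroup_mono Set.sdiff_subset _ hy', q' * q,
      mul_mem hq' hq, ?_⟩
    rw [hc, x_zero, one_mul, ← mul_assoc, ← mul_assoc (y' * g), ← e]
  · obtain ⟨c, rfl⟩ : ∃ u : Kˣ, (u : K) = c := ⟨Units.mk0 c hc, rfl⟩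
    obtain ⟨q', hq', e⟩ := move ((c⁻¹ : Kˣ) : K)
    have hw := isMonomial_w (σ n) b hab (-c⁻¹)
    have hsw : Equiv.swap (σ n) b (σ n) = b := Equiv.swap_apply_left _ _
    refine ⟨w (σ n) b hab (-c⁻¹) * g,
      mul_mem (Subgroup.subset_closure ⟨_, _, _, _, ha, hb, rfl⟩) hgm, _, _, hw.mul hg,
      fun k hk => ?_,
      x (σ n) b hab (r + ((c⁻¹ : Kˣ) : K)) * MulAut.conj (w (σ n) b hab (-c⁻¹)) y', ?_, q' * q,
      mul_mem hq' hq, ?_⟩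
    · rw [Equiv.Perm.mul_apply, hσ k hk]
      exact Equiv.swap_apply_of_ne_of_ne (ha.trans_lt hk).ne' (hb.trans_lt hk).ne'
    · rw [Equiv.Perm.mul_apply, hsw]
      refine mul_mem (x_mem_columnSubgroup (Set.mem_Iic.2 ha) hab _) ?_
      have key : columnSubgroup K (Set.Iic n \ {b}) (σ n) ≤ (columnSubgroup K (Set.Iic n) b).comap
          (MulAut.conj (w (σ n) b hab (-c⁻¹))).toMonoidHom := by
        rw [columnSubgroup, Subgroup.closure_le]
        rintro _ ⟨l, h, t, ⟨hl, hlb⟩, rfl⟩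
        change MulAut.conj (w (σ n) b hab (-c⁻¹)) (x l (σ n) h t) ∈ columnSubgroup K (Set.Iic n) b
        rw [hw.conj_x, x_congr (Equiv.swap_apply_of_ne_of_ne h hlb) hsw rfl _ hlb]
        exact x_mem_columnSubgroup hl _ _
      exact key hy'
    · have e1 : x (σ n) b hab r * (x b (σ n) hab.symm (c : K) * y' * g * q) =
          x (σ n) b hab (r + ((c⁻¹ : Kˣ) : K)) * w (σ n) b hab (-c⁻¹) *
            (x (σ n) b hab ((c⁻¹ : Kˣ) : K) * (y' * g)) * q := by
        rw [x_eq_x_mul_w_mul_x _ _ hab, ← x_mul_x]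
        simp only [mul_assoc]
      rw [e1, e, MulAut.conj_apply]
      group

/-- The cells exhaust the elements of rank `n + 1`: their union contains `1` and is stable under the
generators of the group. -/
theorem mem_columnCells {n : ℕ} {s : SteinbergGroup K} (hs : s ∈ rankSubgroup K (n + 1)) :
    s ∈ columnCells K n := by
  induction hs using Subgroup.closure_induction_left with
  | one => exact ⟨1, one_mem _, 1, 1, IsMonomial.one, fun _ _ => rfl, 1, one_mem _, 1, one_mem _,
      by simp⟩
  | mul_left s hs y _ ih =>
    obtain ⟨i, j, h, r, hi, hj, rfl⟩ := hs
    exact x_mul_mem_columnCells h (by omega) (by omega) r ih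
  | inv_mul_cancel s hs y _ ih =>
    obtain ⟨i, j, h, r, hi, hj, rfl⟩ := hs
    rw [x_inv]
    exact x_mul_mem_columnCells h (by omega) (by omega) _ ih

/-! ### The kernel of `St(K) → SL(K)` -/

/-- The semidirect decomposition of `fixingSubgroup K n`, up to symbols. -/
theorem exists_eq_mul_of_mem_fixingSubgroup {n : ℕ} {q : SteinbergGroup K}
    (hq : q ∈ fixingSubgroup K n) : ∃ y ∈ rowSubgroup K (Set.Iio n) n, ∃ s ∈ rankSubgroup K n,
      ∃ z ∈ symbolSubgroup K, q = s * y * z := by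
  rw [fixingSubgroup, Subgroup.sup_eq_closure] at hq
  have hnorm : ∀ s ∈ rankSubgroup K n, ∀ y ∈ rowSubgroup K (Set.Iio n) n,
      s⁻¹ * y * s ∈ rowSubgroup K (Set.Iio n) n := by
    intro s hs y hy
    have h1 := rankSubgroup_le_normalizer_rowSubgroup n (inv_mem hs)
    have h2 := (Subgroup.mem_normalizer_iff.1 h1 y).1 hy
    rwa [inv_inv] at h2
  have step : ∀ p ∈ (rowSubgroup K (Set.Iio n) n ∪ rankSymbolSubgroup K n : Set (SteinbergGroup K)),
      ∀ q, (∃ y ∈ rowSubgroup K (Set.Iio n) n, ∃ s ∈ rankSubgroup K n, ∃ z ∈ symbolSubgroup K,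
        q = s * y * z) → ∃ y ∈ rowSubgroup K (Set.Iio n) n, ∃ s ∈ rankSubgroup K n,
          ∃ z ∈ symbolSubgroup K, p * q = s * y * z := by
    rintro p hp _ ⟨y, hy, s, hs, z, hz, rfl⟩
    rcases hp with hp | hp
    · exact ⟨s⁻¹ * p * s * y, mul_mem (hnorm s hs p hp) hy, s, hs, z, hz, by group⟩
    · obtain ⟨s', hs', z', hz', rfl⟩ := Subgroup.mem_sup_of_normal_right.1 hp
      refine ⟨y, hy, s' * s, mul_mem hs' hs, z * z', mul_mem hz hz', ?_⟩
      rw [mul_assoc s' z', ← comm_of_mem_symbolSubgroup hz']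
      simp only [mul_assoc]
  induction hq using Subgroup.closure_induction_left with
  | one => exact ⟨1, one_mem _, 1, one_mem _, 1, one_mem _, by simp⟩
  | mul_left p hp q _ ih => exact step p hp q ih
  | inv_mul_cancel p hp q _ ih =>
    exact step _ (hp.imp (fun h => inv_mem h) (fun h => inv_mem h)) q ih

/-- Induction on the rank. An element of the kernel lies in the cell of a monomial element which
fixes the `n`-th basis vector, hence in `fixingSubgroup K n`; its row factor is then trivial, and up
to symbols it has smaller rank. -/
theorem mem_symbolSubgroup_of_toAut_eq_one (n : ℕ) {s : SteinbergGroup K}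
    (hs : s ∈ rankSubgroup K (n + 1)) (h : toAut K s = 1) : s ∈ symbolSubgroup K := by
  induction n generalizing s with
  | zero =>
    have h1 : rankSubgroup K 1 ≤ ⊥ := by
      rw [rankSubgroup, Subgroup.closure_le]
      rintro _ ⟨i, j, h, r, hi, hj, rfl⟩
      omega
    rw [Subgroup.mem_bot.1 (h1 hs)]
    exact one_mem _
  | succ m ih =>
    obtain ⟨n, hn⟩ : ∃ n, n = m + 1 := ⟨_, rfl⟩
    rw [← hn] at hs ih
    have hn0 : 0 ≠ n := by omega
    obtain ⟨g, hgm, σ, d, hg, -, y, hy, q, hq, rfl⟩ := mem_columnCells hs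
    have hrank : ∀ s ∈ rankSubgroup K n, (toAut K s : Module.End K (ℕ →₀ K)) (Finsupp.single n 1) =
        Finsupp.single n 1 := by
      refine fun s hs => toAut_single_of_forall_col_ne (k := n) ?_ hs 1
      rintro _ ⟨i, j, h, r, hi, hj, rfl⟩
      exact ⟨i, j, h, r, hj.ne, rfl⟩
    have hsymb : ∀ z ∈ symbolSubgroup K, toAut K z = 1 := fun z hz => symbolSubgroup_le_ker hz
    have hfix : ∀ q ∈ fixingSubgroup K n, (toAut K q : Module.End K (ℕ →₀ K))
        (Finsupp.single n 1) = Finsupp.single n 1 := by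
      intro q hq
      obtain ⟨y, hy, s, hs, z, hz, rfl⟩ := exists_eq_mul_of_mem_fixingSubgroup hq
      have hy1 : (toAut K y : Module.End K (ℕ →₀ K)) (Finsupp.single n 1) =
          Finsupp.single n 1 := by
        refine toAut_single_of_forall_col_ne (k := n) ?_ hy 1
        rintro _ ⟨l, h, r, hl, rfl⟩
        exact ⟨n, l, h, r, ne_of_lt hl, rfl⟩
      rw [map_mul, map_mul, hsymb z hz, mul_one, Units.val_mul, Module.End.mul_apply, hy1,
        hrank s hs]
    -- the equation `s e_n = e_n` forces `g e_n = e_n` and `y = 1`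
    have e1 : (toAut K y : Module.End K (ℕ →₀ K)) (Finsupp.single (σ n) (d n : K)) =
        Finsupp.single n 1 := by
      have := congrArg (fun a : LinearMap.GeneralLinearGroup K (ℕ →₀ K) =>
        (a : Module.End K (ℕ →₀ K)) (Finsupp.single n 1)) h
      simpa only [map_mul, Units.val_mul, Module.End.mul_apply, hfix q hq, hg.toAut_single,
        Units.val_one, Module.End.one_apply] using this
    have e2 : (d n : K) = (Finsupp.single n (1 : K)) (σ n) := by
      rw [← e1, toAut_apply_of_forall_row_ne (k := σ n) _ hy, Finsupp.single_eq_same]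
      rintro _ ⟨l, h, r, hl, rfl⟩
      exact ⟨l, _, h, r, h, rfl⟩
    have e3 : σ n = n := by
      by_contra hne
      rw [Finsupp.single_eq_of_ne hne] at e2
      exact (d n).ne_zero e2
    rw [e3, Finsupp.single_eq_same] at e2
    rw [e3, e2] at e1
    rw [e3, ← Finset.coe_Iic] at hy
    obtain rfl := eq_one_of_mem_columnSubgroup _ hy e1
    obtain ⟨k, hk, a, hga⟩ := exists_monomialRep_inv_mul_mem hn0 hgm
    have hgq : g ∈ rankSymbolSubgroup K n := by
      have e4 := hfix _ (Subgroup.mem_sup_right hga)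
      rw [map_mul, map_inv, Units.val_mul, Module.End.mul_apply, hg.toAut_single, e3, e2] at e4
      have e5 : (toAut K (monomialRep n hn0 k a) : Module.End K (ℕ →₀ K)) (Finsupp.single n 1) =
          Finsupp.single n 1 := by
        nth_rw 1 [← e4]
        rw [← Module.End.mul_apply, Units.mul_inv, Module.End.one_apply]
      by_cases hkn : k = n
      · rw [hkn, monomialRep_self, (isMonomial_h _ _ _ a).toAut_single, if_pos rfl] at e5
        have e6 : a = 1 := Units.ext (Finsupp.single_injective n e5)
        rwa [hkn, monomialRep_self, e6, h_one, inv_one, one_mul] at hga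
      · rw [monomialRep_of_ne _ _ _ hkn, (isMonomial_w _ _ _ a).toAut_single,
          Equiv.swap_apply_right] at e5
        have e6 := DFunLike.congr_fun e5 n
        rw [Finsupp.single_eq_of_ne (Ne.symm hkn), Finsupp.single_eq_same] at e6
        exact absurd e6 zero_ne_one
    obtain ⟨y, hy, s, hs, z, hz, hsyz⟩ := exists_eq_mul_of_mem_fixingSubgroup
      (mul_mem (Subgroup.mem_sup_right hgq) hq : g * q ∈ fixingSubgroup K n)
    rw [one_mul, hsyz] at h ⊢
    rw [map_mul, hsymb z hz, mul_one] at h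
    obtain rfl : y = 1 := by
      refine eq_one_of_mem_rowSubgroup (n := n) (Finset.Iio n)
        (by rw [Finset.coe_Iio]; exact hy) fun l hl => ?_
      have := congrArg (fun a : LinearMap.GeneralLinearGroup K (ℕ →₀ K) =>
        (a : Module.End K (ℕ →₀ K)) (Finsupp.single l 1) n) h
      simp only [map_mul, Units.val_mul, Module.End.mul_apply, Units.val_one,
        Module.End.one_apply] at this
      rw [toAut_apply_of_forall_row_ne (k := n) _ hs, Finsupp.single_eq_of_ne hl.symm] at this
      · exact this
      · rintro _ ⟨i, j, h, r, hi, hj, rfl⟩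
        exact ⟨i, j, h, r, hi.ne, rfl⟩
    rw [mul_one] at h ⊢
    exact mul_mem (ih hs h) hz

/-- `K_2` of a field is generated by the symbols. -/
theorem ker_toAut_eq : (toAut K).ker = symbolSubgroup K := by
  refine le_antisymm (fun s hs => ?_) symbolSubgroup_le_ker
  obtain ⟨n, hn⟩ := exists_mem_rankSubgroup s
  refine mem_symbolSubgroup_of_toAut_eq_one n ?_ hs
  refine Subgroup.closure_mono ?_ hn
  rintro _ ⟨i, j, h, r, hi, hj, rfl⟩
  exact ⟨i, j, h, r, by omega, by omega, rfl⟩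

theorem comm_of_mem_ker {z : SteinbergGroup K} (hz : toAut K z = 1) (g : SteinbergGroup K) :
    g * z = z * g :=
  comm_of_mem_symbolSubgroup (ker_toAut_eq (K := K) ▸ MonoidHom.mem_ker.2 hz) g

end SteinbergGroup

section K2

open SteinbergGroup

variable {K : Type*} [Field K]

/-- Homomorphisms from `K_2(K)` are determined by their values on symbols. -/
theorem K2.hom_ext {A : Type*} [Group A] {φ ψ : K2 K →* A}
    (h : ∀ u v : Kˣ, φ (symbol u v) = ψ (symbol u v)) : φ = ψ := by
  have key : Subgroup.closure {k : K2 K | ∃ u v, k = symbol u v} = ⊤ := by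
    rw [eq_top_iff]
    rintro ⟨s, hs⟩ -
    have hs' := hs
    rw [ker_toAut_eq, symbolSubgroup] at hs'
    induction hs' using Subgroup.closure_induction with
    | mem s h =>
      obtain ⟨u, v, rfl⟩ := h
      exact Subgroup.subset_closure ⟨u, v, rfl⟩
    | one => exact one_mem _
    | mul a b ha hb iha ihb =>
      have ha' := symbolSubgroup_le_ker ha
      have hb' := symbolSubgroup_le_ker hb
      exact mul_mem (iha ha') (ihb hb')
    | inv a ha iha => exact inv_mem (iha (symbolSubgroup_le_ker ha))
  refine MonoidHom.eq_of_eqOn_dense key ?_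
  rintro _ ⟨u, v, rfl⟩
  exact h u v

/-- The commutator of two elements depends only on their images in `SL(K)`. -/
theorem SteinbergGroup.commutator_congr {a a' b b' : SteinbergGroup K}
    (ha : toAut K a = toAut K a') (hb : toAut K b = toAut K b') : ⁅a, b⁆ = ⁅a', b'⁆ :=
  commutatorElement_congr_of_ker_le_center
    (fun _ hz => Subgroup.mem_center_iff.2 (comm_of_mem_ker hz)) ha hb

theorem toAut_h_mul (i j : ℕ) (hij : i ≠ j) (u v : Kˣ) :
    toAut K (h i j hij (u * v)) = toAut K (h i j hij u * h i j hij v) := by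
  ext1
  refine LinearMap.ext fun f => Finsupp.ext fun k => ?_
  simp only [map_mul, Units.val_mul, Module.End.mul_apply, toAut_h_apply]
  split_ifs
  · ring
  · simp only [mul_inv, Units.val_mul]; ring
  · ring

theorem symbol_mul_left (u u' v : Kˣ) : symbol (u * u') v = symbol u v * symbol u' v := by
  ext1
  change ⁅_, _⁆ = ⁅_, _⁆ * ⁅_, _⁆
  rw [commutator_congr (toAut_h_mul 0 1 (by decide) u u') rfl]
  have h1 := comm_of_mem_ker (symbol u' v).2 (h 0 1 (by decide) u)
  change _ * ⁅_, _⁆ = ⁅_, _⁆ * _ at h1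
  have e1 : ∀ a b c : SteinbergGroup K, ⁅a * b, c⁆ = a * ⁅b, c⁆ * a⁻¹ * ⁅a, c⁆ := by
    intro a b c
    simp only [commutatorElement_def]
    group
  rw [e1, h1, mul_inv_cancel_right]
  exact (comm_of_mem_ker (symbol u' v).2 _).symm

/-- Conjugation by `w_{12}(1)` exchanges `h_{01}` and `h_{02}` up to central elements, and it fixes
the symbols. -/
theorem symbol_swap (u v : Kˣ) : symbol v u = (symbol u v)⁻¹ := by
  ext1
  change ⁅_, _⁆ = ⁅_, _⁆⁻¹
  rw [commutatorElement_inv]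
  have hw := isMonomial_w (K := K) 1 2 (by decide) 1
  have h1 := comm_of_mem_ker (symbol v u).2 (w 1 2 (by decide) 1)
  change _ * ⁅_, _⁆ = ⁅_, _⁆ * _ at h1
  rw [← mul_inv_eq_iff_eq_mul, ← MulAut.conj_apply, map_commutatorElement] at h1
  rw [← h1]
  have key : ∀ i j i' j' (hij : i ≠ j) (hij' : i' ≠ j') (t : Kˣ), Equiv.swap 1 2 i = i' →
      Equiv.swap 1 2 j = j' →
      toAut K (MulAut.conj (w 1 2 (by decide) 1) (h i j hij t)) = toAut K (h i' j' hij' t) := by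
    rintro i j _ _ hij hij' t rfl rfl
    obtain ⟨c, hc⟩ : ∃ c, c = wEntry (K := K) 1 2 1 i := ⟨_, rfl⟩
    obtain ⟨d, hd⟩ : ∃ d, d = wEntry (K := K) 1 2 1 j := ⟨_, rfl⟩
    have e : MulAut.conj (w 1 2 (by decide) 1) (h i j hij t) =
        w _ _ hij' (c * t * d⁻¹) * w _ _ hij' (c * (-1) * d⁻¹) := by
      rw [h, map_mul, hw.conj_w, hw.conj_w, hc, hd]
    rw [e, w_mul_w, map_mul, map_inv, mul_inv_eq_iff_eq_mul, ← map_mul, ← toAut_h_mul]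
    congr 2
    rw [mul_neg_one, neg_mul, neg_neg, mul_comm c t, mul_assoc]
  exact commutator_congr (key _ _ _ _ _ (by decide) _ (by decide) (by decide))
    (key _ _ _ _ _ (by decide) _ (by decide) (by decide))

end K2

/-! ### The universal property of the Steinberg group -/

namespace SteinbergGroup

variable {K : Type*} [Field K] {E G : Type*} [Group E] [Group G]

/-- Two homomorphisms from `St(K)` to a central extension which agree after the projection agree,
since the generators of `St(K)` are commutators. -/
theorem hom_ext_of_ker_le_center {p : E →* G} (hp : p.ker ≤ Subgroup.center E)
    {f g : SteinbergGroup K →* E} (h : p.comp f = p.comp g) : f = g := by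
  refine hom_ext fun i j hij r => ?_
  obtain ⟨m, hm⟩ := Infinite.exists_notMem_finset ({i, j} : Finset ℕ)
  simp only [Finset.mem_insert, Finset.mem_singleton, not_or] at hm
  rw [x_eq_commutator i j m hij (Ne.symm hm.1) hm.2, map_commutatorElement, map_commutatorElement]
  exact commutatorElement_congr_of_ker_le_center hp (DFunLike.congr_fun h _)
    (DFunLike.congr_fun h _)

variable {p : E →* G} {ρ : SteinbergGroup K →* G}

/-- If lifts of `a` and `b` commute with lifts of `t` up to central elements, then the commutator of
lifts of `a` and `b` commutes with lifts of `t`. -/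
theorem commutator_eq_one_of_lift (hp : p.ker ≤ Subgroup.center E)
    {a b t : SteinbergGroup K} (ha : ⁅a, t⁆ = 1) (hb : ⁅b, t⁆ = 1) {A B T : E}
    (hA : p A = ρ a) (hB : p B = ρ b) (hT : p T = ρ t) : ⁅⁅A, B⁆, T⁆ = 1 := by
  have h1 : MulAut.conj T ⁅A, B⁆ = ⁅A, B⁆ := by
    rw [map_commutatorElement]
    have key : ∀ a A, ⁅a, t⁆ = 1 → p A = ρ a → p (MulAut.conj T A) = p A := by
      intro a A h hA
      rw [MulAut.conj_apply, map_mul, map_mul, map_inv, hT, hA, ← map_mul, ← map_inv, ← map_mul,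
        ← commutatorElement_eq_one_iff_mul_comm.1 h, mul_inv_cancel_right]
    exact commutatorElement_congr_of_ker_le_center hp (key a A ha hA) (key b B hb hB)
  rw [commutatorElement_eq_one_iff_mul_comm]
  rw [MulAut.conj_apply, mul_inv_eq_iff_eq_mul] at h1
  exact h1.symm

/-- Lifts of commuting generators commute: the first one is a commutator of generators with a new
index, both of which commute with the second one. -/
theorem commutator_lift_x_eq_one (hp : p.ker ≤ Subgroup.center E) (i j k l : ℕ)
    (hij : i ≠ j) (hkl : k ≠ l) (hjk : j ≠ k) (hil : i ≠ l) (r s : K)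
    (hρ : ∀ g, ∃ e, p e = ρ g) {A B : E}
    (hA : p A = ρ (x i j hij r)) (hB : p B = ρ (x k l hkl s)) : ⁅A, B⁆ = 1 := by
  obtain ⟨m, hm⟩ := Infinite.exists_notMem_finset ({i, j, k, l} : Finset ℕ)
  simp only [Finset.mem_insert, Finset.mem_singleton, not_or] at hm
  obtain ⟨hmi, hmj, hmk, hml⟩ := hm
  obtain ⟨C, hC⟩ := hρ (x i m (Ne.symm hmi) r)
  obtain ⟨D, hD⟩ := hρ (x m j hmj 1)
  have e : p A = p ⁅C, D⁆ := by
    rw [hA, map_commutatorElement, hC, hD, ← map_commutatorElement, ← x_eq_commutator]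
  rw [commutatorElement_congr_of_ker_le_center hp e rfl]
  exact commutator_eq_one_of_lift hp
    (commutator_x_x_eq_one _ _ _ _ _ _ hmk hil _ _)
    (commutator_x_x_eq_one _ _ _ _ _ _ hjk hml _ _) hC hD hB

/-- The instance of the Hall–Witt identity in which `A` commutes with `C`. -/
theorem commutator_assoc_of_comm {A B C : E} (h1 : ⁅A, C⁆ = 1) (h2 : ⁅⁅A, B⁆, ⁅B, C⁆⁆ = 1)
    (h3 : ⁅⁅⁅A, B⁆, C⁆, ⁅B, C⁆⁆ = 1) : ⁅A, ⁅B, C⁆⁆ = ⁅⁅A, B⁆, C⁆ := by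
  have e1 : MulAut.conj A C = C := by
    rw [MulAut.conj_apply, commutatorElement_eq_one_iff_mul_comm.1 h1, mul_inv_cancel_right]
  have e2 : MulAut.conj A ⁅B, C⁆ = ⁅A, B⁆ * ⁅B, C⁆ * ⁅A, B⁆⁻¹ * ⁅⁅A, B⁆, C⁆ := by
    rw [map_commutatorElement, e1, MulAut.conj_apply]
    simp only [commutatorElement_def]
    group
  rw [commutatorElement_eq_one_iff_mul_comm] at h2 h3
  rw [h2, mul_inv_cancel_right, ← h3] at e2
  calc ⁅A, ⁅B, C⁆⁆ = MulAut.conj A ⁅B, C⁆ * ⁅B, C⁆⁻¹ := rfl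
    _ = _ := by rw [e2, mul_inv_cancel_right]

/-- The commutator of lifts of `x_{ik}` and `x_{kj}` does not depend on the middle index `k`. This
is what makes the lifts of the generators in `exists_lift` satisfy the Steinberg relations. -/
theorem commutator_lift_x_eq (hp : p.ker ≤ Subgroup.center E) (i k l j : ℕ) (hik : i ≠ k)
    (hkj : k ≠ j) (hil : i ≠ l) (hlj : l ≠ j) (hkl : k ≠ l) (hij : i ≠ j) (r s t : K)
    (hρ : ∀ g, ∃ e, p e = ρ g) {A B C D : E}
    (hA : p A = ρ (x i k hik r)) (hB : p B = ρ (x k j hkj (s * t)))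
    (hC : p C = ρ (x i l hil (r * s))) (hD : p D = ρ (x l j hlj t)) : ⁅A, B⁆ = ⁅C, D⁆ := by
  obtain ⟨M, hM⟩ := hρ (x k l hkl s)
  have hB' : p ⁅M, D⁆ = ρ (x k j hkj (s * t)) := by
    rw [map_commutatorElement, hM, hD, ← map_commutatorElement, commutator_x_x]
  have hC' : p ⁅A, M⁆ = ρ (x i l hil (r * s)) := by
    rw [map_commutatorElement, hA, hM, ← map_commutatorElement, commutator_x_x]
  rw [commutatorElement_congr_of_ker_le_center hp rfl (hB.trans hB'.symm),
    commutatorElement_congr_of_ker_le_center hp (hC.trans hC'.symm) rfl]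
  have hX : p ⁅⁅A, M⁆, D⁆ = ρ (x i j hij (r * s * t)) := by
    rw [map_commutatorElement, hC', hD, ← map_commutatorElement, commutator_x_x]
  exact commutator_assoc_of_comm
    (commutator_lift_x_eq_one hp i k l j hik hlj hkl hij _ _ hρ hA hD)
    (commutator_lift_x_eq_one hp i l k j hil hkj hkl.symm hij _ _ hρ hC' hB')
    (commutator_lift_x_eq_one hp i j k j hij hkj hkj.symm hij _ _ hρ hX hB')

/-- `St(K)` is a universal central extension: every homomorphism from `St(K)` lifts to a central
extension. -/
theorem exists_lift (hp : p.ker ≤ Subgroup.center E) (hρ : ∀ g, ∃ e, p e = ρ g) :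
    ∃ f : SteinbergGroup K →* E, p.comp f = ρ := by
  choose L hL using hρ
  have hρ : ∀ g, ∃ e, p e = ρ g := fun g => ⟨L g, hL g⟩
  let m : ℕ → ℕ → ℕ := fun i j => i + j + 1
  have hm1 : ∀ i j, i ≠ m i j := fun i j => by simp only [m]; omega
  have hm2 : ∀ i j, m i j ≠ j := fun i j => by simp only [m]; omega
  let X : ∀ i j : ℕ, i ≠ j → K → E := fun i j _ r =>
    ⁅L (x i (m i j) (hm1 i j) r), L (x (m i j) j (hm2 i j) 1)⁆
  have hX : ∀ i j hij r, p (X i j hij r) = ρ (x i j hij r) := by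
    intro i j hij r
    simp only [X]
    rw [map_commutatorElement, hL, hL, ← map_commutatorElement, ← x_eq_commutator]
  have mid : ∀ i k j (hik : i ≠ k) (hkj : k ≠ j) (hij : i ≠ j) (r s : K),
      ⁅X i k hik r, X k j hkj s⁆ = X i j hij (r * s) := by
    intro i k j hik hkj hij r s
    obtain ⟨l, hl⟩ := Infinite.exists_notMem_finset ({i, j, k, m i j} : Finset ℕ)
    simp only [Finset.mem_insert, Finset.mem_singleton, not_or] at hl
    obtain ⟨hli, hlj, hlk, hlm⟩ := hl
    have e1 := commutator_lift_x_eq hp i k l j hik hkj (Ne.symm hli) hlj (Ne.symm hlk) hij r s 1 hρ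
      (A := X i k hik r) (B := X k j hkj s) (hX _ _ _ _) (by rw [mul_one]; exact hX _ _ _ _)
      (hL _) (hL _)
    have e2 := commutator_lift_x_eq hp i (m i j) l j (hm1 i j) (hm2 i j) (Ne.symm hli) hlj
      (Ne.symm hlm) hij (r * s) 1 1 hρ (hL _) (by rw [mul_one]; exact hL _)
      (by rw [mul_one]; exact hL (x i l (Ne.symm hli) (r * s))) (hL _)
    exact e1.trans e2.symm
  have h3 : ∀ i j k l hij hkl, j ≠ k → i ≠ l → ∀ r s, ⁅X i j hij r, X k l hkl s⁆ = 1 :=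
    fun i j k l hij hkl hjk hil r s =>
      commutator_lift_x_eq_one hp i j k l hij hkl hjk hil r s hρ (hX _ _ _ _) (hX _ _ _ _)
  refine ⟨lift X ?_ (fun i j k hij hjk hik r s => mid i j k hij hjk hik r s) h3, ?_⟩
  · intro i j hij r s
    have hk1 := hm1 i j
    have hk2 := hm2 i j
    have e1 : ∀ a b c : E, ⁅a * b, c⁆ = a * ⁅b, c⁆ * a⁻¹ * ⁅a, c⁆ := by
      intro a b c
      simp only [commutatorElement_def]
      group
    have e2 : ⁅X i (m i j) hk1 r * X i (m i j) hk1 s, X (m i j) j hk2 1⁆ = X i j hij (r + s) := by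
      refine commutatorElement_congr_of_ker_le_center hp ?_ ?_
      · rw [map_mul, hX _ _ hk1, hX _ _ hk1, hL, ← map_mul, x_mul_x]
      · rw [hX, hL]
    rw [e1, mid _ _ _ hk1 hk2 hij, mid _ _ _ hk1 hk2 hij, mul_one, mul_one,
      commutatorElement_eq_one_iff_mul_comm.1 (h3 _ _ _ _ hk1 hij hk1.symm hij r s),
      mul_inv_cancel_right] at e2
    rw [← e2]
    exact commutatorElement_eq_one_iff_mul_comm.1 (h3 _ _ _ _ hij hij hij.symm hij r s)
  · refine hom_ext fun i j hij r => ?_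
    rw [MonoidHom.comp_apply, lift_x, hX]

end SteinbergGroup

/-! ### Existence of coherent systems of Haar measures -/

section Cocycle

/-- On a downward directed ordered set, every `2`-cocycle with real values is a coboundary. -/
theorem exists_coboundary {X : Type*} [PartialOrder X] (hX : ∀ a b : X, ∃ c, c ≤ a ∧ c ≤ b)
    (t : X → X → X → ℝ)
    (ht : ∀ a b c d, a ≤ b → b ≤ c → c ≤ d → t a b c + t a c d = t b c d + t a b d) :
    ∃ s : X → X → ℝ, ∀ a b c, a ≤ b → b ≤ c → s a b + s b c + t a b c = s a c := by
  rcases isEmpty_or_nonempty X with hE | ⟨⟨p⟩⟩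
  · exact ⟨fun _ _ => 0, fun a => (hE.false a).elim⟩
  -- On the elements above a fixed `u`, minus `t u` is a primitive; the correction `A u`, which
  -- compares with the base point `p`, makes the primitives `S u` for different `u` agree.
  choose q hq hqp using fun a => hX a p
  choose r hr hr' using fun a b => hX (q a) (q b)
  let A : X → X → ℝ := fun u a => t u (q a) a - t u (q a) p
  let S : X → X → X → ℝ := fun u a b => A u b - A u a - t u a b
  have indep : ∀ a b u v, a ≤ b → u ≤ v → v ≤ q a → v ≤ q b → S u a b = S v a b := by
    intro a b u v hab huv hva hvb
    have h1 := ht u v (q a) a huv hva (hq a)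
    have h2 := ht u v (q a) p huv hva (hqp a)
    have h3 := ht u v (q b) b huv hvb (hq b)
    have h4 := ht u v (q b) p huv hvb (hqp b)
    have h5 := ht u v a b huv (hva.trans (hq a)) hab
    simp only [S, A]
    linarith
  have indep' : ∀ a b u v, a ≤ b → u ≤ q a → u ≤ q b → v ≤ q a → v ≤ q b → S u a b = S v a b := by
    intro a b u v hab hua hub hva hvb
    obtain ⟨w, hwu, hwv⟩ := hX u v
    rw [← indep a b w u hab hwu hua hub, ← indep a b w v hab hwv hva hvb]
  refine ⟨fun a b => S (r a b) a b, fun a b c hab hbc => ?_⟩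
  obtain ⟨u, hu, huc⟩ := hX (r a b) (q c)
  have hua := hu.trans (hr a b)
  have hub := hu.trans (hr' a b)
  have e1 := indep' a b _ u hab (hr a b) (hr' a b) hua hub
  have e2 := indep' b c _ u hbc (hr b c) (hr' b c) hub huc
  have e3 := indep' a c _ u (hab.trans hbc) (hr a c) (hr' a c) hua huc
  have h1 := ht u a b c (hua.trans (hq a)) hab hbc
  simp only [e1, e2, e3]
  simp only [S]
  linarith

end Cocycle

section Existence

open MeasureTheory OLattice

variable {O K : Type*} [CommRing O] [Field K] [Algebra O K] {n : ℕ}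

namespace OLattice.Quot

variable {N L M R : OLattice O K n}

/-- The residue class in `L / N` of an element of `L`. -/
def mk (N : OLattice O K n) {L : OLattice O K n} (v : L.1) : N.Quot L :=
  Submodule.mkQ (N.1.submoduleOf L.1) v

theorem mk_surjective : Function.Surjective (mk N : L.1 → N.Quot L) :=
  Submodule.mkQ_surjective _

theorem mk_eq_mk_iff {v w : L.1} : mk N v = mk N w ↔ (v - w : Fin n → K) ∈ N.1 :=
  Submodule.Quotient.eq _

theorem proj_mk (h : N ≤ L) (v : M.1) : proj h (mk N v) = mk L v := rfl

theorem incl_mk (h : L ≤ M) (v : L.1) : incl (N := N) h (mk N v) = mk N ⟨v, h v.2⟩ := rfl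

variable [TopologicalSpace K]

theorem isOpenQuotientMap_mk [IsTopologicalAddGroup K] :
    IsOpenQuotientMap (mk N : L.1 → N.Quot L) :=
  Submodule.isOpenQuotientMap_mkQ _

theorem isOpenQuotientMap_proj [IsTopologicalAddGroup K] (h : N ≤ L) :
    IsOpenQuotientMap (proj (M := M) h) where
  surjective := proj_surjective h
  continuous := continuous_map continuous_id _ _
  isOpenMap U hU := by
    have e : proj (M := M) h '' U = mk L '' (mk N ⁻¹' U) := by
      ext x
      constructor
      · rintro ⟨y, hy, rfl⟩
        obtain ⟨v, rfl⟩ := mk_surjective y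
        exact ⟨v, hy, rfl⟩
      · rintro ⟨v, hv, rfl⟩
        exact ⟨mk N v, hv, rfl⟩
    rw [e]
    exact isOpenQuotientMap_mk.isOpenMap _ (hU.preimage isOpenQuotientMap_mk.continuous)

theorem isInducing_incl [IsTopologicalAddGroup K] (hN : N ≤ L) (h : L ≤ M) :
    Topology.IsInducing (incl (N := N) h) := by
  refine ⟨le_antisymm (continuous_map continuous_id _ _).le_induced ?_⟩
  intro U hU
  obtain ⟨V, hV, hVU⟩ := (hU.preimage isOpenQuotientMap_mk.continuous :
    IsOpen (mk N ⁻¹' U : Set L.1))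
  refine ⟨mk N '' (Subtype.val ⁻¹' V : Set M.1), isOpenQuotientMap_mk.isOpenMap _
    (hV.preimage continuous_subtype_val), ?_⟩
  ext x
  obtain ⟨v, rfl⟩ := mk_surjective x
  constructor
  · rintro ⟨w, hw, e⟩
    rw [incl_mk, mk_eq_mk_iff] at e
    have hw' : (w : Fin n → K) ∈ L.1 := by
      have := add_mem (hN e) v.2
      rwa [sub_add_cancel] at this
    have h1 : mk N ⟨w, hw'⟩ = mk N v := mk_eq_mk_iff.2 e
    rw [← h1]
    have h2 : (⟨w, hw'⟩ : L.1) ∈ (Subtype.val ⁻¹' V : Set L.1) := hw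
    rwa [hVU] at h2
  · intro hv
    have h2 : v ∈ (mk N ⁻¹' U : Set L.1) := hv
    rw [← hVU] at h2
    exact ⟨⟨v, h v.2⟩, h2, rfl⟩

theorem isSES [IsLatticeTopology O K] (hNL : N ≤ L) (hLM : L ≤ M) :
    TopologicalAddGroup.IsSES (incl (N := N) hLM).toAddMonoidHom
      (proj (M := M) hNL).toAddMonoidHom := by
  have := IsLatticeTopology.isTopologicalAddGroup (O := O) (K := K)
  have := IsLatticeTopology.t2Space n L M hLM
  have hex : Function.Exact (incl (N := N) hLM) (proj (M := M) hNL) := by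
    intro y
    constructor
    · intro hy
      obtain ⟨z, hz⟩ := exists_incl_of_proj_eq hNL hLM (x := y) (y := 0) (by rw [hy, map_zero])
      exact ⟨z, by rw [hz, zero_add]⟩
    · rintro ⟨z, rfl⟩
      obtain ⟨v, rfl⟩ := mk_surjective z
      rw [incl_mk, proj_mk]
      refine (mk_eq_mk_iff (w := 0)).2 ?_
      rw [ZeroMemClass.coe_zero, sub_zero]
      exact v.2
  refine ⟨⟨⟨isInducing_incl hNL hLM, ?_⟩, ?_⟩, isOpenQuotientMap_proj hNL, hex⟩
  · intro y z hyz
    obtain ⟨v, rfl⟩ := mk_surjective y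
    obtain ⟨w, rfl⟩ := mk_surjective z
    have h : mk N (L := M) ⟨v, hLM v.2⟩ = mk N ⟨w, hLM w.2⟩ := hyz
    rw [mk_eq_mk_iff] at h
    exact mk_eq_mk_iff.2 h
  · have e : Set.range (incl (N := N) hLM) = proj (M := M) hNL ⁻¹' {0} := by
      ext y; exact (hex y).symm
    change IsClosed (Set.range (incl (N := N) hLM))
    rw [e]
    exact isClosed_singleton.preimage (isOpenQuotientMap_proj hNL).continuous

end OLattice.Quot

variable [TopologicalSpace K]

theorem IsTensor.smul {N L M : OLattice O K n} {hNL : N ≤ L} {hLM : L ≤ M}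
    {α : Measure (N.Quot L)} {β : Measure (L.Quot M)} {γ : Measure (N.Quot M)}
    (h : IsTensor hNL hLM α β γ) (a b : PosReal) :
    IsTensor hNL hLM (ENNReal.ofReal a • α) (ENNReal.ofReal b • β)
      (ENNReal.ofReal ((a * b : PosReal) : ℝ) • γ) := by
  intro f hf hfs F hF
  have h1 := h f hf hfs (fun z => (a : ℝ)⁻¹ * F z) fun x => by
    rw [hF, integral_posReal_smul, inv_mul_cancel_left₀ a.2.ne']
  rw [integral_posReal_smul, integral_posReal_smul, h1, integral_const_mul]
  have := a.2.ne'
  change (a * b : ℝ) * _ = _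
  field_simp

variable [IsLatticeTopology O K]

/-- The tensor product of Haar measures is the Haar measure of the extension
`0 → L / N → M / N → M / L → 0` of topological groups. -/
theorem exists_isTensor {N L M : OLattice O K n} (hNL : N ≤ L) (hLM : L ≤ M)
    (α : Measure (N.Quot L)) (β : Measure (L.Quot M)) [α.IsAddHaarMeasure] [β.IsAddHaarMeasure] :
    ∃ γ : Measure (N.Quot M), γ.IsAddHaarMeasure ∧ γ.Regular ∧ IsTensor hNL hLM α β γ := by
  have := IsLatticeTopology.isTopologicalAddGroup (O := O) (K := K)
  have := IsLatticeTopology.locallyCompactSpace n N M (hNL.trans hLM)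
  have := IsLatticeTopology.t2Space n N M (hNL.trans hLM)
  have H := Quot.isSES hNL hLM
  refine ⟨H.inducedMeasure α β, inferInstance, inferInstance, fun f hf hfs F hF => ?_⟩
  have h1 := H.integral_inducedMeasure α β ⟨⟨f, hf⟩, hfs⟩
  refine h1.trans ?_
  rw [H.integrate_apply]
  refine integral_congr_ae (Filter.Eventually.of_forall fun z => ?_)
  obtain ⟨x, rfl⟩ := Quot.proj_surjective hNL z
  rw [hF]
  exact H.pushforward_apply_apply α ⟨⟨f, hf⟩, hfs⟩ x

/-- The tensor product of relative measures is associative. -/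
theorem IsTensor.integral_eq {N L M R : OLattice O K n} (hNL : N ≤ L) (hLM : L ≤ M) (hMR : M ≤ R)
    {α : Measure (N.Quot L)} {β : Measure (L.Quot M)} {γ : Measure (M.Quot R)}
    {αβ : Measure (N.Quot M)} {βγ : Measure (L.Quot R)} {δ δ' : Measure (N.Quot R)}
    [α.IsAddHaarMeasure] [β.IsAddHaarMeasure]
    (h1 : IsTensor hNL hLM α β αβ) (h2 : IsTensor (hNL.trans hLM) hMR αβ γ δ)
    (h3 : IsTensor hLM hMR β γ βγ) (h4 : IsTensor hNL (hLM.trans hMR) α βγ δ')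
    {f : N.Quot R → ℝ} (hf : Continuous f) (hfs : HasCompactSupport f) :
    ∫ x, f x ∂δ = ∫ x, f x ∂δ' := by
  have := IsLatticeTopology.isTopologicalAddGroup (O := O) (K := K)
  have := IsLatticeTopology.locallyCompactSpace n N R (hNL.trans (hLM.trans hMR))
  have H := Quot.isSES hNL (hLM.trans hMR)
  have H' := Quot.isSES (hNL.trans hLM) hMR
  have H'' := Quot.isSES hLM hMR
  let F₂ := H.pushforward α ⟨⟨f, hf⟩, hfs⟩
  have hF₂ : ∀ x, F₂ (Quot.proj hNL x) = ∫ y, f (x + Quot.incl (hLM.trans hMR) y) ∂α :=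
    fun x => H.pushforward_apply_apply α ⟨⟨f, hf⟩, hfs⟩ x
  have := IsLatticeTopology.locallyCompactSpace n L R (hLM.trans hMR)
  let F₃ := H''.pushforward β F₂
  have hF₃ : ∀ x, F₃ (Quot.proj hLM x) = ∫ y, F₂ (x + Quot.incl hMR y) ∂β :=
    fun x => H''.pushforward_apply_apply β F₂ x
  rw [h4 f hf hfs F₂ hF₂, h3 F₂ F₂.continuous F₂.hasCompactSupport F₃ hF₃]
  refine h2 f hf hfs F₃ fun x => ?_
  have e1 : F₃ (Quot.proj (hNL.trans hLM) x) = F₃ (Quot.proj hLM (Quot.proj hNL x)) := by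
    obtain ⟨x, rfl⟩ := Quot.mk_surjective x
    rfl
  let g := H'.pullback ⟨⟨f, hf⟩, hfs⟩ x
  rw [e1, hF₃]
  refine (h1 g g.continuous g.hasCompactSupport _ fun y => ?_).symm
  have e2 : Quot.proj hNL x + Quot.incl hMR (Quot.proj hNL y) =
      Quot.proj hNL (x + Quot.incl hMR y) := by
    rw [map_add]
    obtain ⟨y, rfl⟩ := Quot.mk_surjective y
    rfl
  rw [e2, hF₂]
  refine integral_congr_ae (Filter.Eventually.of_forall fun z => ?_)
  change f (x + Quot.incl hMR y + Quot.incl (hLM.trans hMR) z) =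
    f (x + Quot.incl hMR (y + Quot.incl hLM z))
  rw [map_add, add_assoc]
  congr 3
  obtain ⟨z, rfl⟩ := Quot.mk_surjective z
  rfl

theorem exists_posReal_smul_eq {N L : OLattice O K n} (hNL : N ≤ L) (α β : Measure (N.Quot L))
    [α.IsAddHaarMeasure] [β.IsAddHaarMeasure] [α.Regular] [β.Regular] :
    ∃ t : PosReal, α = ENNReal.ofReal t • β := by
  have := IsLatticeTopology.isTopologicalAddGroup (O := O) (K := K)
  have := IsLatticeTopology.locallyCompactSpace n N L hNL
  refine ⟨⟨_, NNReal.coe_pos.2 (Measure.addHaarScalarFactor_pos_of_isAddHaarMeasure α β)⟩, ?_⟩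
  rw [ENNReal.ofReal_coe_nnreal]
  exact Measure.isAddLeftInvariant_eq_smul_of_regular _ _

theorem exists_integral_ne_zero_of_isAddHaarMeasure {N L : OLattice O K n} (hNL : N ≤ L)
    (α : Measure (N.Quot L)) [α.IsAddHaarMeasure] :
    ∃ f : N.Quot L → ℝ, Continuous f ∧ HasCompactSupport f ∧ ∫ x, f x ∂α ≠ 0 := by
  have := IsLatticeTopology.isTopologicalAddGroup (O := O) (K := K)
  have := IsLatticeTopology.locallyCompactSpace n N L hNL
  obtain ⟨f, hf1, hf2, -, hf4⟩ := exists_continuousMap_one_of_isCompact_subset_isOpen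
    (isCompact_singleton (x := (0 : N.Quot L))) isOpen_univ (Set.subset_univ _)
  refine ⟨f, f.continuous, hf2, ne_of_gt ?_⟩
  refine f.continuous.integral_pos_of_hasCompactSupport_nonneg_nonzero (x := 0) hf2
    (fun x => (hf4 x).1) ?_
  rw [hf1 rfl]
  exact one_ne_zero

variable (O K n) in
/-- There are coherent systems of Haar measures: arbitrary Haar measures on the groups `L / N` are
multiplicative up to a `2`-cocycle, and this cocycle is a coboundary. -/
theorem HaarSystem.nonempty [IsDomain O] [IsFractionRing O K] : Nonempty (HaarSystem O K n) := by
  have := IsLatticeTopology.isTopologicalAddGroup (O := O) (K := K)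
  have hex : ∀ N L : OLattice O K n, ∃ m : Measure (N.Quot L), N ≤ L →
      m.IsAddHaarMeasure ∧ m.Regular := by
    intro N L
    by_cases h : N ≤ L
    · have := IsLatticeTopology.locallyCompactSpace n N L h
      exact ⟨Measure.addHaar, fun _ => ⟨inferInstance, inferInstance⟩⟩
    · exact ⟨0, fun h' => absurd h' h⟩
  choose m hm hmr using hex
  have hexp : ∀ t : PosReal, ∃ u : ℝ, (⟨Real.exp u, Real.exp_pos u⟩ : PosReal) = t :=
    fun t => ⟨Real.log t, Subtype.ext (Real.exp_log t.2)⟩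
  let e : ℝ → PosReal := fun u => ⟨Real.exp u, Real.exp_pos u⟩
  have he : ∀ u v, e (u + v) = e u * e v := fun u v => Subtype.ext (Real.exp_add u v)
  have ht : ∀ N L M : OLattice O K n, ∃ u : ℝ, ∀ (hNL : N ≤ L) (hLM : L ≤ M),
      IsTensor hNL hLM (m N L) (m L M) (ENNReal.ofReal (e u) • m N M) := by
    intro N L M
    by_cases h : N ≤ L ∧ L ≤ M
    · have := hm N L h.1
      have := hm L M h.2
      have := hm N M (h.1.trans h.2)
      have := hmr N M (h.1.trans h.2)
      obtain ⟨γ, h1, h2, h3⟩ := exists_isTensor h.1 h.2 (m N L) (m L M)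
      obtain ⟨t, rfl⟩ := exists_posReal_smul_eq (h.1.trans h.2) γ (m N M)
      obtain ⟨u, rfl⟩ := hexp t
      exact ⟨u, fun _ _ => h3⟩
    · exact ⟨0, fun h1 h2 => absurd ⟨h1, h2⟩ h⟩
  choose t ht using ht
  obtain ⟨s, hs⟩ := exists_coboundary (fun a b : OLattice O K n => a.exists_le_le b) t (by
    intro N L M R hNL hLM hMR
    have := hm N L hNL
    have := hm L M hLM
    have := hm N R (hNL.trans (hLM.trans hMR))
    obtain ⟨f, hf, hfs, hf0⟩ :=
      exists_integral_ne_zero_of_isAddHaarMeasure (hNL.trans (hLM.trans hMR)) (m N R)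
    have one : ∀ {A B : OLattice O K n} (μ : Measure (A.Quot B)),
        ENNReal.ofReal ((1 : PosReal) : ℝ) • μ = μ := by
      intro A B μ
      change ENNReal.ofReal 1 • μ = μ
      rw [ENNReal.ofReal_one, one_smul]
    have h2 := (ht N M R (hNL.trans hLM) hMR).smul (e (t N L M)) 1
    have h4 := (ht N L R hNL (hLM.trans hMR)).smul 1 (e (t L M R))
    rw [one] at h2 h4
    have key := IsTensor.integral_eq hNL hLM hMR (ht N L M hNL hLM) h2 (ht L M R hLM hMR) h4 hf hfs
    rw [mul_one, one_mul, integral_posReal_smul, integral_posReal_smul, integral_posReal_smul,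
      integral_posReal_smul, ← mul_assoc, ← mul_assoc] at key
    have h5 := mul_right_cancel₀ hf0 key
    change Real.exp _ * Real.exp _ = Real.exp _ * Real.exp _ at h5
    rw [← Real.exp_add, ← Real.exp_add] at h5
    exact Real.exp_injective h5)
  refine ⟨⟨fun N L _ => ENNReal.ofReal (e (s N L)) • m N L, fun N L h => ?_, fun N L h => ?_,
    fun N L M hNL hLM => ?_⟩⟩
  · have := hm N L h
    exact Measure.IsAddHaarMeasure.smul _ (by simp [e, Real.exp_pos]) ENNReal.ofReal_ne_top
  · have := hmr N L h
    exact Measure.Regular.smul ENNReal.ofReal_ne_top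
  · have h1 := (ht N L M hNL hLM).smul (e (s N L)) (e (s L M))
    rw [smul_smul, ← ENNReal.ofReal_mul (e (s N L) * e (s L M) : PosReal).2.le] at h1
    rw [← hs N L M hNL hLM, he, he]
    exact h1

end Existence

/-! ### Stabilization of matrices -/

section StabilizeGL

variable (K : Type*) [Field K]

/-- An `n × n` matrix acts on `K^m`, for `n ≤ m`, by acting on the first `n` coordinates. -/
def extendEnd {n m : ℕ} (h : n ≤ m) : Matrix (Fin n) (Fin n) K →* Module.End K (Fin m → K) where
  toFun A :=
    { toFun := fun v i => if hi : (i : ℕ) < n then A.mulVec (fun j => v (Fin.castLE h j)) ⟨i, hi⟩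
        else v i
      map_add' := fun v w => by
        funext i
        by_cases hi : (i : ℕ) < n
        · simp only [hi, dif_pos, Pi.add_apply]
          exact congrFun (A.mulVec_add _ _) _
        · simp [hi]
      map_smul' := fun c v => by
        funext i
        by_cases hi : (i : ℕ) < n
        · simp only [hi, dif_pos, Pi.smul_apply, RingHom.id_apply]
          exact congrFun (A.mulVec_smul c _) _
        · simp [hi] }
  map_one' := by
    refine LinearMap.ext fun v => funext fun i => ?_
    by_cases hi : (i : ℕ) < n
    · simp [Fin.castLE]
    · simp
  map_mul' A B := by
    refine LinearMap.ext fun v => funext fun i => ?_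
    by_cases hi : (i : ℕ) < n
    · simp [hi, ← Matrix.mulVec_mulVec]
    · simp [hi]

variable {K}

theorem extendEnd_apply {n m : ℕ} (h : n ≤ m) (A : Matrix (Fin n) (Fin n) K) (v : Fin m → K)
    (i : Fin m) : extendEnd K h A v i = if hi : (i : ℕ) < n then
      A.mulVec (fun j => v (Fin.castLE h j)) ⟨i, hi⟩ else v i := rfl

variable (K) in
/-- The embedding `GL_n(K) → GL_m(K)` in the upper left corner, for `n ≤ m`. -/
noncomputable def stabGL {n m : ℕ} (h : n ≤ m) :
    Matrix.GeneralLinearGroup (Fin n) K →* Matrix.GeneralLinearGroup (Fin m) K :=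
  Units.map ((LinearMap.toMatrixAlgEquiv' (R := K) (n := Fin m)).toAlgHom.toMonoidHom.comp
    (extendEnd K h))

theorem stabGL_mulVec {n m : ℕ} (h : n ≤ m) (g : Matrix.GeneralLinearGroup (Fin n) K)
    (v : Fin m → K) : (stabGL K h g : Matrix (Fin m) (Fin m) K).mulVec v =
      extendEnd K h (g : Matrix (Fin n) (Fin n) K) v := by
  rw [← Matrix.toLin'_apply]
  have : Matrix.toLin' (stabGL K h g : Matrix (Fin m) (Fin m) K) =
      extendEnd K h (g : Matrix (Fin n) (Fin n) K) :=
    Matrix.toLin'_toMatrix' (extendEnd K h (g : Matrix (Fin n) (Fin n) K))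
  rw [this]

theorem GeneralLinearGroup.ext_mulVec {n : ℕ} {g g' : Matrix.GeneralLinearGroup (Fin n) K}
    (h : ∀ v, (g : Matrix (Fin n) (Fin n) K).mulVec v =
      (g' : Matrix (Fin n) (Fin n) K).mulVec v) : g = g' := by
  ext1
  ext i j
  have := congrFun (h (Pi.single j 1)) i
  simpa using this

theorem stabGL_refl {n : ℕ} (g : Matrix.GeneralLinearGroup (Fin n) K) :
    stabGL K le_rfl g = g := by
  refine GeneralLinearGroup.ext_mulVec fun v => funext fun i => ?_
  rw [stabGL_mulVec, extendEnd_apply, dif_pos i.2]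
  rfl

theorem stabGL_stabGL {n m l : ℕ} (h : n ≤ m) (h' : m ≤ l)
    (g : Matrix.GeneralLinearGroup (Fin n) K) :
    stabGL K h' (stabGL K h g) = stabGL K (h.trans h') g := by
  refine GeneralLinearGroup.ext_mulVec fun v => funext fun i => ?_
  rw [stabGL_mulVec, stabGL_mulVec, extendEnd_apply, extendEnd_apply]
  by_cases hi : (i : ℕ) < m
  · rw [dif_pos hi, stabGL_mulVec, extendEnd_apply]
    by_cases hi' : (i : ℕ) < n
    · rw [dif_pos hi', dif_pos hi']
      rfl
    · rw [dif_neg hi', dif_neg hi']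
      rfl
  · rw [dif_neg hi, dif_neg fun hi' => hi (hi'.trans_le h)]

theorem stabilize_apply (n : ℕ) (g : Matrix.GeneralLinearGroup (Fin n) K) (v : ℕ →₀ K) (k : ℕ) :
    (stabilize K n g : Module.End K (ℕ →₀ K)) v k = if hk : k < n then
      (g : Matrix (Fin n) (Fin n) K).mulVec (fun j => v j) ⟨k, hk⟩ else v k := by
  have e : ∀ w : Fin n → K, inclCoords K n w k = if hk : k < n then w ⟨k, hk⟩ else 0 := by
    intro w
    simp only [inclCoords, LinearMap.sum_apply, LinearMap.comp_apply, LinearMap.proj_apply,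
      Finsupp.lsingle_apply, Finsupp.finsetSum_apply, Finsupp.single_apply]
    split_ifs with hk
    · rw [Finset.sum_eq_single (⟨k, hk⟩ : Fin n)]
      · simp
      · intro b _ hb
        rw [if_neg]
        rintro rfl
        exact hb rfl
      · simp
    · refine Finset.sum_eq_zero fun b _ => if_neg ?_
      rintro rfl
      exact hk b.2
  have e2 : (stabilize K n g : Module.End K (ℕ →₀ K)) v =
      v + inclCoords K n (((g : Matrix (Fin n) (Fin n) K) - 1).mulVec (fun j => v j)) := rfl
  rw [e2, Finsupp.add_apply, e]
  split_ifs with hk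
  · simp [Matrix.sub_mulVec]
  · rw [add_zero]

theorem stabilize_stabGL {n m : ℕ} (h : n ≤ m) (g : Matrix.GeneralLinearGroup (Fin n) K) :
    stabilize K m (stabGL K h g) = stabilize K n g := by
  ext1
  refine LinearMap.ext fun v => Finsupp.ext fun k => ?_
  rw [stabilize_apply, stabilize_apply]
  by_cases hk : k < m
  · rw [dif_pos hk, stabGL_mulVec, extendEnd_apply]
    rfl
  · rw [dif_neg hk, dif_neg fun hi' => hk (hi'.trans_le h)]

theorem stabilize_injective (n : ℕ) : Function.Injective (stabilize K n) := by
  intro g g' h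
  refine GeneralLinearGroup.ext_mulVec fun v => funext fun i => ?_
  have h1 := congrArg (fun a : LinearMap.GeneralLinearGroup K (ℕ →₀ K) =>
    (a : Module.End K (ℕ →₀ K)) (inclCoords K n v) i) h
  have h2 : (fun j : Fin n => inclCoords K n v j) = v := firstCoords_inclCoords K n v
  simpa only [stabilize_apply, i.2, dif_pos, h2] using h1

variable (K) in
theorem elementary_mem_range_stabilize {n i j : ℕ} (hi : i < n) (hj : j < n) (hij : i ≠ j) (r : K) :
    ∃ g, stabilize K n g = elementary K i j hij r := by
  have hij' : (⟨i, hi⟩ : Fin n) ≠ ⟨j, hj⟩ := fun h => hij (congrArg Fin.val h)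
  refine ⟨Matrix.GeneralLinearGroup.mkOfDetNeZero (Matrix.transvection ⟨i, hi⟩ ⟨j, hj⟩ r)
    (by simp [Matrix.det_transvection_of_ne _ _ hij' r]), ?_⟩
  ext1
  refine LinearMap.ext fun v => Finsupp.ext fun k => ?_
  rw [stabilize_apply]
  simp only [elementary, LinearMap.add_apply, Module.End.one_apply, Finsupp.add_apply,
    matrixUnit_apply, Finsupp.single_apply]
  split_ifs with hk h h
  · subst h
    simp [Matrix.GeneralLinearGroup.mkOfDetNeZero, Matrix.transvection, Matrix.add_mulVec,
      Matrix.single_mulVec]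
  · have : (⟨k, hk⟩ : Fin n) ≠ ⟨i, hi⟩ := fun h' => h (congrArg Fin.val h').symm
    simp [Matrix.GeneralLinearGroup.mkOfDetNeZero, Matrix.transvection, Matrix.add_mulVec,
      Matrix.single_mulVec, this]
  · exact absurd (h ▸ hi) hk
  · rw [add_zero]

end StabilizeGL

/-! ### Stabilization of lattices and of Haar measures -/

section StabilizeHaar

open MeasureTheory OLattice

variable {O K : Type*} [CommRing O] [Field K] [Algebra O K] {n m l : ℕ}

theorem glMap_stabGL (h : n ≤ m) (g : Matrix.GeneralLinearGroup (Fin n) K) (v : Fin m → K) :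
    glMap O (stabGL K h g) v = extendEnd K h (g : Matrix (Fin n) (Fin n) K) v :=
  stabGL_mulVec h g v

variable (O K) in
/-- The projection `K^m → K^n` to the first `n` coordinates, for `n ≤ m`. -/
def truncCoords (h : n ≤ m) : (Fin m → K) →ₗ[O] (Fin n → K) :=
  LinearMap.funLeft O K (Fin.castLE h)

variable (O K) in
/-- The inclusion `K^n → K^m` as the first `n` coordinates, for `n ≤ m`. -/
def padCoords (n m : ℕ) : (Fin n → K) →ₗ[O] (Fin m → K) where
  toFun v i := if hi : (i : ℕ) < n then v ⟨i, hi⟩ else 0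
  map_add' v w := by
    funext i
    by_cases hi : (i : ℕ) < n <;> simp [hi]
  map_smul' c v := by
    funext i
    by_cases hi : (i : ℕ) < n <;> simp [hi]

theorem truncCoords_padCoords (h : n ≤ m) (v : Fin n → K) :
    truncCoords O K h (padCoords O K n m v) = v := by
  funext i
  simp [truncCoords, padCoords, LinearMap.funLeft]

theorem truncCoords_glMap (h : n ≤ m) (g : Matrix.GeneralLinearGroup (Fin n) K) (v : Fin m → K) :
    truncCoords O K h (glMap O (stabGL K h g) v) = glMap O g (truncCoords O K h v) := by
  funext i
  rw [glMap_stabGL]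
  exact dif_pos i.2

/-- For a submodule `S` of `K^n` the submodule `S ⊕ O^{m-n}` of `K^m`. -/
def extendSubmodule (h : n ≤ m) (S : Submodule O (Fin n → K)) : Submodule O (Fin m → K) :=
  S.comap (truncCoords O K h) ⊓
    Submodule.pi {i | n ≤ (i : ℕ)} fun _ => LinearMap.range (Algebra.linearMap O K)

theorem mem_extendSubmodule (h : n ≤ m) {S : Submodule O (Fin n → K)} {v : Fin m → K} :
    v ∈ extendSubmodule h S ↔ truncCoords O K h v ∈ S ∧
      ∀ i : Fin m, n ≤ (i : ℕ) → v i ∈ LinearMap.range (Algebra.linearMap O K) := Iff.rfl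

theorem mem_map_glMap {S : Submodule O (Fin n → K)} {g : Matrix.GeneralLinearGroup (Fin n) K}
    {v : Fin n → K} : v ∈ S.map (glMap O g) ↔ glMap O g⁻¹ v ∈ S := by
  constructor
  · rintro ⟨w, hw, rfl⟩
    rwa [← LinearMap.comp_apply, ← glMap_mul, inv_mul_cancel, glMap_one]
  · intro hv
    exact ⟨_, hv, by rw [← LinearMap.comp_apply, ← glMap_mul, mul_inv_cancel, glMap_one]; rfl⟩

theorem extendSubmodule_map (h : n ≤ m) (S : Submodule O (Fin n → K))
    (g : Matrix.GeneralLinearGroup (Fin n) K) :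
    extendSubmodule h (S.map (glMap O g)) = (extendSubmodule h S).map (glMap O (stabGL K h g)) := by
  ext v
  rw [mem_map_glMap, mem_extendSubmodule, mem_extendSubmodule, mem_map_glMap, ← map_inv,
    truncCoords_glMap]
  refine and_congr Iff.rfl (forall₂_congr fun i hi => ?_)
  rw [glMap_stabGL, extendEnd_apply, dif_neg (not_lt.2 hi)]

theorem extendSubmodule_standardLattice (h : n ≤ m) :
    extendSubmodule h (standardLattice O K n) = standardLattice O K m := by
  ext v
  rw [mem_extendSubmodule]
  constructor
  · rintro ⟨h1, h2⟩ i -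
    by_cases hi : (i : ℕ) < n
    · exact h1 ⟨i, hi⟩ trivial
    · exact h2 i (not_lt.1 hi)
  · intro h1
    exact ⟨fun i _ => h1 _ trivial, fun i _ => h1 i trivial⟩

namespace OLattice

/-- For a lattice `L` in `K^n` the lattice `L ⊕ O^{m-n}` in `K^m`. -/
noncomputable def extend (h : n ≤ m) (L : OLattice O K n) : OLattice O K m :=
  ⟨extendSubmodule h L.1, by
    obtain ⟨g, hg⟩ := L.2
    exact ⟨stabGL K h g, by rw [hg, extendSubmodule_map, extendSubmodule_standardLattice]⟩⟩

theorem extend_std (h : n ≤ m) : extend h (std O K n) = std O K m :=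
  OLattice.ext (extendSubmodule_standardLattice h)

theorem extend_smul (h : n ≤ m) (g : Matrix.GeneralLinearGroup (Fin n) K) (L : OLattice O K n) :
    extend h (g • L) = stabGL K h g • extend h L :=
  OLattice.ext (extendSubmodule_map h L.1 g)

theorem extend_mono (h : n ≤ m) {N L : OLattice O K n} (hNL : N ≤ L) : extend h N ≤ extend h L :=
  fun _ hv => ⟨hNL hv.1, hv.2⟩

theorem extend_refl (L : OLattice O K n) : extend le_rfl L = L := by
  refine OLattice.ext (Submodule.ext fun v => ?_)
  exact ⟨fun hv => hv.1, fun hv => ⟨hv, fun i hi => absurd i.2 (not_lt.2 hi)⟩⟩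

theorem extend_extend (h : n ≤ m) (h' : m ≤ l) (L : OLattice O K n) :
    extend h' (extend h L) = extend (h.trans h') L := by
  refine OLattice.ext (Submodule.ext fun v => ?_)
  constructor
  · rintro ⟨⟨h1, h2⟩, h3⟩
    refine ⟨h1, fun i hi => ?_⟩
    by_cases hm : (i : ℕ) < m
    · exact h2 ⟨i, hm⟩ hi
    · exact h3 i (not_lt.1 hm)
  · rintro ⟨h1, h2⟩
    exact ⟨⟨h1, fun i hi => h2 _ hi⟩, fun i hi => h2 i (h.trans hi)⟩

namespace Quot

/-- The map `L / N → L' / N'` induced by a linear map `f : K^m → K^n` with `f(N) ⊆ N'` and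
`f(L) ⊆ L'`. -/
def mapTo {N L : OLattice O K m} {N' L' : OLattice O K n} (f : (Fin m → K) →ₗ[O] (Fin n → K))
    (hN : N.1 ≤ N'.1.comap f) (hL : L.1 ≤ L'.1.comap f) : N.Quot L →ₗ[O] N'.Quot L' :=
  Submodule.mapQ _ _ (f.restrict hL) fun x hx => hN (show (x : Fin m → K) ∈ N.1 from hx)

variable {N L : OLattice O K m} {N' L' : OLattice O K n}

theorem mapTo_mk (f : (Fin m → K) →ₗ[O] (Fin n → K)) (hN : N.1 ≤ N'.1.comap f)
    (hL : L.1 ≤ L'.1.comap f) (v : L.1) : mapTo f hN hL (mk N v) = mk N' ⟨f v, hL v.2⟩ := rfl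

theorem continuous_mapTo [TopologicalSpace K] {f : (Fin m → K) →ₗ[O] (Fin n → K)}
    (hf : Continuous f) (hN : N.1 ≤ N'.1.comap f) (hL : L.1 ≤ L'.1.comap f) :
    Continuous (mapTo f hN hL) := by
  refine Continuous.quotient_lift ?_ _
  refine continuous_quotient_mk'.comp ?_
  exact (hf.comp continuous_subtype_val).subtype_mk _

theorem continuous_truncCoords [TopologicalSpace K] (h : n ≤ m) :
    Continuous (truncCoords O K h) :=
  continuous_pi fun i => continuous_apply (Fin.castLE h i)

theorem continuous_padCoords [TopologicalSpace K] (n m : ℕ) :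
    Continuous (padCoords O K n m) := by
  refine continuous_pi fun i => ?_
  by_cases hi : (i : ℕ) < n
  · simpa [padCoords, hi] using continuous_apply (⟨i, hi⟩ : Fin n)
  · simpa [padCoords, hi] using continuous_const

theorem le_comap_truncCoords (h : n ≤ m) (L : OLattice O K n) :
    (extend h L).1 ≤ L.1.comap (truncCoords O K h) := fun _ hv => hv.1

theorem le_comap_padCoords (h : n ≤ m) (L : OLattice O K n) :
    L.1 ≤ (extend h L).1.comap (padCoords O K n m) := by
  intro v hv
  refine ⟨?_, fun i hi => ?_⟩
  · change truncCoords O K h _ ∈ L.1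
    rwa [truncCoords_padCoords]
  · have : padCoords O K n m v i = 0 := dif_neg (not_lt.2 hi)
    rw [this]
    exact zero_mem _

/-- The isomorphism `(L ⊕ O^{m-n}) / (N ⊕ O^{m-n}) → L / N` of topological groups. -/
noncomputable def truncate [TopologicalSpace K] (h : n ≤ m) (N L : OLattice O K n) :
    (extend h N).Quot (extend h L) ≃ₜ+ N.Quot L where
  toFun := mapTo (truncCoords O K h) (le_comap_truncCoords h N) (le_comap_truncCoords h L)
  invFun := mapTo (padCoords O K n m) (le_comap_padCoords h N) (le_comap_padCoords h L)
  left_inv x := by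
    obtain ⟨v, rfl⟩ := mk_surjective x
    rw [mapTo_mk, mapTo_mk, mk_eq_mk_iff]
    refine ⟨?_, fun i hi => ?_⟩
    · change truncCoords O K h (padCoords O K n m (truncCoords O K h v) - v) ∈ N.1
      rw [map_sub, truncCoords_padCoords, sub_self]
      exact zero_mem _
    · have : padCoords O K n m (truncCoords O K h v) i = 0 := dif_neg (not_lt.2 hi)
      change padCoords O K n m (truncCoords O K h v) i - v.1 i ∈ _
      rw [this, zero_sub]
      exact neg_mem (v.2.2 i hi)
  right_inv x := by
    obtain ⟨v, rfl⟩ := mk_surjective x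
    rw [mapTo_mk, mapTo_mk, mk_eq_mk_iff]
    change truncCoords O K h (padCoords O K n m v) - v ∈ N.1
    rw [truncCoords_padCoords, sub_self]
    exact zero_mem _
  map_add' := map_add _
  continuous_toFun := continuous_mapTo (continuous_truncCoords h) _ _
  continuous_invFun := continuous_mapTo (continuous_padCoords n m) _ _

end Quot

end OLattice

variable [TopologicalSpace K]

/-- A transport lemma: equal lattices and equal linear maps yield equal images of measures. -/
theorem HaarSystem.meas_mapTo_congr (H : HaarSystem O K m) {N L : OLattice O K n}
    {N₁ L₁ N₂ L₂ : OLattice O K m}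
    (hN : N₁ = N₂) (hL : L₁ = L₂) (h₁ : N₁ ≤ L₁) (h₂ : N₂ ≤ L₂)
    (f₁ f₂ : (Fin m → K) →ₗ[O] (Fin n → K)) (hf : f₁ = f₂)
    (a₁ : N₁.1 ≤ N.1.comap f₁) (b₁ : L₁.1 ≤ L.1.comap f₁)
    (a₂ : N₂.1 ≤ N.1.comap f₂) (b₂ : L₂.1 ≤ L.1.comap f₂) :
    (H.meas N₁ L₁ h₁).map (OLattice.Quot.mapTo f₁ a₁ b₁) =
      (H.meas N₂ L₂ h₂).map (OLattice.Quot.mapTo f₂ a₂ b₂) := by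
  subst hN hL hf
  rfl

theorem measurable_truncate (h : n ≤ m) (N L : OLattice O K n) :
    Measurable (OLattice.Quot.truncate h N L) :=
  (OLattice.Quot.truncate h N L).continuous_toFun.measurable

variable [IsLatticeTopology O K]

/-- A coherent choice of Haar measures for the lattices in `K^m` induces one for the lattices in
`K^n`, for `n ≤ m`. -/
noncomputable def HaarSystem.restrict (h : n ≤ m) (H : HaarSystem O K m) : HaarSystem O K n where
  meas N L hNL := (H.meas (extend h N) (extend h L) (extend_mono h hNL)).map
    (OLattice.Quot.truncate h N L)
  isAddHaar N L hNL := by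
    have := IsLatticeTopology.isTopologicalAddGroup (O := O) (K := K)
    have := H.isAddHaar _ _ (extend_mono h hNL)
    exact (OLattice.Quot.truncate h N L).isAddHaarMeasure_map _
  regular N L hNL := by
    have := H.regular _ _ (extend_mono h hNL)
    exact Measure.Regular.map (OLattice.Quot.truncate h N L).toHomeomorph
  isTensor N L M hNL hLM := by
    intro f hf hfs F hF
    have e1 : ∫ x, f x ∂(H.meas _ _ (extend_mono h (hNL.trans hLM))).map
        (OLattice.Quot.truncate h N M) = ∫ x, f (OLattice.Quot.truncate h N M x)
          ∂(H.meas _ _ (extend_mono h (hNL.trans hLM))) :=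
      integral_map_equiv (OLattice.Quot.truncate h N M).toHomeomorph.toMeasurableEquiv f
    have e2 : ∫ x, F x ∂(H.meas _ _ (extend_mono h hLM)).map
        (OLattice.Quot.truncate h L M) = ∫ x, F (OLattice.Quot.truncate h L M x)
          ∂(H.meas _ _ (extend_mono h hLM)) :=
      integral_map_equiv (OLattice.Quot.truncate h L M).toHomeomorph.toMeasurableEquiv F
    rw [e1, e2]
    refine H.isTensor _ _ _ (extend_mono h hNL) (extend_mono h hLM)
      _ (hf.comp (OLattice.Quot.truncate h N M).continuous_toFun)
      (hfs.comp_homeomorph (OLattice.Quot.truncate h N M).toHomeomorph) _ fun x => ?_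
    have e3 : OLattice.Quot.truncate h L M
        (OLattice.Quot.proj (extend_mono h hNL) x) =
          OLattice.Quot.proj hNL (OLattice.Quot.truncate h N M x) := by
      obtain ⟨x, rfl⟩ := OLattice.Quot.mk_surjective x
      rfl
    have e4 : ∫ y, f (OLattice.Quot.truncate h N M x + OLattice.Quot.incl hLM y)
        ∂(H.meas _ _ (extend_mono h hNL)).map (OLattice.Quot.truncate h N L) =
        ∫ y, f (OLattice.Quot.truncate h N M x +
          OLattice.Quot.incl hLM (OLattice.Quot.truncate h N L y))
          ∂(H.meas _ _ (extend_mono h hNL)) :=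
      integral_map_equiv (OLattice.Quot.truncate h N L).toHomeomorph.toMeasurableEquiv
        (fun y => f (OLattice.Quot.truncate h N M x + OLattice.Quot.incl hLM y))
    rw [e3, hF, e4]
    refine integral_congr_ae (Filter.Eventually.of_forall fun y => ?_)
    change _ = f (OLattice.Quot.truncate h N M (x + OLattice.Quot.incl (extend_mono h hLM) y))
    rw [map_add]
    obtain ⟨y, rfl⟩ := OLattice.Quot.mk_surjective y
    rfl

theorem measurable_smulInv (g : Matrix.GeneralLinearGroup (Fin n) K) (N L : OLattice O K n) :
    Measurable (OLattice.Quot.smulInv g N L) :=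
  (OLattice.Quot.smulInv g N L).continuous_toFun.measurable

/-- The restriction of Haar systems is compatible with the stabilization of matrices. -/
theorem HaarSystem.restrict_pull (h : n ≤ m) (g : Matrix.GeneralLinearGroup (Fin n) K)
    (H : HaarSystem O K m) : (H.pull (stabGL K h g)).restrict h = (H.restrict h).pull g := by
  refine HaarSystem.ext' fun N L hNL => ?_
  have e := H.meas_mapTo_congr (N := N) (L := L) (extend_smul h g N).symm (extend_smul h g L).symm
    (OLattice.smul_mono _ (extend_mono h hNL)) (extend_mono h (OLattice.smul_mono g hNL))
    (truncCoords O K h ∘ₗ glMap O (stabGL K h g)⁻¹) (glMap O g⁻¹ ∘ₗ truncCoords O K h)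
    (LinearMap.ext fun v => by
      rw [LinearMap.comp_apply, ← map_inv, truncCoords_glMap, LinearMap.comp_apply])
    (fun _ hy => ((extend h N).smul_le_comap _ hy).1)
    (fun _ hy => ((extend h L).smul_le_comap _ hy).1)
    (fun _ hy => N.smul_le_comap g hy.1)
    (fun _ hy => L.smul_le_comap g hy.1)
  change Measure.map (OLattice.Quot.truncate h N L) (Measure.map (OLattice.Quot.smulInv
      (stabGL K h g) (extend h N) (extend h L)) _) = Measure.map (OLattice.Quot.smulInv g N L)
    (Measure.map (OLattice.Quot.truncate h (g • N) (g • L)) _)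
  rw [Measure.map_map (measurable_truncate h N L) (measurable_smulInv _ _ _),
    Measure.map_map (measurable_smulInv _ _ _) (measurable_truncate h _ _)]
  convert e using 2
  · funext x
    obtain ⟨x, rfl⟩ := OLattice.Quot.mk_surjective x
    rfl
  · funext x
    obtain ⟨x, rfl⟩ := OLattice.Quot.mk_surjective x
    rfl

theorem HaarSystem.restrict_refl (H : HaarSystem O K n) : H.restrict le_rfl = H := by
  refine HaarSystem.ext' fun N L hNL => ?_
  have e := H.meas_mapTo_congr (N := N) (L := L) (extend_refl N) (extend_refl L)
    (extend_mono le_rfl hNL) hNL (truncCoords O K le_rfl) LinearMap.id rfl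
    (OLattice.Quot.le_comap_truncCoords le_rfl N) (OLattice.Quot.le_comap_truncCoords le_rfl L)
    (fun _ hy => hy) (fun _ hy => hy)
  refine e.trans ?_
  have e2 : (OLattice.Quot.mapTo LinearMap.id (fun _ hy => hy) (fun _ hy => hy) :
      N.Quot L →ₗ[O] N.Quot L) = (id : N.Quot L → N.Quot L) := funext fun x => by
    obtain ⟨x, rfl⟩ := OLattice.Quot.mk_surjective x
    rfl
  rw [e2, Measure.map_id]

theorem HaarSystem.restrict_restrict (h : n ≤ m) (h' : m ≤ l) (H : HaarSystem O K l) :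
    (H.restrict h').restrict h = H.restrict (h.trans h') := by
  refine HaarSystem.ext' fun N L hNL => ?_
  have e := H.meas_mapTo_congr (N := N) (L := L) (extend_extend h h' N) (extend_extend h h' L)
    (extend_mono h' (extend_mono h hNL)) (extend_mono (h.trans h') hNL)
    (truncCoords O K h ∘ₗ truncCoords O K h') (truncCoords O K (h.trans h')) rfl
    (fun _ hy => hy.1.1) (fun _ hy => hy.1.1)
    (OLattice.Quot.le_comap_truncCoords _ N) (OLattice.Quot.le_comap_truncCoords _ L)
  refine Eq.trans ?_ e
  change Measure.map (OLattice.Quot.truncate h N L)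
    (Measure.map (OLattice.Quot.truncate h' (extend h N) (extend h L)) _) = _
  rw [Measure.map_map (measurable_truncate _ _ _) (measurable_truncate _ _ _)]
  congr 1
  funext x
  obtain ⟨x, rfl⟩ := OLattice.Quot.mk_surjective x
  rfl

theorem Rescaled.restrict (h : n ≤ m) {c : OLattice O K m → PosReal} {H H' : HaarSystem O K m}
    (hc : Rescaled c H H') : Rescaled (fun L => c (extend h L)) (H.restrict h) (H'.restrict h) := by
  intro N L hNL
  change Measure.map _ _ = _ • Measure.map _ _
  rw [hc _ _ (extend_mono h hNL), Measure.map_smul]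

namespace HaarGL

variable (O K) in
/-- The stabilization `(g, μ) ↦ (g ⊕ 1, μ)`. -/
noncomputable def stab (h : n ≤ m) : HaarGL O K n →* HaarGL O K m :=
  MonoidHom.mk' (fun x => ⟨stabGL K h x.g, fun H => x.r (H.restrict h), by
    intro H H' c hc
    have := x.isRelMeasure _ _ _ (hc.restrict h)
    rwa [extend_smul, extend_std] at this⟩)
  fun x y => HaarGL.ext (map_mul _ _ _) (funext fun H => by
    change x.r (H.restrict h) * y.r ((H.restrict h).pull x.g) =
      x.r (H.restrict h) * y.r ((H.pull (stabGL K h x.g)).restrict h)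
    rw [HaarSystem.restrict_pull])

theorem stab_refl (x : HaarGL O K n) : stab O K le_rfl x = x :=
  HaarGL.ext (stabGL_refl x.g) (funext fun H => congrArg x.r H.restrict_refl)

theorem stab_stab (h : n ≤ m) (h' : m ≤ l) (x : HaarGL O K n) :
    stab O K h' (stab O K h x) = stab O K (h.trans h') x :=
  HaarGL.ext (stabGL_stabGL h h' x.g) (funext fun H => congrArg x.r (H.restrict_restrict h h'))

theorem stab_ofPosReal (h : n ≤ m) (t : PosReal) :
    stab O K h (ofPosReal O K n t) = ofPosReal O K m t :=
  HaarGL.ext (map_one _) rfl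

end HaarGL

end StabilizeHaar

/-! ### The stable group of pairs `(g, μ)` -/

section StableHaar

variable (O K : Type*) [CommRing O] [Field K] [Algebra O K]
  [TopologicalSpace K] [IsLatticeTopology O K]

instance HaarGL.directedSystem :
    DirectedSystem (fun n => HaarGL O K n) (fun _ _ h => HaarGL.stab O K h) where
  map_self _ x := HaarGL.stab_refl x
  map_map _ _ _ h h' x := HaarGL.stab_stab h h' x

/-- The direct limit of the groups of pairs `(g, μ)` with `g ∈ GL_n(K)`. -/
abbrev HaarGLInf : Type _ :=
  DirectLimit (fun n => HaarGL O K n) (fun _ _ h => HaarGL.stab O K h)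

namespace HaarGLInf

/-- The map from the group for `n` to the direct limit. -/
noncomputable def of (n : ℕ) : HaarGL O K n →* HaarGLInf O K where
  toFun x := (⟦⟨n, x⟩⟧ : HaarGLInf O K)
  map_one' := (DirectLimit.one_def (f := fun _ _ h => HaarGL.stab O K h) n).symm
  map_mul' x y := (DirectLimit.mul_def (f := fun _ _ h => HaarGL.stab O K h) n x y).symm

variable {O K}

theorem exists_of (e : HaarGLInf O K) : ∃ n x, e = of O K n x := by
  induction e using DirectLimit.induction with
  | _ n x => exact ⟨n, x, rfl⟩

theorem of_stab {n m : ℕ} (h : n ≤ m) (x : HaarGL O K n) :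
    of O K m (HaarGL.stab O K h x) = of O K n x :=
  (DirectLimit.eq_of_le (f := fun _ _ h => HaarGL.stab O K h)
    (⟨n, x⟩ : Σ i, HaarGL O K i) m h).symm

theorem of_ofPosReal (n m : ℕ) (t : PosReal) :
    of O K n (HaarGL.ofPosReal O K n t) = of O K m (HaarGL.ofPosReal O K m t) := by
  rcases le_total n m with h | h
  · rw [← of_stab h, HaarGL.stab_ofPosReal]
  · rw [← of_stab h, HaarGL.stab_ofPosReal]

variable (O K) in
/-- The central subgroup `ℝ_{>0}` of the direct limit. -/
noncomputable def ofPosReal : PosReal →* HaarGLInf O K :=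
  (of O K 0).comp (HaarGL.ofPosReal O K 0)

theorem ofPosReal_eq (n : ℕ) (t : PosReal) :
    ofPosReal O K t = of O K n (HaarGL.ofPosReal O K n t) := of_ofPosReal 0 n t

variable (O K) in
/-- The projection `(g, μ) ↦ g` from the direct limit to `GL(K) ⊂ Aut(K^∞)`. -/
noncomputable def toGL : HaarGLInf O K →* LinearMap.GeneralLinearGroup K (ℕ →₀ K) where
  toFun := DirectLimit.lift _ (fun n x => stabilize K n x.g)
    fun _ _ h x => (stabilize_stabGL h x.g).symm
  map_one' := map_one (stabilize K _)
  map_mul' x y := by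
    induction x, y using DirectLimit.induction₂ with
    | _ n x y =>
      rw [DirectLimit.mul_def]
      exact map_mul (stabilize K n) x.g y.g

theorem toGL_of (n : ℕ) (x : HaarGL O K n) : toGL O K (of O K n x) = stabilize K n x.g := rfl

end HaarGLInf

variable [IsDomain O] [IsFractionRing O K]

variable {O K}

/-- Over the identity matrix the measure does not depend on the Haar system, since any two systems
differ by a rescaling, which acts on the measures of `O^n / O^n` trivially. -/
theorem HaarGL.exists_eq_ofPosReal {n : ℕ} {x : HaarGL O K n} (hx : x.g = 1) :
    ∃ t, x = HaarGL.ofPosReal O K n t := by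
  obtain ⟨H₀⟩ := HaarSystem.nonempty O K n
  refine ⟨x.r H₀, HaarGL.ext hx (funext fun H => ?_)⟩
  obtain ⟨c, hc⟩ := H₀.exists_rescaled H
  have := x.isRelMeasure H₀ H c hc
  rw [hx, one_smul] at this
  exact mul_right_cancel this

theorem HaarGL.ofPosReal_injective (n : ℕ) : Function.Injective (HaarGL.ofPosReal O K n) := by
  intro s t h
  obtain ⟨H⟩ := HaarSystem.nonempty O K n
  exact congrFun (congrArg HaarGL.r h) H

namespace HaarGLInf

theorem exists_eq_ofPosReal {e : HaarGLInf O K} (he : toGL O K e = 1) :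
    ∃ t, e = ofPosReal O K t := by
  obtain ⟨n, x, rfl⟩ := exists_of e
  obtain ⟨t, rfl⟩ := HaarGL.exists_eq_ofPosReal (x := x)
    (stabilize_injective n (he.trans (map_one _).symm))
  exact ⟨t, of_ofPosReal n 0 t⟩

theorem ofPosReal_injective : Function.Injective (ofPosReal O K) := by
  intro s t h
  obtain ⟨k, h₁, h₂, e⟩ := Quotient.exact h
  change HaarGL.stab O K h₁ (HaarGL.ofPosReal O K 0 s) =
    HaarGL.stab O K h₂ (HaarGL.ofPosReal O K 0 t) at e
  rw [HaarGL.stab_ofPosReal, HaarGL.stab_ofPosReal] at e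
  exact HaarGL.ofPosReal_injective k e

theorem ofPosReal_comm (t : PosReal) (e : HaarGLInf O K) :
    e * ofPosReal O K t = ofPosReal O K t * e := by
  obtain ⟨n, x, rfl⟩ := exists_of e
  rw [ofPosReal_eq n, ← map_mul, ← map_mul]
  refine congrArg (of O K n) (Subgroup.mem_center_iff.1 (HaarGL.ker_toGL_le_center ?_) x)
  exact map_one (HaarGL.toGL O K n)

theorem ker_toGL_le_center : (toGL O K).ker ≤ Subgroup.center (HaarGLInf O K) := by
  intro e he
  obtain ⟨t, rfl⟩ := exists_eq_ofPosReal he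
  exact Subgroup.mem_center_iff.2 (ofPosReal_comm t)

theorem exists_toGL_eq_stabilize (n : ℕ) (g : Matrix.GeneralLinearGroup (Fin n) K) :
    ∃ x : HaarGL O K n, x.g = g ∧ toGL O K (of O K n x) = stabilize K n g := by
  obtain ⟨x, rfl⟩ := HaarGL.toGL_surjective (O := O) g
  exact ⟨x, rfl, rfl⟩

theorem exists_toGL_eq_toAut (s : SteinbergGroup K) :
    ∃ e : HaarGLInf O K, toGL O K e = SteinbergGroup.toAut K s := by
  suffices h : (⊤ : Subgroup (SteinbergGroup K)) ≤
      (toGL O K).range.comap (SteinbergGroup.toAut K) from h (Subgroup.mem_top s)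
  rw [← SteinbergGroup.closure_x_eq_top, Subgroup.closure_le]
  rintro _ ⟨i, j, hij, r, rfl⟩
  obtain ⟨g, hg⟩ := elementary_mem_range_stabilize K (lt_max_of_lt_left i.lt_succ_self)
    (lt_max_of_lt_right j.lt_succ_self) hij r
  obtain ⟨x, -, hx⟩ := exists_toGL_eq_stabilize (O := O) _ g
  refine ⟨_, hx.trans (hg.trans ?_)⟩
  rw [SteinbergGroup.toAut, SteinbergGroup.lift_x]

/-- An element of the kernel lies over the identity matrix, hence is a positive real number, and
these embed into the direct limit. -/
theorem of_injective (n : ℕ) : Function.Injective (of O K n) := by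
  refine (injective_iff_map_eq_one _).2 fun x hx => ?_
  have h1 : x.g = 1 := stabilize_injective n (by
    rw [← toGL_of, hx, map_one, map_one])
  obtain ⟨t, rfl⟩ := HaarGL.exists_eq_ofPosReal h1
  rw [← ofPosReal_eq] at hx
  rw [ofPosReal_injective (hx.trans (map_one _).symm), map_one]

end HaarGLInf

/-! ### The homomorphism `K_2(K) → ℝ_{>0}` -/

variable (O K) in
/-- A homomorphism from the Steinberg group to the direct limit of the groups of pairs `(g, μ)`,
over `Aut(K^∞)`. -/
noncomputable def steinbergLift : SteinbergGroup K →* HaarGLInf O K :=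
  (SteinbergGroup.exists_lift HaarGLInf.ker_toGL_le_center
    (HaarGLInf.exists_toGL_eq_toAut (O := O) (K := K))).choose

theorem toGL_steinbergLift (s : SteinbergGroup K) :
    HaarGLInf.toGL O K (steinbergLift O K s) = SteinbergGroup.toAut K s :=
  DFunLike.congr_fun (SteinbergGroup.exists_lift HaarGLInf.ker_toGL_le_center
    (HaarGLInf.exists_toGL_eq_toAut (O := O) (K := K))).choose_spec s

theorem exists_steinbergLift_eq (k : K2 K) :
    ∃ t, steinbergLift O K k.1 = HaarGLInf.ofPosReal O K t :=
  HaarGLInf.exists_eq_ofPosReal ((toGL_steinbergLift k.1).trans k.2)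

variable (O K) in
/-- The homomorphism `K_2(K) → ℝ_{>0}` which the lift `steinbergLift` induces on the kernels of
`St(K) → SL(K)` and of `(g, μ) ↦ g`. -/
noncomputable def haarSymbol : K2 K →* PosReal :=
  MonoidHom.mk' (fun k => (exists_steinbergLift_eq (O := O) k).choose) fun k l =>
    HaarGLInf.ofPosReal_injective (O := O) (K := K) (by
      rw [map_mul, ← (exists_steinbergLift_eq (O := O) (k * l)).choose_spec,
        ← (exists_steinbergLift_eq (O := O) k).choose_spec,
        ← (exists_steinbergLift_eq (O := O) l).choose_spec, ← map_mul]
      rfl)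

theorem ofPosReal_haarSymbol (k : K2 K) :
    HaarGLInf.ofPosReal O K (haarSymbol O K k) = steinbergLift O K k.1 :=
  (exists_steinbergLift_eq (O := O) k).choose_spec.symm

end StableHaar

/-! ### Haar measure and multiplication on the residue field -/

section Modulus

open MeasureTheory

open scoped Pointwise in
theorem AddSubgroup.relIndex_mul_measure {G : Type*} [AddGroup G] [MeasurableSpace G]
    [MeasurableConstVAdd G G] {A B : AddSubgroup G} (hAB : A ≤ B) (h0 : A.relIndex B ≠ 0)
    (hA : MeasurableSet (A : Set G)) (μ : Measure G) [μ.IsAddLeftInvariant] :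
    A.relIndex B * μ A = μ B := by
  have : (A.addSubgroupOf B).FiniteIndex := ⟨h0⟩
  obtain ⟨s, hs, -⟩ := (A.addSubgroupOf B).exists_isComplement_left 0
  have hs' : Finite s := hs.finite_left_iff.mpr inferInstance
  have hU : (B : Set G) = ⋃ a : s, (((a : B) : G) +ᵥ (A : Set G)) := by
    ext x
    simp only [Set.mem_iUnion]
    constructor
    · intro hx
      obtain ⟨⟨a, c⟩, hac⟩ := hs.2 ⟨x, hx⟩
      refine ⟨a, c.1.1, c.2, ?_⟩
      exact congrArg Subtype.val hac
    · rintro ⟨a, y, hy, rfl⟩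
      exact B.add_mem a.1.2 (hAB hy)
  have hd : Pairwise (Function.onFun Disjoint fun a : s => (((a : B) : G) +ᵥ (A : Set G))) := by
    intro a b hab
    refine Set.disjoint_left.2 ?_
    rintro _ ⟨y, hy, rfl⟩ ⟨z, hz, hzy⟩
    refine hab (congrArg Prod.fst (@hs.1 (a, ⟨⟨y, hAB hy⟩, hy⟩) (b, ⟨⟨z, hAB hz⟩, hz⟩) ?_))
    exact Subtype.ext hzy.symm
  rw [hU, measure_iUnion hd fun _ => hA.const_vadd _]
  simp only [measure_vadd, ENNReal.tsum_const]
  congr 1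
  have e : ENat.card s = ((A.addSubgroupOf B).index : ℕ∞) := hs.encard_left
  rw [AddSubgroup.relIndex, e]
  rfl

theorem relIndex_pow_maximalIdeal (R : Type*) [CommRing R] [IsDomain R]
    [IsDiscreteValuationRing R] [Finite (IsLocalRing.ResidueField R)] (i j : ℕ) :
    (IsLocalRing.maximalIdeal R ^ (i + j) : Ideal R).toAddSubgroup.relIndex
      (IsLocalRing.maximalIdeal R ^ j : Ideal R).toAddSubgroup =
        Nat.card (IsLocalRing.ResidueField R) ^ i := by
  have hidx : ∀ k : ℕ, (IsLocalRing.maximalIdeal R ^ k : Ideal R).toAddSubgroup.index =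
      Nat.card (IsLocalRing.ResidueField R) ^ k := fun k =>
    cardQuot_pow_of_prime (IsDiscreteValuationRing.not_a_field R)
  have hle : (IsLocalRing.maximalIdeal R ^ (i + j) : Ideal R).toAddSubgroup ≤
      (IsLocalRing.maximalIdeal R ^ j : Ideal R).toAddSubgroup :=
    Ideal.pow_le_pow_right (Nat.le_add_left j i)
  have h := AddSubgroup.relIndex_mul_index hle
  rw [hidx, hidx, pow_add (Nat.card _)] at h
  exact Nat.eq_of_mul_eq_mul_right (pow_pos Nat.card_pos j) h

variable {O O₁ K : Type*} [CommRing O] [IsDomain O] [IsDiscreteValuationRing O]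
  [Field K] [Algebra O K]
  [CommRing O₁] [IsDomain O₁] [IsDiscreteValuationRing O₁]
  [Algebra O₁ (IsLocalRing.ResidueField O)]

/-- For a homomorphism `β` from `O` to a group the image under `β` of the elements of `O` whose
residue class lies in the `j`-th power of the maximal ideal of `O₁`. -/
noncomputable def residueBall (O₁ : Type*) [CommRing O₁] [IsLocalRing O₁]
    [Algebra O₁ (IsLocalRing.ResidueField O)] {Q : Type*} [AddCommGroup Q] (β : O →+ Q) (j : ℕ) :
    AddSubgroup Q :=
  (((IsLocalRing.maximalIdeal O₁ ^ j : Ideal O₁).toAddSubgroup.map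
    (algebraMap O₁ (IsLocalRing.ResidueField O)).toAddMonoidHom).comap
      (IsLocalRing.residue O).toAddMonoidHom).map β

variable {Q : Type*} [AddCommGroup Q] {β : O →+ Q}

theorem mem_residueBall {j : ℕ} {y : Q} : y ∈ residueBall O₁ β j ↔ ∃ x : O,
    (∃ w ∈ (IsLocalRing.maximalIdeal O₁ ^ j : Ideal O₁),
      algebraMap O₁ (IsLocalRing.ResidueField O) w = IsLocalRing.residue O x) ∧ β x = y := Iff.rfl

theorem apply_mem_residueBall (hβ : ∀ x, β x = 0 ↔ IsLocalRing.residue O x = 0) {j : ℕ} {x : O} :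
    β x ∈ residueBall O₁ β j ↔ ∃ w ∈ (IsLocalRing.maximalIdeal O₁ ^ j : Ideal O₁),
      algebraMap O₁ (IsLocalRing.ResidueField O) w = IsLocalRing.residue O x := by
  rw [mem_residueBall]
  refine ⟨?_, fun h => ⟨x, h, rfl⟩⟩
  rintro ⟨x', ⟨w, hw, hwx⟩, hx'⟩
  refine ⟨w, hw, hwx.trans ?_⟩
  rw [← sub_eq_zero, ← map_sub] at hx' ⊢
  exact (hβ _).1 hx'

theorem relIndex_residueBall [IsFractionRing O₁ (IsLocalRing.ResidueField O)]
    [Finite (IsLocalRing.ResidueField O₁)]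
    (hβ : ∀ x, β x = 0 ↔ IsLocalRing.residue O x = 0) (i j : ℕ) :
    (residueBall O₁ β (i + j)).relIndex (residueBall O₁ β j) =
      Nat.card (IsLocalRing.ResidueField O₁) ^ i := by
  have hk : ∀ A : AddSubgroup (IsLocalRing.ResidueField O),
      A.comap (IsLocalRing.residue O).toAddMonoidHom ⊔ β.ker =
        A.comap (IsLocalRing.residue O).toAddMonoidHom := fun A => sup_eq_left.2 fun x hx => by
    have h0 : IsLocalRing.residue O x = 0 := (hβ x).1 hx
    change IsLocalRing.residue O x ∈ A
    rw [h0]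
    exact zero_mem _
  rw [residueBall, residueBall, AddSubgroup.relIndex_map_map, hk, hk, AddSubgroup.relIndex_comap,
    AddSubgroup.map_comap_eq_self_of_surjective, AddSubgroup.relIndex_map_map_of_injective,
    relIndex_pow_maximalIdeal]
  · exact IsFractionRing.injective O₁ (IsLocalRing.ResidueField O)
  · exact IsLocalRing.residue_surjective

variable [TopologicalSpace K] [TopologicalSpace Q]

theorem hasBasis_residueBall (hK : InducesResidueTopology O O₁ K)
    (hβ : ∀ x, β x = 0 ↔ IsLocalRing.residue O x = 0)
    (hnhds : nhds 0 = Filter.map β (Filter.comap (algebraMap O K) (nhds 0))) :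
    (nhds (0 : Q)).HasBasis (fun _ : ℕ => True) fun j => (residueBall O₁ β j : Set Q) := by
  refine ⟨fun S => ?_⟩
  rw [hnhds]
  constructor
  · intro hS
    obtain ⟨j, -, hj⟩ := hK.mem_iff.1 (Filter.image_mem_map (m := IsLocalRing.residue O)
      (Filter.mem_map.1 hS))
    refine ⟨j, trivial, ?_⟩
    rintro _ ⟨x, ⟨w, hw, hwx⟩, rfl⟩
    obtain ⟨x', hx', hxx⟩ := hj ⟨w, hw, hwx⟩
    have : β x = β x' := by
      rw [← sub_eq_zero, ← map_sub, hβ, map_sub, sub_eq_zero]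
      exact hxx.symm
    rw [this]
    exact hx'
  · rintro ⟨j, -, hj⟩
    refine Filter.mem_of_superset (Filter.image_mem_map ?_) hj
    have := hK.mem_of_mem (i := j) trivial
    rw [Filter.mem_map] at this
    exact this

variable [IsTopologicalAddGroup Q] [WeaklyLocallyCompactSpace Q] [MeasurableSpace Q] [BorelSpace Q]

/-- A homomorphism `α` of `Q ≅ k` which corresponds to the division by `u ∈ k^*` multiplies a Haar
measure by `q^{-ν(u)}`. Both sides are compared on a ball `B_j` of finite measure: its preimage is
the ball `B_{i+j}`, where `i = ν(u)`, and this ball has index `q^i` in `B_j`. -/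
theorem mul_pow_eq_one_of_map_eq_smul [IsFractionRing O₁ (IsLocalRing.ResidueField O)]
    [Finite (IsLocalRing.ResidueField O₁)] (hK : InducesResidueTopology O O₁ K)
    (hβ : ∀ x, β x = 0 ↔ IsLocalRing.residue O x = 0) (hβs : Function.Surjective β)
    (hnhds : nhds 0 = Filter.map β (Filter.comap (algebraMap O K) (nhds 0)))
    (μ : Measure Q) [μ.IsAddHaarMeasure] {α : Q → Q} (hα : Measurable α) {u : Oˣ}
    (hαβ : ∀ x, α (β x) = β ((u⁻¹ : Oˣ) * x)) {s : ℝ} (hs : 0 < s)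
    (hμ : μ.map α = ENNReal.ofReal s • μ) {w : O₁} {i : ℕ}
    (hw : Ideal.span {w} = IsLocalRing.maximalIdeal O₁ ^ i)
    (hwu : algebraMap O₁ (IsLocalRing.ResidueField O) w = IsLocalRing.residue O u) :
    s * (Nat.card (IsLocalRing.ResidueField O₁) : ℝ) ^ i = 1 := by
  have hb := hasBasis_residueBall (O₁ := O₁) hK hβ hnhds
  have hopen : ∀ j, IsOpen (residueBall O₁ β j : Set Q) := fun j =>
    AddSubgroup.isOpen_of_mem_nhds _ (hb.mem_of_mem trivial)
  obtain ⟨S, hS, hSμ⟩ := μ.finiteAt_nhds 0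
  obtain ⟨j, -, hj⟩ := hb.mem_iff.1 hS
  have hpre : α ⁻¹' (residueBall O₁ β j) = residueBall O₁ β (i + j) := by
    ext y
    obtain ⟨x, rfl⟩ := hβs y
    change α (β x) ∈ residueBall O₁ β j ↔ β x ∈ residueBall O₁ β (i + j)
    have hu : IsLocalRing.residue O u * IsLocalRing.residue O (u⁻¹ : Oˣ) = 1 := by
      rw [← map_mul, Units.mul_inv, map_one]
    rw [hαβ, apply_mem_residueBall hβ, apply_mem_residueBall hβ, pow_add, ← hw]
    constructor
    · rintro ⟨z, hz, hzx⟩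
      refine ⟨w * z, Ideal.mul_mem_mul (Ideal.mem_span_singleton_self w) hz, ?_⟩
      rw [map_mul, hzx, hwu, map_mul, ← mul_assoc, hu, one_mul]
    · rintro ⟨z, hz, hzx⟩
      obtain ⟨z, hz', rfl⟩ := Ideal.mem_span_singleton_mul.1 hz
      refine ⟨z, hz', ?_⟩
      rw [map_mul, ← hzx, map_mul, hwu, ← mul_assoc, mul_comm (IsLocalRing.residue O _), hu,
        one_mul]
  have hle : residueBall O₁ β (i + j) ≤ residueBall O₁ β j := by
    rintro _ ⟨x, ⟨w, hw, hwx⟩, rfl⟩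
    exact ⟨x, ⟨w, Ideal.pow_le_pow_right (Nat.le_add_left j i) hw, hwx⟩, rfl⟩
  have h1 := AddSubgroup.relIndex_mul_measure hle
    (by rw [relIndex_residueBall hβ]; exact pow_ne_zero _ Nat.card_pos.ne')
    (hopen _).measurableSet μ
  rw [relIndex_residueBall hβ] at h1
  have h2 : μ (residueBall O₁ β (i + j)) = ENNReal.ofReal s * μ (residueBall O₁ β j) := by
    rw [← hpre, ← Measure.map_apply hα (hopen j).measurableSet, hμ]
    rfl
  have h3 : μ (residueBall O₁ β j) ≠ 0 := (hopen j).measure_ne_zero μ ⟨0, zero_mem _⟩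
  have h4 : μ (residueBall O₁ β j) ≠ ⊤ := ((measure_mono hj).trans_lt hSμ).ne
  rw [h2] at h1
  have h5 := congrArg ENNReal.toReal h1
  rw [ENNReal.toReal_mul, ENNReal.toReal_mul, ENNReal.toReal_ofReal hs.le, ENNReal.toReal_natCast,
    ← mul_assoc] at h5
  have h6 := mul_right_cancel₀ (ENNReal.toReal_ne_zero.2 ⟨h3, h4⟩) (h5.trans (one_mul _).symm)
  rw [mul_comm, ← h6, Nat.cast_pow]

end Modulus

/-! ### Diagonal matrices -/

section Diagonal

variable {K : Type*} [Field K] {n : ℕ}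

/-- The diagonal matrix with given invertible entries. -/
def diagGL (d : Fin n → Kˣ) : Matrix.GeneralLinearGroup (Fin n) K where
  val := Matrix.diagonal fun i => (d i : K)
  inv := Matrix.diagonal fun i => ((d i)⁻¹ : Kˣ)
  val_inv := by simp [Matrix.diagonal_mul_diagonal]
  inv_val := by simp [Matrix.diagonal_mul_diagonal]

theorem diagGL_mulVec (d : Fin n → Kˣ) (v : Fin n → K) (i : Fin n) :
    (diagGL d : Matrix (Fin n) (Fin n) K).mulVec v i = d i * v i :=
  Matrix.mulVec_diagonal _ _ _

theorem diagGL_inv (d : Fin n → Kˣ) : (diagGL d)⁻¹ = diagGL d⁻¹ := by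
  ext1; rfl

theorem diagGL_mul (d e : Fin n → Kˣ) : diagGL d * diagGL e = diagGL (d * e) := by
  refine GeneralLinearGroup.ext_mulVec fun v => funext fun i => ?_
  rw [Units.val_mul, ← Matrix.mulVec_mulVec, diagGL_mulVec, diagGL_mulVec, diagGL_mulVec,
    Pi.mul_apply, Units.val_mul, mul_assoc]

variable {O : Type*} [CommRing O] [Algebra O K]

theorem glMap_diagGL (d : Fin n → Kˣ) (v : Fin n → K) (i : Fin n) :
    glMap O (diagGL d) v i = d i * v i := diagGL_mulVec d v i

theorem OLattice.mem_std {v : Fin n → K} :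
    v ∈ (OLattice.std O K n).1 ↔ ∀ i, ∃ x : O, algebraMap O K x = v i :=
  ⟨fun h i => h i trivial, fun h i _ => h i⟩

theorem OLattice.mem_diagGL_smul_std {d : Fin n → Kˣ} {v : Fin n → K} :
    v ∈ (diagGL d • OLattice.std O K n).1 ↔ ∀ i, ∃ x : O, d i * algebraMap O K x = v i := by
  rw [OLattice.smul_val, mem_map_glMap, diagGL_inv, OLattice.mem_std]
  refine forall_congr' fun i => exists_congr fun x => ?_
  rw [glMap_diagGL, Pi.inv_apply, Units.eq_inv_mul_iff_mul_eq]

/-- The diagonal matrix with given entries in `O^*`. -/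
noncomputable def diagUnits (O : Type*) [CommRing O] [Algebra O K] (d : Fin n → Oˣ) :
    Matrix.GeneralLinearGroup (Fin n) K :=
  diagGL fun i => Units.map (algebraMap O K : O →* K) (d i)

theorem OLattice.diagUnits_smul (d : Fin n → Oˣ) (e : Fin n → Kˣ) :
    (diagUnits O d : Matrix.GeneralLinearGroup (Fin n) K) • diagGL e • OLattice.std O K n =
      diagGL e • OLattice.std O K n := by
  rw [diagUnits, ← mul_smul, diagGL_mul]
  refine OLattice.ext (Submodule.ext fun v => ?_)
  rw [OLattice.mem_diagGL_smul_std, OLattice.mem_diagGL_smul_std]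
  refine forall_congr' fun i => ⟨?_, ?_⟩
  · rintro ⟨x, hx⟩
    refine ⟨d i * x, hx ▸ ?_⟩
    simp only [Pi.mul_apply, Units.val_mul, map_mul, Units.coe_map, MonoidHom.coe_coe]
    ring
  · rintro ⟨x, hx⟩
    refine ⟨(d i)⁻¹ * x, hx ▸ ?_⟩
    have : algebraMap O K (d i) * algebraMap O K ((d i)⁻¹ : Oˣ) = 1 := by
      rw [← map_mul, Units.mul_inv, map_one]
    simp only [Pi.mul_apply, Units.val_mul, map_mul, Units.coe_map, MonoidHom.coe_coe]
    linear_combination (e i * algebraMap O K x) * this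

theorem OLattice.diagUnits_smul_std (d : Fin n → Oˣ) :
    (diagUnits O d : Matrix.GeneralLinearGroup (Fin n) K) • OLattice.std O K n =
      OLattice.std O K n := by
  have := OLattice.diagUnits_smul (K := K) d 1
  have h1 : (diagGL 1 : Matrix.GeneralLinearGroup (Fin n) K) = 1 := by
    ext1
    exact Matrix.diagonal_one
  rwa [h1, one_smul] at this

theorem diagUnits_eq (u : Oˣ) : (diagUnits O ![u, u⁻¹, 1] : Matrix.GeneralLinearGroup (Fin 3) K) =
    diagGL ![Units.map (algebraMap O K : O →* K) u,
      (Units.map (algebraMap O K : O →* K) u)⁻¹, 1] := by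
  rw [diagUnits]
  congr 1
  funext i
  fin_cases i
  · rfl
  · exact map_inv _ _
  · exact map_one _

theorem HaarSystem.pull_meas_of_smul_eq [TopologicalSpace K] [IsLatticeTopology O K]
    (H : HaarSystem O K n)
    {g : Matrix.GeneralLinearGroup (Fin n) K} {N L : OLattice O K n} (hNL : N ≤ L)
    (hN : g • N = N) (hL : g • L = L) : (H.pull g).meas N L hNL = (H.meas N L hNL).map
      (OLattice.Quot.map (glMap O g⁻¹)
        (by have := N.smul_le_comap g; rwa [hN] at this)
        (by have := L.smul_le_comap g; rwa [hL] at this)) :=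
  H.meas_map_congr hN hL (OLattice.smul_mono g hNL) hNL (glMap O g⁻¹) (glMap O g⁻¹) rfl
    (N.smul_le_comap g) (L.smul_le_comap g) _ _

theorem toAut_h_zero_one (u : Kˣ) : SteinbergGroup.toAut K (SteinbergGroup.h 0 1 (by decide) u) =
    stabilize K 3 (diagGL ![u, u⁻¹, 1]) := by
  ext1
  refine LinearMap.ext fun v => Finsupp.ext fun k => ?_
  rw [SteinbergGroup.toAut_h_apply, stabilize_apply]
  split_ifs with h0 h1 h2 h3 h4
  any_goals omega
  all_goals try rw [diagGL_mulVec]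
  · subst h0; rfl
  · subst h2; rfl
  · obtain rfl : k = 2 := by omega
    simp
  · rw [one_mul]

theorem toAut_h_zero_two (u : Kˣ) : SteinbergGroup.toAut K (SteinbergGroup.h 0 2 (by decide) u) =
    stabilize K 3 (diagGL ![u, 1, u⁻¹]) := by
  ext1
  refine LinearMap.ext fun v => Finsupp.ext fun k => ?_
  rw [SteinbergGroup.toAut_h_apply, stabilize_apply]
  split_ifs with h0 h1 h2 h3 h4
  any_goals omega
  all_goals try rw [diagGL_mulVec]
  · subst h0; rfl
  · subst h2; rfl
  · obtain rfl : k = 1 := by omega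
    simp
  · rw [one_mul]

end Diagonal

/-! ### The values on symbols as commutators -/

section Pairing

variable {O K : Type*} [CommRing O] [IsDomain O] [Field K] [Algebra O K] [IsFractionRing O K]
  [TopologicalSpace K] [IsLatticeTopology O K]

variable (O K) in
/-- The pairing `(u, v) ↦ φ({u, v})` for the homomorphism `φ = haarSymbol`. -/
noncomputable def haarPairing : Kˣ →* Kˣ →* PosReal :=
  MonoidHom.mk' (fun u => MonoidHom.mk' (fun v => haarSymbol O K (symbol u v)) fun v v' => by
      rw [← inv_inj, ← map_inv, ← symbol_swap, symbol_mul_left, map_mul, mul_inv, ← map_inv,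
        ← map_inv, ← symbol_swap, ← symbol_swap])
    fun u u' => MonoidHom.ext fun v => by
      change haarSymbol O K (symbol (u * u') v) = haarSymbol O K (symbol u v) *
        haarSymbol O K (symbol u' v)
      rw [symbol_mul_left, map_mul]

theorem haarPairing_apply (u v : Kˣ) : haarPairing O K u v = haarSymbol O K (symbol u v) := rfl

theorem haarPairing_swap (u v : Kˣ) : haarPairing O K v u = (haarPairing O K u v)⁻¹ := by
  rw [haarPairing_apply, symbol_swap, map_inv, haarPairing_apply]

/-- By skew-symmetry the value has square `1`, and it is positive. -/
theorem haarPairing_self (u : Kˣ) : haarPairing O K u u = 1 := by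
  have h := congrArg Subtype.val (mul_eq_one_iff_eq_inv.2 (haarPairing_swap (O := O) u u))
  refine Subtype.ext ?_
  exact (mul_self_eq_one_iff.1 h).resolve_right
    fun h' => absurd (haarPairing O K u u).2 (by rw [h']; norm_num)

/-- The symbol of `u` and `v` is a commutator of lifts of `diag(u, u⁻¹, 1)` and `diag(v, 1, v⁻¹)`.
Its image is thus the commutator of arbitrary pairs `(g, μ)` over these two matrices. -/
theorem mul_eq_ofPosReal_haarPairing_mul (u v : Kˣ) {x y : HaarGL O K 3}
    (hx : x.g = diagGL ![u, u⁻¹, 1]) (hy : y.g = diagGL ![v, 1, v⁻¹]) :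
    x * y = HaarGL.ofPosReal O K 3 (haarPairing O K u v) * (y * x) := by
  rw [← mul_inv_eq_iff_eq_mul, mul_inv_rev, ← mul_assoc]
  apply HaarGLInf.of_injective 3
  rw [← HaarGLInf.ofPosReal_eq, haarPairing_apply, ofPosReal_haarSymbol]
  change HaarGLInf.of O K 3 ⁅x, y⁆ = steinbergLift O K ⁅_, _⁆
  rw [map_commutatorElement, map_commutatorElement]
  refine commutatorElement_congr_of_ker_le_center HaarGLInf.ker_toGL_le_center ?_ ?_
  · rw [toGL_steinbergLift, HaarGLInf.toGL_of, hx, toAut_h_zero_one]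
  · rw [toGL_steinbergLift, HaarGLInf.toGL_of, hy, toAut_h_zero_two]

/-- A matrix which preserves `O^n` has the lift whose measure on `O^n / O^n` is `1`. -/
def HaarGL.ofSMulEq {n : ℕ} {g : Matrix.GeneralLinearGroup (Fin n) K}
    (hg : g • OLattice.std O K n = OLattice.std O K n) : HaarGL O K n :=
  ⟨g, fun _ => 1, by rw [hg]; exact isRelMeasure_const _ 1⟩

/-- For a unit `u` the matrix `diag(u, u⁻¹, 1)` preserves `O^3`, and the value of the pairing is the
factor by which this matrix changes a relative measure over `diag(v, 1, v⁻¹)`. -/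
theorem r_pull_diagUnits (u : Oˣ) (v : Kˣ) {y : HaarGL O K 3} (hy : y.g = diagGL ![v, 1, v⁻¹])
    (H : HaarSystem O K 3) : y.r (H.pull (diagUnits O ![u, u⁻¹, 1])) =
      haarPairing O K (Units.map (algebraMap O K : O →* K) u) v * y.r H := by
  have h := mul_eq_ofPosReal_haarPairing_mul (x := HaarGL.ofSMulEq (OLattice.diagUnits_smul_std
    (K := K) ![u, u⁻¹, 1])) _ v (diagUnits_eq u) hy
  have h2 := congrFun (congrArg HaarGL.r h) H
  rw [HaarGL.mul_r, HaarGL.mul_r, HaarGL.mul_r] at h2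
  change 1 * y.r _ = haarPairing O K _ v * (y.r (H.pull 1) * 1) at h2
  rwa [one_mul, mul_one, HaarSystem.pull_one] at h2

theorem haarPairing_unit_unit (u v : Oˣ) : haarPairing O K (Units.map (algebraMap O K : O →* K) u)
    (Units.map (algebraMap O K : O →* K) v) = 1 := by
  obtain ⟨H⟩ := HaarSystem.nonempty O K 3
  have hd : (diagUnits O ![v, 1, v⁻¹] : Matrix.GeneralLinearGroup (Fin 3) K) =
      diagGL ![Units.map (algebraMap O K : O →* K) v, 1,
        (Units.map (algebraMap O K : O →* K) v)⁻¹] := by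
    rw [diagUnits]
    congr 1
    funext i
    fin_cases i
    · rfl
    · exact map_one _
    · exact map_inv _ _
  have h := r_pull_diagUnits u _ (y := HaarGL.ofSMulEq (OLattice.diagUnits_smul_std
    (K := K) ![v, 1, v⁻¹])) hd H
  exact (mul_one _).symm.trans h.symm

end Pairing

/-! ### The value on the symbol of a unit and a uniformizer -/

section UnitUniformizer

open MeasureTheory OLattice

variable {O O₁ K : Type*} [CommRing O] [Field K] [Algebra O K]

/-- The lattice `ϖ O ⊕ O ⊕ O`. -/
noncomputable def subLattice (O : Type*) [CommRing O] [Algebra O K] (ϖ : Kˣ) : OLattice O K 3 :=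
  diagGL ![ϖ, 1, 1] • OLattice.std O K 3

/-- The map `O → O^3 / (ϖ O ⊕ O ⊕ O)`, `x ↦ (x, 0, 0)`. -/
noncomputable def firstCoordinate (O : Type*) [CommRing O] [Algebra O K] (ϖ : Kˣ) :
    O →+ (subLattice O ϖ).Quot (OLattice.std O K 3) :=
  AddMonoidHom.mk' (fun x => OLattice.Quot.mk _ ⟨Pi.single 0 (algebraMap O K x), fun i _ => by
    by_cases hi : i = 0
    · subst hi; exact ⟨x, (Pi.single_eq_same (M := fun _ => K) 0 _).symm⟩
    · exact ⟨0, by rw [Pi.single_eq_of_ne hi]; exact map_zero _⟩⟩) fun x y => by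
    refine (congrArg _ (Subtype.ext ?_)).trans (map_add (Submodule.mkQ _) _ _)
    change Pi.single 0 _ = Pi.single 0 _ + Pi.single 0 _
    rw [map_add, Pi.single_add]

variable {π : O} {ϖ : Kˣ}

theorem mk_eq_firstCoordinate {v : (OLattice.std O K 3).1} {x : O}
    (hx : algebraMap O K x = v.1 0) :
    OLattice.Quot.mk (subLattice O ϖ) v = firstCoordinate O ϖ x := by
  refine OLattice.Quot.mk_eq_mk_iff.2 ?_
  change v.1 - Pi.single 0 (algebraMap O K x) ∈ _
  rw [subLattice, mem_diagGL_smul_std]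
  intro i
  by_cases hi : i = 0
  · subst hi
    refine ⟨0, ?_⟩
    rw [map_zero, mul_zero, Pi.sub_apply, Pi.single_eq_same, hx, sub_self]
  · obtain ⟨y, hy⟩ := mem_std.1 v.2 i
    refine ⟨y, ?_⟩
    rw [Pi.sub_apply, Pi.single_eq_of_ne hi, sub_zero, ← hy]
    fin_cases i
    · exact absurd rfl hi
    · exact one_mul _
    · exact one_mul _

theorem firstCoordinate_surjective : Function.Surjective (firstCoordinate (K := K) O ϖ) := by
  intro y
  obtain ⟨v, rfl⟩ := OLattice.Quot.mk_surjective y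
  obtain ⟨x, hx⟩ := mem_std.1 v.2 0
  exact ⟨x, (mk_eq_firstCoordinate hx).symm⟩

/-- `firstCoordinate` carries the topology which `K` induces on `O` to the one of the quotient. -/
theorem nhds_eq_map_firstCoordinate [TopologicalSpace K] [IsTopologicalAddGroup K] :
    nhds 0 = Filter.map (firstCoordinate O ϖ) (Filter.comap (algebraMap O K) (nhds (0 : K))) := by
  have hq := OLattice.Quot.isOpenQuotientMap_mk (N := subLattice O ϖ) (L := OLattice.std O K 3)
  apply le_antisymm
  · intro S hS
    obtain ⟨U, hU, hUS⟩ := hS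
    have h1 : OLattice.Quot.mk (subLattice O ϖ) ⁻¹' S ∈ nhds (0 : (OLattice.std O K 3).1) := by
      have hc : Continuous fun v : (OLattice.std O K 3).1 => v.1 0 :=
        (continuous_apply 0).comp continuous_subtype_val
      filter_upwards [hc.continuousAt.preimage_mem_nhds hU] with v hv
      obtain ⟨x, hx⟩ := mem_std.1 v.2 0
      change OLattice.Quot.mk _ v ∈ S
      rw [mk_eq_firstCoordinate hx]
      exact hUS (show algebraMap O K x ∈ U by rw [hx]; exact hv)
    exact Filter.mem_of_superset (hq.isOpenMap.image_mem_nhds h1) (Set.image_preimage_subset _ _)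
  · refine (hq.continuous.tendsto 0).comp ?_
    rw [tendsto_subtype_rng]
    refine tendsto_pi_nhds.2 fun i => ?_
    by_cases hi : i = 0
    · subst hi
      simpa using Filter.tendsto_comap
    · simpa [Pi.single_eq_of_ne hi] using tendsto_const_nhds

variable [IsDomain O] [IsDiscreteValuationRing O] [IsFractionRing O K]

theorem firstCoordinate_eq_zero_iff (hπ : Irreducible π) (hϖ : (ϖ : K) = algebraMap O K π) (x : O) :
    firstCoordinate O ϖ x = 0 ↔ IsLocalRing.residue O x = 0 := by
  rw [IsLocalRing.residue_eq_zero_iff, hπ.maximalIdeal_eq, Ideal.mem_span_singleton]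
  have h0 : (0 : (subLattice O ϖ).Quot (OLattice.std O K 3)) = OLattice.Quot.mk _ 0 := rfl
  rw [h0]
  refine OLattice.Quot.mk_eq_mk_iff.trans ?_
  change (Pi.single 0 (algebraMap O K x) - 0 : Fin 3 → K) ∈ _ ↔ _
  rw [sub_zero, subLattice, mem_diagGL_smul_std]
  constructor
  · intro h
    obtain ⟨y, hy⟩ := h 0
    refine ⟨y, IsFractionRing.injective O K ?_⟩
    rw [map_mul, ← hϖ]
    exact hy.symm
  · rintro ⟨y, rfl⟩ i
    by_cases hi : i = 0
    · subst hi
      exact ⟨y, by rw [Pi.single_eq_same, map_mul, ← hϖ]; rfl⟩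
    · exact ⟨0, by rw [Pi.single_eq_of_ne hi, map_zero, mul_zero]⟩

variable [CommRing O₁] [IsDomain O₁] [IsDiscreteValuationRing O₁]
  [Algebra O₁ (IsLocalRing.ResidueField O)] [IsFractionRing O₁ (IsLocalRing.ResidueField O)]
  [Finite (IsLocalRing.ResidueField O₁)]
  [TopologicalSpace K] [IsLatticeTopology O K]

/-- The matrix `g = diag(u, u⁻¹, 1)` preserves `O^3`, the lattice `ϖ O ⊕ O ⊕ ϖ⁻¹ O` and their common
sublattice `N = ϖ O ⊕ O ⊕ O`. The value is the ratio of the factors by which `g` changes the Haar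
measures of the two quotients by `N`. On `(ϖ O ⊕ O ⊕ ϖ⁻¹ O) / N` it acts trivially, and on `O^3 /
N`, which is the residue field, by multiplication by the residue class of `u`. -/
theorem haarPairing_unit_uniformizer_mul_pow (hK : InducesResidueTopology O O₁ K)
    (hπ : Irreducible π) (hϖ : (ϖ : K) = algebraMap O K π) {u : Oˣ} {w : O₁} {i : ℕ}
    (hw : Ideal.span {w} = IsLocalRing.maximalIdeal O₁ ^ i)
    (hwu : algebraMap O₁ (IsLocalRing.ResidueField O) w = IsLocalRing.residue O u) :
    (haarPairing O K (Units.map (algebraMap O K : O →* K) u) ϖ : ℝ) *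
      (Nat.card (IsLocalRing.ResidueField O₁) : ℝ) ^ i = 1 := by
  have := IsLatticeTopology.isTopologicalAddGroup (O := O) (K := K)
  obtain ⟨H⟩ := HaarSystem.nonempty O K 3
  obtain ⟨y, hy⟩ := HaarGL.toGL_surjective (O := O) (diagGL ![ϖ, 1, ϖ⁻¹])
  change y.g = _ at hy
  set g : Matrix.GeneralLinearGroup (Fin 3) K := diagUnits O ![u, u⁻¹, 1] with hg
  set N := subLattice O ϖ with hN
  have hgN : g • N = N := diagUnits_smul _ _
  have hgS : g • OLattice.std O K 3 = OLattice.std O K 3 := diagUnits_smul_std _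
  have hgL : g • y.g • OLattice.std O K 3 = y.g • OLattice.std O K 3 := by
    rw [hy]; exact diagUnits_smul _ _
  have hNS : N ≤ OLattice.std O K 3 := by
    intro v hv
    rw [mem_std]
    intro i
    obtain ⟨x, hx⟩ := mem_diagGL_smul_std.1 hv i
    fin_cases i
    · exact ⟨π * x, by rw [map_mul, ← hϖ]; exact hx⟩
    · exact ⟨x, by rw [← hx]; exact (one_mul _).symm⟩
    · exact ⟨x, by rw [← hx]; exact (one_mul _).symm⟩
  have hNL : N ≤ y.g • OLattice.std O K 3 := by
    intro v hv
    rw [hy, mem_diagGL_smul_std]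
    intro i
    obtain ⟨x, hx⟩ := mem_diagGL_smul_std.1 hv i
    fin_cases i
    · exact ⟨x, hx⟩
    · exact ⟨x, hx⟩
    · refine ⟨π * x, ?_⟩
      rw [← hx, map_mul, ← hϖ]
      change ((ϖ⁻¹ : Kˣ) : K) * (ϖ * algebraMap O K x) = ((1 : Kˣ) : K) * algebraMap O K x
      rw [Units.inv_mul_cancel_left, Units.val_one, one_mul]
  obtain ⟨c, hc⟩ := H.exists_rescaled (H.pull g)
  have h1 := y.isRelMeasure H (H.pull g) c hc
  rw [hg, r_pull_diagUnits u ϖ hy] at h1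
  have hcL := hc N _ hNL
  have hcS := hc N _ hNS
  rw [H.pull_meas_of_smul_eq hNL hgN hgL] at hcL
  rw [H.pull_meas_of_smul_eq hNS hgN hgS] at hcS
  have hginv : g⁻¹ = diagUnits O ![u⁻¹, u, 1] := by
    rw [hg, diagUnits, diagGL_inv, diagUnits]
    congr 1
    funext i
    rw [Pi.inv_apply, ← map_inv]
    congr 1
    fin_cases i
    · rfl
    · exact inv_inv u
    · exact inv_one
  -- The quotient `(ϖ O ⊕ O ⊕ ϖ⁻¹ O) / N` is the third coordinate, on which `g` acts trivially.
  have hcNL : c (y.g • OLattice.std O K 3) = c N := by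
    have e : ∀ a b, (OLattice.Quot.map (N := N) (L := y.g • OLattice.std O K 3) (N' := N)
        (L' := y.g • OLattice.std O K 3) (glMap O g⁻¹) a b :
          N.Quot (y.g • OLattice.std O K 3) → N.Quot (y.g • OLattice.std O K 3)) = id := by
      intro a b
      funext z
      obtain ⟨⟨v, hv⟩, rfl⟩ := OLattice.Quot.mk_surjective z
      refine OLattice.Quot.mk_eq_mk_iff.2 ?_
      change glMap O g⁻¹ v - v ∈ N.1
      have hv := mem_diagGL_smul_std.1 (hy ▸ hv)
      rw [hN, subLattice, mem_diagGL_smul_std, hginv, diagUnits]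
      intro i
      obtain ⟨x, hx⟩ := hv i
      rw [Pi.sub_apply, glMap_diagGL, ← hx]
      fin_cases i
      · refine ⟨(u⁻¹ : Oˣ) * x - x, ?_⟩
        simp
        ring
      · refine ⟨u * x - x, ?_⟩
        simp
      · exact ⟨0, by simp⟩
    rw [e, Measure.map_id] at hcL
    have h2 := H.scalar_unique hNL (s := 1) (t := c (y.g • OLattice.std O K 3) / c N)
      (by rw [show ((1 : PosReal) : ℝ) = 1 from rfl, ENNReal.ofReal_one, one_smul]; exact hcL)
    exact (div_eq_one.1 h2.symm)
  rw [hcNL] at h1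
  have h3 : haarPairing O K (Units.map (algebraMap O K : O →* K) u) ϖ =
      c (OLattice.std O K 3) / c N := by
    rw [eq_div_iff_mul_eq', ← mul_right_inj (y.r H), ← h1]
    ac_rfl
  have := IsLatticeTopology.locallyCompactSpace 3 N (OLattice.std O K 3) hNS
  have := H.isAddHaar N _ hNS
  rw [h3]
  refine mul_pow_eq_one_of_map_eq_smul hK (firstCoordinate_eq_zero_iff hπ hϖ)
    firstCoordinate_surjective nhds_eq_map_firstCoordinate (H.meas N _ hNS)
    (OLattice.Quot.continuous_map (continuous_glMap _) _ _).measurable (u := u) (fun x => ?_)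
    (div_pos (c _).2 (c N).2) hcS hw hwu
  refine mk_eq_firstCoordinate ?_
  change _ = glMap O g⁻¹ (Pi.single 0 (algebraMap O K x)) 0
  rw [hginv, diagUnits, glMap_diagGL, Pi.single_eq_same, map_mul]
  rfl

end UnitUniformizer

/-! ### The tame symbol -/

section Valuation

variable {R F : Type*} [CommRing R] [IsDomain R] [IsDiscreteValuationRing R] [Field F] [Algebra R F]
  [IsFractionRing R F]

theorem dvrVal_mul {x y : F} (hx : x ≠ 0) (hy : y ≠ 0) :
    dvrVal R (x * y) = dvrVal R x + dvrVal R y := by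
  rw [dvrVal, map_mul, WithZero.log_mul]
  · rfl
  · exact (map_ne_zero _).2 hx
  · exact (map_ne_zero _).2 hy

theorem dvrVal_zpow (x : F) (n : ℤ) : dvrVal R (x ^ n) = n * dvrVal R x := by
  rw [dvrVal, map_zpow₀, WithZero.log_zpow]
  rfl

theorem dvrVal_unit (u : Rˣ) : dvrVal R (algebraMap R F u) = 0 := by
  rw [dvrVal, Ring.ordFrac_of_isUnit u.isUnit, WithZero.log_one]

theorem dvrVal_irreducible {ϖ : R} (hϖ : Irreducible ϖ) : dvrVal R (algebraMap R F ϖ) = 1 := by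
  rw [dvrVal, Ring.ordFrac_irreducible hϖ, WithZero.log_exp]

theorem exists_span_singleton_eq_pow {w : R} (hw : w ≠ 0) :
    ∃ i : ℕ, Ideal.span {w} = IsLocalRing.maximalIdeal R ^ i ∧
      dvrVal R (algebraMap R F w) = i := by
  obtain ⟨p, hp⟩ := IsDiscreteValuationRing.exists_irreducible R
  obtain ⟨i, u, rfl⟩ := IsDiscreteValuationRing.eq_unit_mul_pow_irreducible hw hp
  have hp0 : algebraMap R F p ≠ 0 :=
    (map_ne_zero_iff _ (IsFractionRing.injective R F)).2 hp.ne_zero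
  refine ⟨i, ?_, ?_⟩
  · rw [hp.maximalIdeal_eq, Ideal.span_singleton_pow, Ideal.span_singleton_mul_left_unit u.isUnit]
  · rw [map_mul, map_pow,
      dvrVal_mul ((map_ne_zero_iff _ (IsFractionRing.injective R F)).2 u.ne_zero)
      (pow_ne_zero i hp0), dvrVal_unit, ← zpow_natCast, dvrVal_zpow, dvrVal_irreducible hp]
    ring

theorem exists_eq_unit_mul_zpow {p : R} (hp : Irreducible p) {ϖ : Fˣ}
    (hϖ : (ϖ : F) = algebraMap R F p) (f : Fˣ) : ∃ (u : Rˣ) (n : ℤ),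
      f = Units.map (algebraMap R F : R →* F) u * ϖ ^ n ∧ dvrVal R (f : F) = n := by
  have hinj := IsFractionRing.injective R F
  obtain ⟨a, b, hb, hab⟩ := IsFractionRing.div_surjective (A := R) (f : F)
  have hb0 : b ≠ 0 := nonZeroDivisors.ne_zero hb
  have ha0 : a ≠ 0 := by
    rintro rfl
    rw [map_zero, zero_div] at hab
    exact f.ne_zero hab.symm
  obtain ⟨i, u, rfl⟩ := IsDiscreteValuationRing.eq_unit_mul_pow_irreducible ha0 hp
  obtain ⟨j, v, rfl⟩ := IsDiscreteValuationRing.eq_unit_mul_pow_irreducible hb0 hp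
  have e : f = Units.map (algebraMap R F : R →* F) (u * v⁻¹) * ϖ ^ ((i : ℤ) - j) := by
    rw [zpow_sub, zpow_natCast, zpow_natCast, map_mul, map_inv]
    ext1
    rw [← hab, map_mul, map_mul, map_pow, map_pow, ← hϖ, div_eq_mul_inv, mul_inv]
    simp only [Units.val_mul, Units.val_inv_eq_inv_val, Units.val_pow_eq_pow_val, Units.coe_map,
      MonoidHom.coe_coe]
    ring
  refine ⟨u * v⁻¹, (i : ℤ) - j, e, ?_⟩
  rw [e, Units.val_mul, Units.val_zpow_eq_zpow_val, dvrVal_mul (Units.ne_zero _)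
    (zpow_ne_zero _ ϖ.ne_zero), dvrVal_zpow, hϖ, dvrVal_irreducible hp]
  change dvrVal R (algebraMap R F (u * v⁻¹ : Rˣ)) + _ = _
  rw [dvrVal_unit]
  ring

end Valuation

section TameSymbol

variable {O O₁ K : Type*} [CommRing O] [IsDomain O] [IsDiscreteValuationRing O]
  [Field K] [Algebra O K] [IsFractionRing O K]
  [CommRing O₁] [IsDomain O₁] [IsDiscreteValuationRing O₁]
  [Algebra O₁ (IsLocalRing.ResidueField O)] [IsFractionRing O₁ (IsLocalRing.ResidueField O)]

theorem exists_unit_residue_eq {z : IsLocalRing.ResidueField O} (hz : z ≠ 0) :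
    ∃ u : Oˣ, IsLocalRing.residue O u = z := by
  obtain ⟨x, rfl⟩ := IsLocalRing.residue_surjective z
  exact ⟨((IsLocalRing.residue_ne_zero_iff_isUnit x).1 hz).unit, rfl⟩

theorem residue_unit_ne_zero (u : Oˣ) : IsLocalRing.residue O u ≠ 0 :=
  (IsLocalRing.residue_ne_zero_iff_isUnit _).2 u.isUnit

/-- The tame symbol in terms of the unit parts and the valuations. -/
theorem tameVal_unit_mul_zpow {ϖ f g : Kˣ} {u v : Oˣ} {a b : ℤ}
    (hf : f = Units.map (algebraMap O K : O →* K) u * ϖ ^ a) (ha : dvrVal O (f : K) = a)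
    (hg : g = Units.map (algebraMap O K : O →* K) v * ϖ ^ b) (hb : dvrVal O (g : K) = b) :
    tameVal O O₁ f g = b * dvrVal O₁ (IsLocalRing.residue O u) -
      a * dvrVal O₁ (IsLocalRing.residue O v) := by
  have e : (f : K) ^ b / (g : K) ^ a = algebraMap O K (u ^ b * v ^ (-a) : Oˣ) := by
    have : f ^ b / g ^ a = Units.map (algebraMap O K : O →* K) (u ^ b * v ^ (-a)) := by
      rw [hf, hg, mul_zpow, mul_zpow, ← zpow_mul, ← zpow_mul, mul_comm b a,
        mul_div_mul_right_eq_div, map_mul, map_zpow, map_zpow, zpow_neg, div_eq_mul_inv]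
    have h := congrArg Units.val this
    rwa [div_eq_mul_inv, ← zpow_neg, Units.val_mul, Units.val_zpow_eq_zpow_val,
      Units.val_zpow_eq_zpow_val, zpow_neg, ← div_eq_mul_inv] at h
  have hr : IsLocalRing.residue O (u ^ b * v ^ (-a) : Oˣ) =
      IsLocalRing.residue O u ^ b * IsLocalRing.residue O v ^ (-a) := by
    have := congrArg Units.val (map_mul
      (Units.map (IsLocalRing.residue O : O →* IsLocalRing.ResidueField O)) (u ^ b) (v ^ (-a)))
    rwa [map_zpow, map_zpow, Units.val_mul, Units.val_zpow_eq_zpow_val,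
      Units.val_zpow_eq_zpow_val] at this
  rw [tameVal, ha, hb, e, reduction_algebraMap, hr,
    dvrVal_mul (zpow_ne_zero _ (residue_unit_ne_zero u)) (zpow_ne_zero _ (residue_unit_ne_zero v)),
    dvrVal_zpow, dvrVal_zpow]
  ring

variable [Finite (IsLocalRing.ResidueField O₁)] [TopologicalSpace K] [IsLatticeTopology O K]

theorem haarPairing_unit_uniformizer (hK : InducesResidueTopology O O₁ K) {p : O}
    (hp : Irreducible p) {ϖ : Kˣ} (hϖ : (ϖ : K) = algebraMap O K p) (u : Oˣ) :
    (haarPairing O K (Units.map (algebraMap O K : O →* K) u) ϖ : ℝ) =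
      (Nat.card (IsLocalRing.ResidueField O₁) : ℝ) ^ (-dvrVal O₁ (IsLocalRing.residue O u)) := by
  have hq : (Nat.card (IsLocalRing.ResidueField O₁) : ℝ) ≠ 0 := Nat.cast_ne_zero.2 Nat.card_pos.ne'
  have hinj := IsFractionRing.injective O₁ (IsLocalRing.ResidueField O)
  -- the case of a residue class in `O₁`
  have key : ∀ (u : Oˣ) (w : O₁),
      algebraMap O₁ (IsLocalRing.ResidueField O) w = IsLocalRing.residue O u →
      (haarPairing O K (Units.map (algebraMap O K : O →* K) u) ϖ : ℝ) =
        (Nat.card (IsLocalRing.ResidueField O₁) : ℝ) ^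
          (-dvrVal O₁ (IsLocalRing.residue O u)) := by
    intro u w hwu
    have hw : w ≠ 0 := by
      rintro rfl
      rw [map_zero] at hwu
      exact residue_unit_ne_zero u hwu.symm
    obtain ⟨i, hi, hiv⟩ := exists_span_singleton_eq_pow (F := IsLocalRing.ResidueField O) hw
    rw [← hwu, hiv, zpow_neg, zpow_natCast]
    exact eq_inv_of_mul_eq_one_left (haarPairing_unit_uniformizer_mul_pow hK hp hϖ hi hwu)
  -- in general the residue class is a quotient of two such classes
  obtain ⟨w, w', hw', hww⟩ := IsFractionRing.div_surjective (A := O₁) (IsLocalRing.residue O u)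
  have hw0 : algebraMap O₁ (IsLocalRing.ResidueField O) w' ≠ 0 :=
    (map_ne_zero_iff _ hinj).2 (nonZeroDivisors.ne_zero hw')
  obtain ⟨u', hu'⟩ := exists_unit_residue_eq hw0
  have h1 := key u' w' hu'.symm
  have h2 := key (u * u') w (by rw [Units.val_mul, map_mul, hu', ← hww, div_mul_cancel₀ _ hw0])
  have h3 : haarPairing O K (Units.map (algebraMap O K : O →* K) (u * u')) ϖ =
      haarPairing O K (Units.map (algebraMap O K : O →* K) u) ϖ *
        haarPairing O K (Units.map (algebraMap O K : O →* K) u') ϖ := by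
    rw [map_mul, map_mul]
    rfl
  rw [h3, Units.val_mul, map_mul, dvrVal_mul (residue_unit_ne_zero u) (residue_unit_ne_zero u'),
    neg_add, zpow_add₀ hq] at h2
  change (haarPairing O K _ ϖ : ℝ) * (haarPairing O K _ ϖ : ℝ) = _ at h2
  rw [h1] at h2
  exact mul_right_cancel₀ (zpow_ne_zero _ hq) h2

/-- On `f = u ϖ^a` and `g = v ϖ^b` the pairing is bimultiplicative and skew-symmetric, trivial on
pairs of units and on `(ϖ, ϖ)`, and the logarithmic tame symbol expands in the same way. -/
theorem haarSymbol_symbol (hK : InducesResidueTopology O O₁ K) (f g : Kˣ) :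
    (haarSymbol O K (symbol f g) : ℝ) =
      (Nat.card (IsLocalRing.ResidueField O₁) : ℝ) ^ (-tameVal O O₁ f g) := by
  have hq : (Nat.card (IsLocalRing.ResidueField O₁) : ℝ) ≠ 0 := Nat.cast_ne_zero.2 Nat.card_pos.ne'
  obtain ⟨p, hp⟩ := IsDiscreteValuationRing.exists_irreducible O
  have hp0 : algebraMap O K p ≠ 0 :=
    (map_ne_zero_iff _ (IsFractionRing.injective O K)).2 hp.ne_zero
  obtain ⟨u, a, hf, ha⟩ := exists_eq_unit_mul_zpow hp (ϖ := Units.mk0 _ hp0) rfl f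
  obtain ⟨v, b, hg, hb⟩ := exists_eq_unit_mul_zpow hp (ϖ := Units.mk0 _ hp0) rfl g
  set ϖ := Units.mk0 _ hp0 with hϖ
  have hu := haarPairing_unit_uniformizer hK hp (ϖ := ϖ) rfl u
  have hv := haarPairing_unit_uniformizer hK hp (ϖ := ϖ) rfl v
  have h1 : haarPairing O K f g = haarPairing O K (Units.map (algebraMap O K : O →* K) u) ϖ ^ b *
      haarPairing O K (Units.map (algebraMap O K : O →* K) v) ϖ ^ (-a) := by
    rw [hf, hg]
    simp only [map_mul, map_zpow, MonoidHom.mul_apply, MonoidHom.zpow_apply]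
    rw [haarPairing_unit_unit, haarPairing_self,
      haarPairing_swap (Units.map (algebraMap O K : O →* K) v) ϖ]
    simp [mul_comm]
  rw [tameVal_unit_mul_zpow (O₁ := O₁) hf ha hg hb, ← haarPairing_apply, h1]
  change ((haarPairing O K _ ϖ ^ b : PosReal) : ℝ) *
    ((haarPairing O K _ ϖ ^ (-a) : PosReal) : ℝ) = _
  rw [Positive.coe_zpow, Positive.coe_zpow, hu, hv, ← zpow_mul, ← zpow_mul, ← zpow_add₀ hq]
  congr 1
  ring

end TameSymbol

/-! ### Morphisms of extensions and pushouts -/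

section PushoutMorphism

variable {A B E E' G : Type*} [Group A] [Group B] [Group E] [Group E'] [Group G]

/-- A morphism of extensions of the same group identifies the second extension, if its kernel is
central, with the pushout of the first. -/
theorem isPushoutExtension_of_hom (S : GroupExtension A E G) (S' : GroupExtension B E' G)
    (φ : A →* B) (Ψ : E →* E') (hcentral : ∀ b e, S'.inl b * e = e * S'.inl b)
    (hinl : ∀ a, Ψ (S.inl a) = S'.inl (φ a)) (hright : ∀ e, S'.rightHom (Ψ e) = S.rightHom e) :
    IsPushoutExtension S φ S' := by
  have hS' : ∀ b, S'.rightHom (S'.inl b) = 1 := fun b =>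
    MonoidHom.mem_ker.1 (S'.range_inl_eq_ker_rightHom ▸ ⟨b, rfl⟩)
  let F : E × B →* E' := MonoidHom.mk' (fun x => Ψ x.1 * S'.inl x.2) fun x y => by
    change Ψ (x.1 * y.1) * S'.inl (x.2 * y.2) = _
    rw [map_mul, map_mul, mul_assoc (Ψ x.1), mul_assoc (Ψ x.1), ← mul_assoc (Ψ y.1),
      ← mul_assoc (S'.inl x.2), hcentral x.2 (Ψ y.1)]
  have hF : ∀ x b, F (x, b) = Ψ x * S'.inl b := fun _ _ => rfl
  have hker : Subgroup.normalClosure (Set.range fun a => (S.inl a, (φ a)⁻¹)) = F.ker := by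
    apply le_antisymm
    · refine Subgroup.normalClosure_le_normal ?_
      rintro _ ⟨a, rfl⟩
      change F (_, _) = 1
      rw [hF, hinl, map_inv, mul_inv_cancel]
    · rintro ⟨x, b⟩ hx
      have hx : Ψ x * S'.inl b = 1 := hx
      have h1 : x ∈ S.inl.range := by
        have h := congrArg S'.rightHom hx
        rw [map_mul, hS', mul_one, map_one, hright] at h
        rwa [S.range_inl_eq_ker_rightHom]
      obtain ⟨a, rfl⟩ := h1
      rw [hinl, ← map_mul] at hx
      have hb : b = (φ a)⁻¹ :=
        (inv_eq_of_mul_eq_one_right (S'.inl_injective (hx.trans (map_one _).symm))).symm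
      rw [hb]
      exact Subgroup.subset_normalClosure ⟨a, rfl⟩
  have hsurj : Function.Surjective F := by
    intro e
    obtain ⟨x, hx⟩ := S.rightHom_surjective (S'.rightHom e)
    have : (Ψ x)⁻¹ * e ∈ S'.inl.range := by
      rw [S'.range_inl_eq_ker_rightHom, MonoidHom.mem_ker, map_mul, map_inv, hright, hx,
        inv_mul_cancel]
    obtain ⟨b, hb⟩ := this
    exact ⟨(x, b), by rw [hF, hb, mul_inv_cancel_left]⟩
  refine ⟨(QuotientGroup.quotientMulEquivOfEq hker).trans
    (QuotientGroup.quotientKerEquivOfSurjective F hsurj), fun b => ?_, fun x b => ?_⟩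
  · change F (1, b) = _
    rw [hF, map_one, one_mul]
  · change S'.rightHom (F (x, b)) = _
    rw [hF, map_mul, hright, hS', mul_one]

end PushoutMorphism

/-! ### The comparison of the two extensions -/

section Comparison

variable (O K : Type*) [CommRing O] [IsDomain O] [Field K] [Algebra O K] [IsFractionRing O K]
  [TopologicalSpace K] [IsLatticeTopology O K]

theorem det_eq_one_iff_mem_range_haarProj (g : GL2 K) : Matrix.GeneralLinearGroup.det g = 1 ↔
    g ∈ ((HaarGL.toGL O K 2).comp (haarSL2 O K).subtype).range := by
  constructor
  · intro hg
    obtain ⟨x, rfl⟩ := HaarGL.toGL_surjective (O := O) g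
    exact ⟨⟨x, hg⟩, rfl⟩
  · rintro ⟨x, rfl⟩
    exact x.2

/-- The extension `1 → ℝ_{>0} → θ⁻¹(SL_2(K)) ⋊ Kˣ → GL_2(K) → 1`. -/
noncomputable def haarExtension : GroupExtension PosReal (HaarGL2 O K) (GL2 K) :=
  semidirectExtension K
    ((HaarGL.ofPosReal O K 2).codRestrict (haarSL2 O K) fun t => by
      rw [haarSL2, MonoidHom.mem_ker, MonoidHom.comp_apply]
      exact map_one _)
    ((HaarGL.toGL O K 2).comp (haarSL2 O K).subtype)
    (fun s t h => HaarGL.ofPosReal_injective 2 (congrArg Subtype.val h))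
    (by
      ext x
      constructor
      · rintro ⟨t, rfl⟩
        rfl
      · intro hx
        obtain ⟨t, ht⟩ := HaarGL.exists_eq_ofPosReal (x := x.1) hx
        exact ⟨t, Subtype.ext ht.symm⟩)
    (det_eq_one_iff_mem_range_haarProj O K) (haarAction O K)
    (fun a x => by
      change HaarGL.toGL O K 2 (haarLift O K a * x.1 * (haarLift O K a)⁻¹) =
        upperLeft K a * HaarGL.toGL O K 2 x.1 * (upperLeft K a)⁻¹
      rw [map_mul, map_mul, map_inv, toGL_haarLift])

theorem haarInl_comm (t : PosReal) (x : HaarGL2 O K) : haarInl O K t * x = x * haarInl O K t := by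
  have hc : ∀ y : HaarGL O K 2, HaarGL.ofPosReal O K 2 t * y = y * HaarGL.ofPosReal O K 2 t :=
    fun y => (Subgroup.mem_center_iff.1 (HaarGL.ker_toGL_le_center
      (x := HaarGL.ofPosReal O K 2 t) (map_one (HaarGL.toGL O K 2))) y).symm
  refine SemidirectProduct.ext (Subtype.ext ?_) ?_
  · change HaarGL.ofPosReal O K 2 t * (haarAction O K 1 x.left).1 =
      x.left.1 * (haarLift O K x.right * HaarGL.ofPosReal O K 2 t * (haarLift O K x.right)⁻¹)
    rw [map_one, ← hc, mul_inv_cancel_right, hc]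
    rfl
  · exact (one_mul _).trans (mul_one _).symm

variable {O K}

/-- The lift to `HaarGLInf` is equivariant for `Kˣ`: both sides are lifts of the same homomorphism,
and lifts from `St(K)` to a central extension are unique. -/
theorem steinbergLift_cornerAction (a : Kˣ) (s : SteinbergGroup K) :
    steinbergLift O K (cornerAction K a s) = HaarGLInf.of O K 2 (haarLift O K a) *
      steinbergLift O K s * (HaarGLInf.of O K 2 (haarLift O K a))⁻¹ := by
  have h : (steinbergLift O K).comp (cornerAction K a) =
      (MulAut.conj (HaarGLInf.of O K 2 (haarLift O K a))).toMonoidHom.comp (steinbergLift O K) := by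
    refine SteinbergGroup.hom_ext_of_ker_le_center HaarGLInf.ker_toGL_le_center
      (MonoidHom.ext fun s => ?_)
    change HaarGLInf.toGL O K (steinbergLift O K _) =
      HaarGLInf.toGL O K (_ * steinbergLift O K s * _⁻¹)
    rw [map_mul, map_mul, map_inv, toGL_steinbergLift, toGL_steinbergLift, toAut_cornerAction,
      HaarGLInf.toGL_of]
    rw [show (haarLift O K a).g = upperLeft K a from toGL_haarLift O K a]
  exact DFunLike.congr_fun h s

/-- Over `SL_2(K)` the lift `steinbergLift` takes its values in the group of pairs for `n = 2`. -/
theorem exists_of_eq_steinbergLift (x : steinbergSL2 K) :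
    ∃ e : haarSL2 O K, e.1.g = x.1.2 ∧ HaarGLInf.of O K 2 e.1 = steinbergLift O K x.1.1 := by
  obtain ⟨e, he⟩ := HaarGL.toGL_surjective (O := O) x.1.2
  change e.g = _ at he
  obtain ⟨t, ht⟩ := HaarGLInf.exists_eq_ofPosReal
    (e := (HaarGLInf.of O K 2 e)⁻¹ * steinbergLift O K x.1.1) (by
      rw [map_mul, map_inv, toGL_steinbergLift, HaarGLInf.toGL_of, he, x.2.2, inv_mul_cancel])
  rw [HaarGLInf.ofPosReal_eq 2, inv_mul_eq_iff_eq_mul, ← map_mul] at ht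
  have hg : (e * HaarGL.ofPosReal O K 2 t).g = x.1.2 := by
    rw [HaarGL.mul_g, he]
    exact mul_one _
  refine ⟨⟨e * HaarGL.ofPosReal O K 2 t, ?_⟩, hg, ht.symm⟩
  change Matrix.GeneralLinearGroup.det (e * HaarGL.ofPosReal O K 2 t).g = 1
  rw [hg, x.2.1]

variable (O K) in
/-- The homomorphism from the pullback of `St(K)` to `SL_2(K)` to the preimage of `SL_2(K)` in the
group of pairs `(g, μ)`, which the homomorphism `steinbergLift` induces. -/
noncomputable def steinbergSL2Lift : steinbergSL2 K →* haarSL2 O K :=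
  MonoidHom.mk' (fun x => (exists_of_eq_steinbergLift (O := O) x).choose) fun x y =>
    Subtype.ext (HaarGLInf.of_injective 2 (by
      refine (exists_of_eq_steinbergLift (O := O) (x * y)).choose_spec.2.trans
        ((map_mul (steinbergLift O K) x.1.1 y.1.1).trans ?_)
      exact ((map_mul (HaarGLInf.of O K 2) _ _).trans (congrArg₂ (· * ·)
        (exists_of_eq_steinbergLift (O := O) x).choose_spec.2
        (exists_of_eq_steinbergLift (O := O) y).choose_spec.2)).symm))

theorem of_steinbergSL2Lift (x : steinbergSL2 K) :
    HaarGLInf.of O K 2 (steinbergSL2Lift O K x).1 = steinbergLift O K x.1.1 :=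
  (exists_of_eq_steinbergLift (O := O) x).choose_spec.2

theorem toGL_steinbergSL2Lift (x : steinbergSL2 K) : (steinbergSL2Lift O K x).1.g = x.1.2 :=
  (exists_of_eq_steinbergLift (O := O) x).choose_spec.1

theorem steinbergSL2Lift_action (a : Kˣ) (x : steinbergSL2 K) :
    steinbergSL2Lift O K (steinbergAction K a x) =
      haarAction O K a (steinbergSL2Lift O K x) := by
  refine Subtype.ext (HaarGLInf.of_injective 2 ?_)
  rw [of_steinbergSL2Lift]
  change steinbergLift O K (cornerAction K a x.1.1) =
    HaarGLInf.of O K 2 (haarLift O K a * (steinbergSL2Lift O K x).1 * (haarLift O K a)⁻¹)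
  rw [map_mul, map_mul, map_inv, of_steinbergSL2Lift, steinbergLift_cornerAction]

variable (O K) in
/-- The morphism from the extension of `GL_2(K)` by `K_2(K)` to the extension by `ℝ_{>0}`. -/
noncomputable def comparison : steinbergSL2 K ⋊[steinbergAction K] Kˣ →* HaarGL2 O K :=
  SemidirectProduct.map (steinbergSL2Lift O K) (MonoidHom.id Kˣ) fun a =>
    MonoidHom.ext fun x => steinbergSL2Lift_action a x

variable (O K) in
theorem isPushoutExtension_haarSymbol :
    IsPushoutExtension (steinbergExtension K) (haarSymbol O K) (haarExtension O K) := by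
  refine isPushoutExtension_of_hom _ _ _ (comparison O K) (haarInl_comm O K) (fun k => ?_)
    fun x => ?_
  · refine SemidirectProduct.ext (Subtype.ext (HaarGLInf.of_injective 2 ?_)) rfl
    change HaarGLInf.of O K 2 (steinbergSL2Lift O K (steinbergInl K k)).1 =
      HaarGLInf.of O K 2 (HaarGL.ofPosReal O K 2 (haarSymbol O K k))
    rw [of_steinbergSL2Lift, ← HaarGLInf.ofPosReal_eq, ofPosReal_haarSymbol]
    rfl
  · change (steinbergSL2Lift O K x.left).1.g * upperLeft K x.right =
      x.left.1.2 * upperLeft K x.right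
    rw [toGL_steinbergSL2Lift]

end Comparison

theorem proposition3 {O O₁ K : Type*}
    [CommRing O] [IsDomain O] [IsDiscreteValuationRing O]
    [IsAdicComplete (IsLocalRing.maximalIdeal O) O]
    [Field K] [Algebra O K] [IsFractionRing O K]
    [CommRing O₁] [IsDomain O₁] [IsDiscreteValuationRing O₁]
    [IsAdicComplete (IsLocalRing.maximalIdeal O₁) O₁]
    [Algebra O₁ (IsLocalRing.ResidueField O)] [IsFractionRing O₁ (IsLocalRing.ResidueField O)]
    [Finite (IsLocalRing.ResidueField O₁)]
    [TopologicalSpace K] [IsLatticeTopology O K] (hK : InducesResidueTopology O O₁ K) :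
    ∃ φ : K2 K →* PosReal,
      (∀ ψ : K2 K →* PosReal,
        (∀ f g : Kˣ, (ψ (symbol f g) : ℝ) =
          (Nat.card (IsLocalRing.ResidueField O₁) : ℝ) ^ (-tameVal O O₁ f g)) ↔ ψ = φ) ∧
      ∃ S : GroupExtension PosReal (HaarGL2 O K) (GL2 K),
        S.inl = haarInl O K ∧ S.rightHom = haarProj O K ∧
          IsPushoutExtension (steinbergExtension K) φ S := by
  refine ⟨haarSymbol O K, fun ψ => ⟨fun h => ?_, ?_⟩, haarExtension O K, rfl, rfl,
    isPushoutExtension_haarSymbol O K⟩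
  · exact K2.hom_ext fun f g => Subtype.ext ((h f g).trans (haarSymbol_symbol hK f g).symm)
  · rintro rfl
    exact haarSymbol_symbol hK
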